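/- \textbf{Theorem (Parallel Swap Test).} \emph{Model.} A quantum circuit acts on $n$ index qubits, $m$ output qubits and any number $w$ of work qubits, all initially $|0\rangle$; the index register holds the binary number $j$. Let $N\ge 1$ with $N\le 2^n$, let $|u_j\rangle,|v_j\rangle$ $(0\le j<N)$ be $2N$ (complex) states of $d$ qubits, let $U_j,V_j$ be unitaries with $U_j|0^d\rangle=|u_j\rangle$ and $V_j|0^d\rangle=|v_j\rangle$, and let $f_0,\dots,f_{N-1}:\mathbb{C}\to\{0,1\}^m$ be arbitrary functions. The instructions of a circuit and their running times are: (i) any unitary on at most three qubits, time $1$; (ii) preparation: $\sum_{j}|j\rangle\langle j|\otimes U_j$, or the same with $V_j$, $U_j^{-1}$ or $V_j^{-1}$, controlled by the index register and by one work qubit and applied to any $d$ other work qubits, time $T_{\rm in}$; (iii) evaluation: $|j\rangle|x\rangle|y\rangle|b\rangle\mapsto|j\rangle|x\rangle|y\rangle|b\oplus f_j(\sigma(x)+\mathbf{i}\,\tau(y))\rangle$, where $x,y$ are the contents of two work registers of $k$ and $l$ qubits and $\sigma:\{0,1\}^k\to\mathbb{R}$, $\tau:\{0,1\}^l\to\mathbb{R}$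 are any tables giving the numbers they encode, time $2^k+2^l$ (the size of the tables; computing values of $f_j$ is not charged further). Instructions (ii) and (iii) act as the identity on index contents $j\ge N$. The running time of a circuit is the sum of the times of its instructions. The time $T_{\rm in}$ is any real number with $T_{\rm in}\ge 1$ and $T_{\rm in}\ge n+d$, i.e. at least the number of index and data qubits involved in a preparation. \emph{Claim.} For every $\delta>0$ there are a constant $C>0$ and an integer $R\ge1$, depending only on $\delta$, such that for all $N\ge 1$, $n$ with $N\le 2^n$, $d$, $m$ and $0<\varepsilon\le1$ there are $w$ and circuits $P_1,\dots,P_R$ (a quantum algorithm with a random seed $r\in\{1,\dots,R\}$), which do not depend on $u_j,v_j,U_j,V_j,f_j$ or $T_{\rm in}$, such that: \begin{itemize} \item every $P_r$ has running time at most $C\,T_{\rm in}/\varepsilon$, for every admissible $T_{\rm in}$; \item for all $u_j,v_j,U_j,V_j,f_j$ as above, for at least $(1-\delta)R$ of the seeds $r$ there are $s_0,\dots,s_{N-1}\in\mathbb{C}$ with $|s_j-\langle u_j|v_j\rangle|\le\varepsilon$ for all $j$, such that the final state of $P_r$ is within distance $\delta$, in the $2$-norm, of \[\frac{1}{\sqrt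 N}\sum_{j=0}^{N-1}|j\rangle|f_j(s_j)\rangle|0^w\rangle .\] \end{itemize} -/

import Mathlib

noncomputable section

namespace ParallelSwapTest

/-- The qubits of a circuit: `n` index qubits (holding `j`), `m` output qubits, `w` work qubits. -/
abbrev Qubit (n m w : ℕ) : Type := Fin n ⊕ Fin m ⊕ Fin w

/-- Computational basis labels of a circuit. -/
abbrev Label (n m w : ℕ) : Type := Qubit n m w → Bool

/-- Pure states (vectors of amplitudes, with the 2-norm). -/
abbrev State (n m w : ℕ) : Type := EuclideanSpace ℂ (Label n m w)

section registers

variable {n m w : ℕ}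

/-- The number written, in binary, in the index register of a basis label. -/
def indexValue (x : Label n m w) : ℕ := Nat.ofBits fun i : Fin n => x (Sum.inl i)

/-- The content of the output register of a basis label. -/
def outPart (x : Label n m w) : Fin m → Bool := fun i => x (Sum.inr (Sum.inl i))

/-- The content of the work register of a basis label. -/
def workPart (x : Label n m w) : Fin w → Bool := fun i => x (Sum.inr (Sum.inr i))

/-- The label obtained from `x` by adding `b` bitwise (modulo 2) to the output register. -/
def xorOut (x : Label n m w) (b : Fin m → Bool) : Label n m w
  | Sum.inl i => x (Sum.inl i)
  | Sum.inr (Sum.inl i) => xor (x (Sum.inr (Sum.inl i))) (b i)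
  | Sum.inr (Sum.inr i) => x (Sum.inr (Sum.inr i))

/-- The placement of some work qubits among all qubits. -/
def workQubits {k : ℕ} (e : Fin k ↪ Fin w) : Fin k ↪ Qubit n m w :=
  e.trans (Function.Embedding.inr.trans Function.Embedding.inr)

/-- The operator `M` on `k` qubits, applied to the qubits `e 0, …, e (k - 1)` and tensored with the
identity on all others: `(M ψ)(x) = ∑ a, M (x restricted to e) a * ψ (x with a written on e)`. -/
def applyOn {k : ℕ} (e : Fin k ↪ Qubit n m w) (M : Matrix (Fin k → Bool) (Fin k → Bool) ℂ)
    (ψ : State n m w) : State n m w :=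
  WithLp.toLp 2 fun x => ∑ a : Fin k → Bool, M (fun i => x (e i)) a * ψ (Function.extend e a x)

end registers

/-- The two families of states. -/
inductive Side : Type
  | left
  | right

/-- What an algorithm has access to: unitaries `U j`, `V j` on `d` qubits (which prepare the states
of the two families), and the functions `f j`, whose values are `m`-bit strings. -/
structure Access (N d m : ℕ) where
  U : Fin N → Matrix.unitaryGroup (Fin d → Bool) ℂ
  V : Fin N → Matrix.unitaryGroup (Fin d → Bool) ℂ
  f : Fin N → ℂ → (Fin m → Bool)

/-- The family of preparation unitaries that belongs to a side. -/
def Access.family {N d m : ℕ} (O : Access N d m) :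
    Side → Fin N → Matrix.unitaryGroup (Fin d → Bool) ℂ
  | Side.left => O.U
  | Side.right => O.V

/-- The instructions of a circuit.
* `elementary`: an arbitrary unitary on at most three qubits.
* `prepare`: if the control qubit is `1`, apply `U j` (or `V j`, or the inverse of one of them) to
  `d` work qubits, where `j` is the content of the index register.
* `evaluate`: add `f j (σ x + i τ y)` to the output register, where `j` is the content of the index
  register, `x` and `y` are the contents of two registers of `k` and `l` work qubits, and the real
  numbers `σ x`, `τ y` which they encode are given by two tables. -/
inductive Gate (n d m w : ℕ) : Type
  | elementary (k : ℕ) (hk : k ≤ 3) (e : Fin k ↪ Qubit n m w)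
      (M : Matrix.unitaryGroup (Fin k → Bool) ℂ)
  | prepare (side : Side) (inverse : Bool) (control : Fin w) (data : Fin d ↪ Fin w)
      (h : control ∉ Set.range data)
  | evaluate (k l : ℕ) (x : Fin k ↪ Fin w) (y : Fin l ↪ Fin w)
      (σ : (Fin k → Bool) → ℝ) (τ : (Fin l → Bool) → ℝ)

/-- The action of an instruction on states. On index contents which are not below `N`, the
instructions `prepare` and `evaluate` do nothing. -/
def Gate.apply {N n d m w : ℕ} (O : Access N d m) : Gate n d m w → State n m w → State n m w
  | Gate.elementary _ _ e M, ψ => applyOn e M.1 ψ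
  | Gate.prepare side inverse control data _, ψ =>
      WithLp.toLp 2 fun x =>
        if h : indexValue x < N then
          if workPart x control = true then
            applyOn (workQubits data)
              (if inverse = true then (O.family side ⟨indexValue x, h⟩)⁻¹.1
                else (O.family side ⟨indexValue x, h⟩).1) ψ x
          else ψ x
        else ψ x
  | Gate.evaluate _ _ x y σ τ, ψ =>
      WithLp.toLp 2 fun z =>
        if h : indexValue z < N then
          ψ (xorOut z (O.f ⟨indexValue z, h⟩
            ((σ fun i => workPart z (x i)) + (τ fun i => workPart z (y i)) * Complex.I)))
        else ψ z

/-- The time taken by an instruction, if one preparation takes time `T`. An evaluation is charged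
the sizes of its two tables. -/
def Gate.time {n d m w : ℕ} (T : ℝ) : Gate n d m w → ℝ
  | Gate.elementary _ _ _ _ => 1
  | Gate.prepare _ _ _ _ _ => T
  | Gate.evaluate k l _ _ _ _ => 2 ^ k + 2 ^ l

/-- A quantum circuit is a list of instructions, executed from left to right. It is written down
without knowledge of the unitaries and functions that its instructions call. -/
abbrev Circuit (n d m w : ℕ) : Type := List (Gate n d m w)

/-- The running time of a circuit. -/
def Circuit.time {n d m w : ℕ} (T : ℝ) (P : Circuit n d m w) : ℝ :=
  (P.map (Gate.time T)).sum

/-- The final state of a circuit started on the all-zero basis state. -/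
def Circuit.run {N n d m w : ℕ} (O : Access N d m) (P : Circuit n d m w) : State n m w :=
  P.foldl (fun ψ g => g.apply O ψ) (EuclideanSpace.single (fun _ => false) 1)

/-- The state `N^{-1/2} ∑ j, |j⟩ |b j⟩ |0…0⟩` (index, output and work registers). -/
def uniformState {N m : ℕ} (n w : ℕ) (b : Fin N → Fin m → Bool) : State n m w :=
  WithLp.toLp 2 fun x =>
    if h : indexValue x < N then
      if outPart x = b ⟨indexValue x, h⟩ ∧ workPart x = fun _ => false then
        ((1 / Real.sqrt N : ℝ) : ℂ)
      else 0
    else 0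

/-- The unitary `W` prepares the state `u`, that is, `W |0…0⟩ = u`. -/
def Prepares {d : ℕ} (W : Matrix.unitaryGroup (Fin d → Bool) ℂ)
    (u : EuclideanSpace ℂ (Fin d → Bool)) : Prop :=
  ∀ a, W.1 a (fun _ => false) = u a

end ParallelSwapTest

end

set_option linter.unusedSectionVars false

noncomputable section

namespace ParallelSwapTest

open Function

/-- States of a finite set `Q` of qubits. -/
abbrev QState (Q : Type) [Fintype Q] [DecidableEq Q] : Type := EuclideanSpace ℂ (Q → Bool)

section operators

variable {Q ι : Type} [Fintype Q] [DecidableEq Q] [Fintype ι] [DecidableEq ι]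

theorem extend_comp_self (e : ι ↪ Q) (x : Q → Bool) : extend e (fun i => x (e i)) x = x := by
  funext q
  by_cases h : ∃ i, e i = q
  · obtain ⟨i, rfl⟩ := h
    rw [e.injective.extend_apply]
  · rw [extend_apply' _ _ _ h]

theorem extend_extend (e : ι ↪ Q) (a b : ι → Bool) (x : Q → Bool) :
    extend e b (extend e a x) = extend e b x := by
  funext q
  by_cases h : ∃ i, e i = q
  · obtain ⟨i, rfl⟩ := h
    rw [e.injective.extend_apply, e.injective.extend_apply]
  · rw [extend_apply' _ _ _ h, extend_apply' _ _ _ h, extend_apply' _ _ _ h]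

theorem extend_restrict (e : ι ↪ Q) (a : ι → Bool) (x : Q → Bool) :
    (fun i => extend e a x (e i)) = a := by
  funext i
  rw [e.injective.extend_apply]

/-- The linear map which applies to the qubits `e` the matrix `M x`, where `x` is the label. -/
def ctrlMap (e : ι ↪ Q) (M : (Q → Bool) → Matrix (ι → Bool) (ι → Bool) ℂ) :
    QState Q →ₗ[ℂ] QState Q where
  toFun ψ := WithLp.toLp 2 fun x => ∑ a, M x (fun i => x (e i)) a * ψ (extend e a x)
  map_add' ψ φ := by
    ext x
    simp [mul_add, Finset.sum_add_distrib]
  map_smul' c ψ := by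
    ext x
    simp only [PiLp.smul_apply, smul_eq_mul, RingHom.id_apply, Finset.mul_sum]
    exact Finset.sum_congr rfl fun a _ => by ring

theorem ctrlMap_apply (e : ι ↪ Q) (M : (Q → Bool) → Matrix (ι → Bool) (ι → Bool) ℂ)
    (ψ : QState Q) (x : Q → Bool) :
    ctrlMap e M ψ x = ∑ a, M x (fun i => x (e i)) a * ψ (extend e a x) := rfl

theorem ctrlMap_one (e : ι ↪ Q) (ψ : QState Q) : ctrlMap e (fun _ => 1) ψ = ψ := by
  ext x
  rw [ctrlMap_apply, Finset.sum_eq_single (fun i => x (e i))]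
  · simp [extend_comp_self]
  · intro b _ hb
    rw [Matrix.one_apply_ne hb.symm, zero_mul]
  · simp

theorem ctrlMap_ctrlMap (e : ι ↪ Q) (M M' : (Q → Bool) → Matrix (ι → Bool) (ι → Bool) ℂ)
    (hM' : ∀ x a, M' (extend e a x) = M' x) (ψ : QState Q) :
    ctrlMap e M (ctrlMap e M' ψ) = ctrlMap e (fun x => M x * M' x) ψ := by
  ext x
  simp only [ctrlMap_apply, hM', extend_extend, extend_restrict, Matrix.mul_apply, Finset.mul_sum,
    Finset.sum_mul]
  rw [Finset.sum_comm]
  exact Finset.sum_congr rfl fun a _ => Finset.sum_congr rfl fun b _ => by ring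

theorem inner_ctrlMap (e : ι ↪ Q) (M : (Q → Bool) → Matrix (ι → Bool) (ι → Bool) ℂ)
    (hM : ∀ x a, M (extend e a x) = M x) (φ ψ : QState Q) :
    inner ℂ (ctrlMap e M φ) ψ = inner ℂ φ (ctrlMap e (fun x => star (M x)) ψ) := by
  simp only [PiLp.inner_apply, ctrlMap_apply, RCLike.inner_apply, map_sum, Finset.mul_sum,
    Finset.sum_mul, map_mul]
  rw [← Finset.sum_product', ← Finset.sum_product']
  refine Finset.sum_bij' (fun p _ => (extend e p.2 p.1, fun i => p.1 (e i)))
    (fun p _ => (extend e p.2 p.1, fun i => p.1 (e i))) (by simp) (by simp) ?_ ?_ ?_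
  · rintro ⟨x, a⟩ _
    simp [extend_extend, extend_comp_self, extend_restrict]
  · rintro ⟨x, a⟩ _
    simp [extend_extend, extend_comp_self, extend_restrict]
  · rintro ⟨x, a⟩ _
    simp only [extend_extend, extend_comp_self, extend_restrict, hM, Matrix.star_apply,
      RCLike.star_def]
    ring

/-- The unitary operator which applies to the qubits `e` the unitary `M x`, where the label `x`
enters through qubits outside `e` only. -/
def ctrl (e : ι ↪ Q) (M : (Q → Bool) → Matrix.unitaryGroup (ι → Bool) ℂ)
    (hM : ∀ x a, M (extend e a x) = M x) : QState Q ≃ₗᵢ[ℂ] QState Q where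
  toLinearEquiv := LinearEquiv.ofLinearMap (ctrlMap e fun x => (M x).1)
    (ctrlMap e fun x => star (M x).1)
    (by
      ext1 ψ
      rw [LinearMap.comp_apply, ctrlMap_ctrlMap _ _ _ (fun x a => by rw [hM])]
      simp [ctrlMap_one])
    (by
      ext1 ψ
      rw [LinearMap.comp_apply, ctrlMap_ctrlMap _ _ _ (fun x a => by rw [hM])]
      simp [ctrlMap_one])
  norm_map' ψ := by
    have h : inner ℂ (ctrlMap e (fun x => (M x).1) ψ) (ctrlMap e (fun x => (M x).1) ψ)
        = inner ℂ ψ ψ := by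
      rw [inner_ctrlMap _ _ (fun x a => by rw [hM]), ctrlMap_ctrlMap _ _ _ (fun x a => by rw [hM])]
      simp [ctrlMap_one]
    rw [inner_self_eq_norm_sq_to_K, inner_self_eq_norm_sq_to_K] at h
    have h' : ‖ctrlMap e (fun x => (M x).1) ψ‖ ^ 2 = ‖ψ‖ ^ 2 := by exact_mod_cast h
    exact (sq_eq_sq₀ (norm_nonneg _) (norm_nonneg _)).1 h'

theorem ctrl_apply (e : ι ↪ Q) (M : (Q → Bool) → Matrix.unitaryGroup (ι → Bool) ℂ)
    (hM : ∀ x a, M (extend e a x) = M x) (ψ : QState Q) (x : Q → Bool) :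
    ctrl e M hM ψ x = ∑ a, (M x).1 (fun i => x (e i)) a * ψ (extend e a x) := rfl

theorem ctrl_symm (e : ι ↪ Q) (M : (Q → Bool) → Matrix.unitaryGroup (ι → Bool) ℂ)
    (hM : ∀ x a, M (extend e a x) = M x) :
    (ctrl e M hM).symm = ctrl e (fun x => (M x)⁻¹) (fun x a => by rw [hM]) := by
  ext1 ψ
  rw [LinearIsometryEquiv.symm_apply_eq]
  have h := ctrlMap_ctrlMap e (fun x => (M x).1) (fun x => ((M x)⁻¹).1)
    (fun x a => by rw [hM]) ψ
  have h1 : (fun x => (M x).1 * ((M x)⁻¹).1) = fun _ => 1 := by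
    funext x
    exact Matrix.mem_unitaryGroup_iff.1 (M x).2
  rw [h1, ctrlMap_one] at h
  exact h.symm

/-- The embedding of a single qubit. -/
def oneQubit (q : Q) : Unit ↪ Q := ⟨fun _ => q, fun _ _ _ => rfl⟩

theorem extend_oneQubit (q : Q) (a : Unit → Bool) (x : Q → Bool) :
    extend (oneQubit q) a x = update x q (a ()) := by
  funext r
  by_cases h : r = q
  · subst h
    rw [update_self]
    exact (oneQubit r).injective.extend_apply a x ()
  · rw [update_of_ne h, extend_apply']
    rintro ⟨_, h'⟩
    exact h h'.symm

/-- A unitary on `Bool`, regarded as a unitary on one qubit. -/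
def unitUnitary (u : Matrix.unitaryGroup Bool ℂ) : Matrix.unitaryGroup (Unit → Bool) ℂ :=
  ⟨u.1.submatrix (fun a => a ()) (fun a => a ()), by
    rw [Matrix.mem_unitaryGroup_iff, Matrix.star_eq_conjTranspose, Matrix.conjTranspose_submatrix,
      ← Matrix.star_eq_conjTranspose]
    rw [show (fun a : Unit → Bool => a ()) = Equiv.funUnique Unit Bool from rfl,
      Matrix.submatrix_mul_equiv, Matrix.mem_unitaryGroup_iff.1 u.2,
      Matrix.submatrix_one_equiv]⟩

/-- The operator which applies to the qubit `q` the unitary `u x`, where the label `x` enters through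
other qubits only. -/
def target (q : Q) (u : (Q → Bool) → Matrix.unitaryGroup Bool ℂ)
    (hu : ∀ x b, u (update x q b) = u x) : QState Q ≃ₗᵢ[ℂ] QState Q :=
  ctrl (oneQubit q) (fun x => unitUnitary (u x)) (fun x a => by rw [extend_oneQubit, hu])

theorem target_apply (q : Q) (u : (Q → Bool) → Matrix.unitaryGroup Bool ℂ)
    (hu : ∀ x b, u (update x q b) = u x) (ψ : QState Q) (x : Q → Bool) :
    target q u hu ψ x = (u x).1 (x q) false * ψ (update x q false)
      + (u x).1 (x q) true * ψ (update x q true) := by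
  rw [target, ctrl_apply, ← Equiv.sum_comp (Equiv.funUnique Unit Bool).symm]
  simp only [extend_oneQubit, Fintype.sum_bool, unitUnitary, Matrix.submatrix_apply]
  rw [add_comm]
  rfl

/-- The composition of a state, as a function of labels, with a map of labels. -/
def pull (τ : (Q → Bool) → (Q → Bool)) : QState Q →ₗ[ℂ] QState Q where
  toFun ψ := WithLp.toLp 2 fun x => ψ (τ x)
  map_add' _ _ := rfl
  map_smul' _ _ := rfl

/-- The multiplication of a state by a function of labels. -/
def mulFn (g : (Q → Bool) → ℂ) : QState Q →ₗ[ℂ] QState Q where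
  toFun ψ := WithLp.toLp 2 fun x => g x * ψ x
  map_add' ψ φ := by
    ext x
    simp [mul_add]
  map_smul' c ψ := by
    ext x
    simp only [PiLp.smul_apply, smul_eq_mul, RingHom.id_apply]
    ring

@[simp]
theorem pull_apply (τ : (Q → Bool) → (Q → Bool)) (ψ : QState Q) (x : Q → Bool) :
    pull τ ψ x = ψ (τ x) := rfl

@[simp]
theorem mulFn_apply (g : (Q → Bool) → ℂ) (ψ : QState Q) (x : Q → Bool) :
    mulFn g ψ x = g x * ψ x := rfl

/-- Two labels agree outside `S`. -/
def AgreeOff (S : Set Q) (x y : Q → Bool) : Prop := ∀ q ∉ S, x q = y q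

/-- An operator acts on the qubits in `S` only, and in a way which depends only on them and on the
qubits in `I`. -/
structure SupportedOn (I S : Set Q) (F : QState Q ≃ₗᵢ[ℂ] QState Q) : Prop where
  pull_comm : ∀ τ : (Q → Bool) → (Q → Bool), (∀ x, ∀ q ∈ S ∪ I, τ x q = x q) →
    (∀ x y, AgreeOff S x y → AgreeOff S (τ x) (τ y)) → ∀ ψ, F (pull τ ψ) = pull τ (F ψ)
  mulFn_comm : ∀ g : (Q → Bool) → ℂ, (∀ x y, AgreeOff S x y → g x = g y) →
    ∀ ψ, F (mulFn g ψ) = mulFn g (F ψ)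

theorem SupportedOn.trans {I S : Set Q} {F G : QState Q ≃ₗᵢ[ℂ] QState Q}
    (hF : SupportedOn I S F) (hG : SupportedOn I S G) : SupportedOn I S (F.trans G) where
  pull_comm τ h h' ψ := by
    rw [LinearIsometryEquiv.trans_apply, hF.pull_comm τ h h', hG.pull_comm τ h h']
    rfl
  mulFn_comm g h ψ := by
    rw [LinearIsometryEquiv.trans_apply, hF.mulFn_comm g h, hG.mulFn_comm g h]
    rfl

theorem SupportedOn.symm {I S : Set Q} {F : QState Q ≃ₗᵢ[ℂ] QState Q}
    (hF : SupportedOn I S F) : SupportedOn I S F.symm where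
  pull_comm τ h h' ψ := by
    rw [LinearIsometryEquiv.symm_apply_eq, hF.pull_comm τ h h', F.apply_symm_apply]
  mulFn_comm g h ψ := by
    rw [LinearIsometryEquiv.symm_apply_eq, hF.mulFn_comm g h, F.apply_symm_apply]

theorem SupportedOn.refl (I S : Set Q) : SupportedOn I S (LinearIsometryEquiv.refl ℂ (QState Q)) :=
  ⟨fun _ _ _ _ => rfl, fun _ _ _ => rfl⟩

theorem SupportedOn.mono {I S S' : Set Q} {F : QState Q ≃ₗᵢ[ℂ] QState Q}
    (hF : SupportedOn I S F) (h : S ⊆ S') : SupportedOn I S' F where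
  pull_comm τ h1 h2 ψ := by
    refine hF.pull_comm τ (fun x q hq => h1 x q (hq.imp (fun a => h a) id)) ?_ ψ
    intro x y hxy q hq
    by_cases hq' : q ∈ S'
    · rw [h1 x q (Or.inl hq'), h1 y q (Or.inl hq'), hxy q hq]
    · exact h2 x y (fun r hr => hxy r fun hr' => hr (h hr')) q hq'
  mulFn_comm g h1 ψ :=
    hF.mulFn_comm g (fun x y hxy => h1 x y fun r hr => hxy r fun hr' => hr (h hr')) ψ

theorem supportedOn_ctrl (I S : Set Q) (e : ι ↪ Q)
    (M : (Q → Bool) → Matrix.unitaryGroup (ι → Bool) ℂ)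
    (hM : ∀ x a, M (extend e a x) = M x) (he : ∀ i, e i ∈ S)
    (hMS : ∀ x y, (∀ q ∈ S ∪ I, x q = y q) → M x = M y) : SupportedOn I S (ctrl e M hM) where
  pull_comm τ h h' ψ := by
    ext x
    simp only [ctrl_apply, pull_apply]
    rw [hMS (τ x) x (h x)]
    refine Finset.sum_congr rfl fun a _ => ?_
    have h1 : (fun i => τ x (e i)) = fun i => x (e i) := by
      funext i
      exact h x _ (Or.inl (he i))
    have h2 : τ (extend e a x) = extend e a (τ x) := by
      funext q
      by_cases hq : ∃ i, e i = q
      · obtain ⟨i, rfl⟩ := hq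
        rw [h _ _ (Or.inl (he i)), e.injective.extend_apply, e.injective.extend_apply]
      · rw [extend_apply' _ _ _ hq]
        by_cases hqS : q ∈ S
        · rw [h _ _ (Or.inl hqS), h _ _ (Or.inl hqS), extend_apply' _ _ _ hq]
        · refine h' _ _ ?_ q hqS
          intro r hr
          rw [extend_apply']
          rintro ⟨i, rfl⟩
          exact hr (he i)
    rw [h1, h2]
  mulFn_comm g h ψ := by
    ext x
    simp only [ctrl_apply, mulFn_apply, Finset.mul_sum]
    refine Finset.sum_congr rfl fun a _ => ?_
    rw [h (extend e a x) x ?_]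
    · ring
    · intro r hr
      rw [extend_apply']
      rintro ⟨i, rfl⟩
      exact hr (he i)

theorem supportedOn_target (I S : Set Q) (q : Q) (u : (Q → Bool) → Matrix.unitaryGroup Bool ℂ)
    (hu : ∀ x b, u (update x q b) = u x) (hq : q ∈ S)
    (huS : ∀ x y, (∀ q ∈ S ∪ I, x q = y q) → u x = u y) : SupportedOn I S (target q u hu) :=
  supportedOn_ctrl I S _ _ _ (fun _ => hq) fun x y h => by rw [huS x y h]

end operators

section gates

variable {N n d m w : ℕ}

theorem extend_workQubits_inl {k : ℕ} (e : Fin k ↪ Fin w) (a : Fin k → Bool) (x : Label n m w)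
    (i : Fin n) : extend (workQubits e) a x (Sum.inl i) = x (Sum.inl i) := by
  rw [extend_apply']
  rintro ⟨l, hl⟩
  exact absurd hl (by simp [workQubits])

theorem extend_workQubits_of_notMem {k : ℕ} (e : Fin k ↪ Fin w) (a : Fin k → Bool)
    (x : Label n m w) (i : Fin w) (hi : i ∉ Set.range e) :
    extend (workQubits e) a x (Sum.inr (Sum.inr i)) = x (Sum.inr (Sum.inr i)) := by
  rw [extend_apply']
  rintro ⟨l, hl⟩
  exact hi ⟨l, by simpa [workQubits] using hl⟩

theorem indexValue_congr {x y : Label n m w} (h : ∀ i : Fin n, x (Sum.inl i) = y (Sum.inl i)) :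
    indexValue x = indexValue y := by
  unfold indexValue
  exact congrArg Nat.ofBits (funext h)

/-- The unitary which a preparation applies, as a function of the label. -/
def prepUnitary (O : Access N d m) (side : Side) (inverse : Bool) (control : Fin w)
    (x : Label n m w) : Matrix.unitaryGroup (Fin d → Bool) ℂ :=
  if h : indexValue x < N then
    if workPart x control = true then
      if inverse = true then (O.family side ⟨indexValue x, h⟩)⁻¹ else O.family side ⟨indexValue x, h⟩
    else 1
  else 1

theorem prepUnitary_congr (O : Access N d m) (side : Side) (inverse : Bool) (control : Fin w)
    {x y : Label n m w} (h : ∀ i : Fin n, x (Sum.inl i) = y (Sum.inl i))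
    (h' : x (Sum.inr (Sum.inr control)) = y (Sum.inr (Sum.inr control))) :
    prepUnitary O side inverse control x = prepUnitary O side inverse control y := by
  have h1 := indexValue_congr h
  simp only [prepUnitary, workPart, h1, h']
  rfl

/-- A preparation, as a unitary operator. -/
def prepOp (O : Access N d m) (side : Side) (inverse : Bool) (control : Fin w)
    (data : Fin d ↪ Fin w) (h : control ∉ Set.range data) : State n m w ≃ₗᵢ[ℂ] State n m w :=
  ctrl (workQubits data) (prepUnitary O side inverse control) fun x a =>
    prepUnitary_congr _ _ _ _ (extend_workQubits_inl data a x)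
      (extend_workQubits_of_notMem data a x _ h)

theorem apply_prepare (O : Access N d m) (side : Side) (inverse : Bool) (control : Fin w)
    (data : Fin d ↪ Fin w) (h : control ∉ Set.range data) (ψ : State n m w) :
    (Gate.prepare side inverse control data h).apply O ψ
      = prepOp O side inverse control data h ψ := by
  ext x
  have h1 : ∑ a, (1 : Matrix.unitaryGroup (Fin d → Bool) ℂ).1
      (fun i => x (workQubits data i)) a * ψ (extend (workQubits data) a x) = ψ x := by
    have := congrArg (fun φ : State n m w => φ x) (ctrlMap_one (workQubits data) ψ)
    simpa [ctrlMap_apply] using this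
  simp only [Gate.apply, prepOp, ctrl_apply, prepUnitary]
  split_ifs with h2 h3 h4
  · simp [applyOn]
  · simp [applyOn]
  · exact h1.symm
  · exact h1.symm

@[simp]
theorem indexValue_xorOut (x : Label n m w) (b : Fin m → Bool) :
    indexValue (xorOut x b) = indexValue x := rfl

@[simp]
theorem workPart_xorOut (x : Label n m w) (b : Fin m → Bool) :
    workPart (xorOut x b) = workPart x := rfl

theorem xorOut_xorOut (x : Label n m w) (b : Fin m → Bool) : xorOut (xorOut x b) b = x := by
  funext q
  rcases q with i | i | i <;> simp [xorOut]

/-- The involution of labels which adds to the output a function of the index and of the work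
register. -/
def xorPerm (b : ℕ → (Fin w → Bool) → Fin m → Bool) : Equiv.Perm (Label n m w) :=
  Involutive.toPerm (fun x => xorOut x (b (indexValue x) (workPart x))) fun x => by
    simp [xorOut_xorOut]

/-- The operator which adds to the output a function of the index and of the work register. -/
def xorOp (b : ℕ → (Fin w → Bool) → Fin m → Bool) : State n m w ≃ₗᵢ[ℂ] State n m w :=
  LinearIsometryEquiv.piLpCongrLeft 2 ℂ ℂ (xorPerm b)

theorem xorOp_apply (b : ℕ → (Fin w → Bool) → Fin m → Bool) (ψ : State n m w) (x : Label n m w) :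
    xorOp b ψ x = ψ (xorOut x (b (indexValue x) (workPart x))) := rfl

/-- The bits which an evaluation adds to the output. -/
def evalBits (O : Access N d m) (s : (Fin w → Bool) → ℂ) (j : ℕ) (z : Fin w → Bool) : Fin m → Bool :=
  if h : j < N then O.f ⟨j, h⟩ (s z) else fun _ => false

theorem xorOut_false (x : Label n m w) : xorOut x (fun _ => false) = x := by
  funext q
  rcases q with i | i | i <;> simp [xorOut]

theorem apply_evaluate (O : Access N d m) (k l : ℕ) (x : Fin k ↪ Fin w) (y : Fin l ↪ Fin w)
    (σ : (Fin k → Bool) → ℝ) (τ : (Fin l → Bool) → ℝ) (ψ : State n m w) :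
    (Gate.evaluate k l x y σ τ).apply O ψ
      = xorOp (evalBits O fun z => (σ fun i => z (x i)) + (τ fun i => z (y i)) * Complex.I) ψ := by
  ext z
  simp only [Gate.apply, xorOp_apply, evalBits]
  split_ifs with h
  · rfl
  · rw [xorOut_false]

/-- The action of an instruction, as a unitary operator. -/
def Gate.op (O : Access N d m) : Gate n d m w → (State n m w ≃ₗᵢ[ℂ] State n m w)
  | Gate.elementary _ _ e M => ctrl e (fun _ => M) fun _ _ => rfl
  | Gate.prepare side inverse control data h => prepOp O side inverse control data h
  | Gate.evaluate _ _ x y σ τ =>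
      xorOp (evalBits O fun z => (σ fun i => z (x i)) + (τ fun i => z (y i)) * Complex.I)

theorem Gate.apply_eq_op (O : Access N d m) (g : Gate n d m w) (ψ : State n m w) :
    g.apply O ψ = g.op O ψ := by
  cases g with
  | elementary k hk e M => rfl
  | prepare side inverse control data h => exact apply_prepare O side inverse control data h ψ
  | evaluate k l x y σ τ => exact apply_evaluate O k l x y σ τ ψ

/-- The inverse instruction. -/
def Gate.inv : Gate n d m w → Gate n d m w
  | Gate.elementary k hk e M => Gate.elementary k hk e M⁻¹
  | Gate.prepare side inverse control data h => Gate.prepare side (!inverse) control data h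
  | Gate.evaluate k l x y σ τ => Gate.evaluate k l x y σ τ

theorem prepUnitary_not (O : Access N d m) (side : Side) (inverse : Bool) (control : Fin w)
    (x : Label n m w) :
    prepUnitary O side (!inverse) control x = (prepUnitary O side inverse control x)⁻¹ := by
  unfold prepUnitary
  cases inverse <;> split_ifs <;> simp_all

theorem Gate.op_inv (O : Access N d m) (g : Gate n d m w) : g.inv.op O = (g.op O).symm := by
  cases g with
  | elementary k hk e M => exact (ctrl_symm e (fun _ => M) fun _ _ => rfl).symm
  | prepare side inverse control data h =>
    rw [Gate.op, prepOp, ctrl_symm]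
    simp only [← prepUnitary_not]
    rfl
  | evaluate k l x y σ τ =>
    ext1 ψ
    rw [LinearIsometryEquiv.eq_symm_apply]
    ext z
    simp only [Gate.op, Gate.inv, xorOp_apply, indexValue_xorOut, workPart_xorOut, xorOut_xorOut]

theorem Gate.time_inv (T : ℝ) (g : Gate n d m w) : g.inv.time T = g.time T := by
  cases g <;> rfl

/-- A family of operators is the action of a circuit, whose running time is at most `a + b T`. -/
def Impl (a b : ℝ) (F : Access N d m → (State n m w ≃ₗᵢ[ℂ] State n m w)) : Prop :=
  ∃ P : Circuit n d m w, (∀ T, 0 ≤ T → Circuit.time T P ≤ a + b * T) ∧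
    ∀ O ψ, P.foldl (fun ψ g => g.apply O ψ) ψ = F O ψ

theorem Impl.refl : Impl (N := N) (n := n) (d := d) (m := m) (w := w) 0 0
    (fun _ => LinearIsometryEquiv.refl ℂ _) :=
  ⟨[], fun T _ => by simp [Circuit.time], fun O ψ => rfl⟩

theorem Impl.trans {a b a' b' : ℝ} {F G : Access N d m → (State n m w ≃ₗᵢ[ℂ] State n m w)}
    (hF : Impl a b F) (hG : Impl a' b' G) :
    Impl (a + a') (b + b') (fun O => (F O).trans (G O)) := by
  obtain ⟨P, hP, hP'⟩ := hF
  obtain ⟨P', hQ, hQ'⟩ := hG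
  refine ⟨P ++ P', fun T hT => ?_, fun O ψ => ?_⟩
  · have h1 := hP T hT
    have h2 := hQ T hT
    simp only [Circuit.time, List.map_append, List.sum_append] at *
    linarith
  · rw [List.foldl_append, hP', hQ']
    rfl

theorem Impl.mono {a b a' b' : ℝ} {F : Access N d m → (State n m w ≃ₗᵢ[ℂ] State n m w)}
    (hF : Impl a b F) (ha : a ≤ a') (hb : b ≤ b') : Impl a' b' F := by
  obtain ⟨P, hP, hP'⟩ := hF
  refine ⟨P, fun T hT => (hP T hT).trans ?_, hP'⟩
  gcongr

theorem Impl.congr {a b : ℝ} {F G : Access N d m → (State n m w ≃ₗᵢ[ℂ] State n m w)}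
    (hF : Impl a b F) (h : ∀ O ψ, F O ψ = G O ψ) : Impl a b G := by
  obtain ⟨P, hP, hP'⟩ := hF
  exact ⟨P, hP, fun O ψ => (hP' O ψ).trans (h O ψ)⟩

theorem foldl_inv (O : Access N d m) (P : Circuit n d m w) (ψ : State n m w) :
    (P.map Gate.inv).reverse.foldl (fun ψ g => g.apply O ψ)
      (P.foldl (fun ψ g => g.apply O ψ) ψ) = ψ := by
  induction P generalizing ψ with
  | nil => rfl
  | cons g P ih =>
    rw [List.map_cons, List.reverse_cons, List.foldl_append, List.foldl_cons (l := P), ih]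
    simp [Gate.apply_eq_op, Gate.op_inv]

theorem Impl.symm {a b : ℝ} {F : Access N d m → (State n m w ≃ₗᵢ[ℂ] State n m w)}
    (hF : Impl a b F) : Impl a b (fun O => (F O).symm) := by
  obtain ⟨P, hP, hP'⟩ := hF
  refine ⟨(P.map Gate.inv).reverse, fun T hT => ?_, fun O ψ => ?_⟩
  · refine le_of_eq_of_le ?_ (hP T hT)
    simp only [Circuit.time, List.map_reverse, List.sum_reverse, List.map_map]
    congr 2
    funext g
    exact Gate.time_inv T g
  · have h := foldl_inv O P ((F O).symm ψ)
    rwa [hP', LinearIsometryEquiv.apply_symm_apply] at h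

theorem impl_prepare (side : Side) (inverse : Bool) (control : Fin w)
    (data : Fin d ↪ Fin w) (h : control ∉ Set.range data) :
    Impl (N := N) (n := n) (m := m) 0 1 (fun O => prepOp O side inverse control data h) :=
  ⟨[Gate.prepare side inverse control data h],
    fun T _ => by simp [Circuit.time, Gate.time], fun O ψ => apply_prepare O _ _ _ _ _ ψ⟩

theorem impl_evaluate (k l : ℕ) (x : Fin k ↪ Fin w) (y : Fin l ↪ Fin w)
    (σ : (Fin k → Bool) → ℝ) (τ : (Fin l → Bool) → ℝ) :
    Impl (N := N) (n := n) (d := d) (m := m) (2 ^ k + 2 ^ l) 0 (fun O =>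
      xorOp (evalBits O fun z => (σ fun i => z (x i)) + (τ fun i => z (y i)) * Complex.I)) :=
  ⟨[Gate.evaluate k l x y σ τ],
    fun T _ => by simp [Circuit.time, Gate.time], fun O ψ => apply_evaluate O _ _ _ _ _ _ ψ⟩

/-- The matrix of a unitary operator. -/
def unitaryOfIso {Q : Type} [Fintype Q] [DecidableEq Q] (F : QState Q ≃ₗᵢ[ℂ] QState Q) :
    Matrix.unitaryGroup (Q → Bool) ℂ :=
  ⟨(EuclideanSpace.basisFun (Q → Bool) ℂ).toBasis.toMatrix
      ((EuclideanSpace.basisFun (Q → Bool) ℂ).map F),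
    OrthonormalBasis.toMatrix_orthonormalBasis_mem_unitary _ _⟩

theorem unitaryOfIso_apply {Q : Type} [Fintype Q] [DecidableEq Q] (F : QState Q ≃ₗᵢ[ℂ] QState Q)
    (p r : Q → Bool) : (unitaryOfIso F).1 p r = F (EuclideanSpace.single r 1) p := by
  simp [unitaryOfIso, Module.Basis.toMatrix_apply]

theorem impl_target (q : Qubit n m w) (s : Finset (Qubit n m w)) (hs : s.card ≤ 2)
    (u : Label n m w → Matrix.unitaryGroup Bool ℂ) (hu : ∀ x b, u (update x q b) = u x)
    (hus : ∀ x y, (∀ r ∈ s, x r = y r) → u x = u y) :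
    Impl (N := N) (d := d) 1 0 (fun _ => target q u hu) := by
  classical
  set t := insert q s
  let e : Fin t.card ↪ Qubit n m w := t.equivFin.symm.toEmbedding.trans (Embedding.subtype _)
  have he : ∀ r ∈ t, ∃ i, e i = r := fun r hr => ⟨t.equivFin ⟨r, hr⟩, by simp [e]⟩
  obtain ⟨i₀, hi₀⟩ := he q (Finset.mem_insert_self _ _)
  have hcard : t.card ≤ 3 := (Finset.card_insert_le _ _).trans (by omega)
  let u' : (Fin t.card → Bool) → Matrix.unitaryGroup Bool ℂ :=
    fun p => u (extend e p fun _ => false)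
  have hext : ∀ (p : Fin t.card → Bool) (b : Bool) (x : Label n m w),
      extend e (update p i₀ b) x = update (extend e p x) q b := by
    intro p b x
    funext r
    by_cases hr : ∃ i, e i = r
    · obtain ⟨i, rfl⟩ := hr
      rw [e.injective.extend_apply]
      by_cases hi : i = i₀
      · subst hi
        rw [← hi₀, update_self, update_self]
      · rw [update_of_ne hi, update_of_ne, e.injective.extend_apply]
        rw [← hi₀]
        exact fun h => hi (e.injective h)
    · rw [extend_apply' _ _ _ hr, update_of_ne, extend_apply' _ _ _ hr]
      rintro rfl
      exact hr ⟨i₀, hi₀⟩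
  have hu' : ∀ p b, u' (update p i₀ b) = u' p := fun p b => by
    simp only [u', hext, hu]
  refine ⟨[Gate.elementary t.card hcard e (unitaryOfIso (target i₀ u' hu'))],
    fun T _ => by simp [Circuit.time, Gate.time], fun O ψ => ?_⟩
  ext x
  have h1 : u' (fun i => x (e i)) = u x := by
    refine hus _ _ fun r hr => ?_
    obtain ⟨i, rfl⟩ := he r (Finset.mem_insert_of_mem hr)
    rw [e.injective.extend_apply]
  have h2 : ∀ b : Bool, ∀ c : ℂ, ∑ a : Fin t.card → Bool,
      c * (EuclideanSpace.single a (1 : ℂ) : QState (Fin t.card)) (update (fun i => x (e i)) i₀ b)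
        * ψ (extend e a x) = c * ψ (update x q b) := by
    intro b c
    rw [Finset.sum_eq_single (update (fun i => x (e i)) i₀ b)]
    · rw [hext, extend_comp_self]
      simp
    · intro a _ ha
      simp [ha.symm]
    · simp
  simp only [List.foldl_cons, List.foldl_nil, Gate.apply, applyOn, unitaryOfIso_apply,
    target_apply, h1, hi₀, add_mul, Finset.sum_add_distrib, h2]

end gates

section singleQubit

/-- The unitary with first column `(α, β)` and determinant `w`. -/
def unitaryTwo (α β w : ℂ) (h : ‖α‖ ^ 2 + ‖β‖ ^ 2 = 1) (hw : ‖w‖ = 1) :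
    Matrix.unitaryGroup Bool ℂ :=
  ⟨Matrix.of fun a b => if b then (if a then starRingEnd ℂ α * w else -(starRingEnd ℂ β) * w)
      else (if a then β else α), by
    have h1 : α * starRingEnd ℂ α + β * starRingEnd ℂ β = 1 := by
      rw [Complex.mul_conj, Complex.mul_conj, Complex.normSq_eq_norm_sq, Complex.normSq_eq_norm_sq]
      exact_mod_cast h
    have h2 : w * starRingEnd ℂ w = 1 := by
      rw [Complex.mul_conj, Complex.normSq_eq_norm_sq, hw]
      simp
    rw [Matrix.mem_unitaryGroup_iff]
    ext a b
    rw [Matrix.mul_apply, Fintype.sum_bool, Matrix.star_apply, Matrix.star_apply]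
    cases a <;> cases b <;>
      simp only [Matrix.of_apply, RCLike.star_def, map_mul, map_neg, Complex.conj_conj,
        Matrix.one_apply, if_true, if_false, Bool.false_eq_true, reduceCtorEq]
    · linear_combination h1 + starRingEnd ℂ β * β * h2
    · linear_combination (-(starRingEnd ℂ β) * α) * h2
    · linear_combination (-(starRingEnd ℂ α) * β) * h2
    · linear_combination h1 + starRingEnd ℂ α * α * h2⟩

/-- The unitary which maps `|0⟩` to `β |1⟩` and is an involution. -/
def flipGate (β : ℂ) (hβ : ‖β‖ = 1) : Matrix.unitaryGroup Bool ℂ :=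
  unitaryTwo 0 β (-1) (by simp [hβ]) (by simp)

/-- The Pauli matrix `X`. -/
def notGate : Matrix.unitaryGroup Bool ℂ := flipGate 1 (by simp)

/-- The Hadamard gate. -/
def hadamard : Matrix.unitaryGroup Bool ℂ :=
  unitaryTwo (Real.sqrt 2)⁻¹ (Real.sqrt 2)⁻¹ (-1) (by
    have h : ‖((Real.sqrt 2 : ℝ) : ℂ)⁻¹‖ ^ 2 = 1 / 2 := by
      rw [norm_inv, Complex.norm_real, Real.norm_of_nonneg (Real.sqrt_nonneg 2), inv_pow,
        Real.sq_sqrt zero_le_two, one_div]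
    rw [h]
    norm_num) (by simp)

/-- The diagonal gate with entries `1, ζ`. -/
def phaseGate (ζ : ℂ) (hζ : ‖ζ‖ = 1) : Matrix.unitaryGroup Bool ℂ :=
  unitaryTwo 1 0 ζ (by simp) hζ

/-- The diagonal gate with entries `-1, 1`. -/
def signGate : Matrix.unitaryGroup Bool ℂ := unitaryTwo (-1) 0 (-1) (by simp) (by simp)

variable {Q : Type} [Fintype Q] [DecidableEq Q]

/-- The operator which flips the qubit `q` if `c` holds of the label. -/
def flipIf (q : Q) (c : (Q → Bool) → Bool) (hc : ∀ x b, c (update x q b) = c x) :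
    QState Q ≃ₗᵢ[ℂ] QState Q :=
  target q (fun x => if c x then notGate else 1) fun x b => by rw [hc]

theorem flipIf_apply (q : Q) (c : (Q → Bool) → Bool) (hc : ∀ x b, c (update x q b) = c x)
    (ψ : QState Q) (x : Q → Bool) : flipIf q c hc ψ x = ψ (update x q (xor (x q) (c x))) := by
  rw [flipIf, target_apply]
  cases h : c x <;> cases hq : x q <;>
    simp [notGate, flipGate, unitaryTwo]

theorem flipIf_apply_update (q : Q) (c : (Q → Bool) → Bool) (hc : ∀ x b, c (update x q b) = c x)
    (ψ : QState Q) (x : Q → Bool) : flipIf q c hc ψ (update x q (xor (x q) (c x))) = ψ x := by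
  rw [flipIf_apply, hc, update_self, update_idem, Bool.xor_assoc, Bool.xor_self, Bool.xor_false,
    update_eq_self]

end singleQubit

section ladder

variable {Q : Type} [Fintype Q] [DecidableEq Q] {D : ℕ}

/-- Input qubits `inp`, flag qubits `flag` and a pattern which the inputs are compared with. -/
structure Ladder (Q : Type) (D : ℕ) where
  inp : Fin D ↪ Q
  flag : Fin (D + 1) ↪ Q
  disjoint : ∀ i s, inp i ≠ flag s
  pattern : Fin D → Bool

namespace Ladder

variable (L : Ladder Q D)

/-- The condition under which the flag `i + 1` is flipped: the flag `i` is set and the input `i`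
matches the pattern. -/
def cond (i : Fin D) (x : Q → Bool) : Bool :=
  x (L.flag i.castSucc) && (x (L.inp i) == L.pattern i)

theorem cond_update (i : Fin D) (x : Q → Bool) (b : Bool) :
    L.cond i (update x (L.flag i.succ) b) = L.cond i x := by
  unfold cond
  rw [update_of_ne, update_of_ne (L.disjoint i _)]
  intro h
  exact absurd (L.flag.injective h) (Fin.castSucc_lt_succ (i := i)).ne

/-- One step of the computation of the flags. -/
def step (i : Fin D) : QState Q ≃ₗᵢ[ℂ] QState Q := flipIf (L.flag i.succ) (L.cond i) (L.cond_update i)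

/-- The first step of the computation of the flags. -/
def start : QState Q ≃ₗᵢ[ℂ] QState Q := flipIf (L.flag 0) (fun _ => true) fun _ _ => rfl

/-- The computation of the flags up to `r`. -/
def op : ℕ → (QState Q ≃ₗᵢ[ℂ] QState Q)
  | 0 => L.start
  | r + 1 => (op r).trans (if h : r < D then L.step ⟨r, h⟩ else LinearIsometryEquiv.refl ℂ _)

/-- The effect of one step on labels. -/
def stepLabel (i : Fin D) (x : Q → Bool) : Q → Bool :=
  update x (L.flag i.succ) (xor (x (L.flag i.succ)) (L.cond i x))

/-- The effect of the computation of the flags on labels. -/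
def label : ℕ → (Q → Bool) → Q → Bool
  | 0, x => update x (L.flag 0) (!(x (L.flag 0)))
  | r + 1, x => if h : r < D then L.stepLabel ⟨r, h⟩ (label r x) else label r x

theorem start_apply_label (ψ : QState Q) (x : Q → Bool) : L.start ψ (L.label 0 x) = ψ x := by
  have h := flipIf_apply_update (L.flag 0) (fun _ => true) (fun _ _ => rfl) ψ x
  rwa [Bool.xor_true] at h

theorem step_apply_stepLabel (i : Fin D) (ψ : QState Q) (x : Q → Bool) :
    L.step i ψ (L.stepLabel i x) = ψ x :=
  flipIf_apply_update _ _ _ ψ x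

theorem op_apply_label (r : ℕ) (ψ : QState Q) (x : Q → Bool) : L.op r ψ (L.label r x) = ψ x := by
  induction r with
  | zero => exact L.start_apply_label ψ x
  | succ r ih =>
    simp only [op, label]
    split_ifs with h
    · rw [LinearIsometryEquiv.trans_apply, step_apply_stepLabel, ih]
    · exact ih

theorem op_symm_apply (r : ℕ) (ψ : QState Q) (x : Q → Bool) :
    (L.op r).symm ψ x = ψ (L.label r x) := by
  rw [← L.op_apply_label r ((L.op r).symm ψ) x, LinearIsometryEquiv.apply_symm_apply]

theorem label_of_notMem (r : ℕ) (x : Q → Bool) (q : Q) (hq : ∀ s, q ≠ L.flag s) :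
    L.label r x q = x q := by
  induction r with
  | zero => exact update_of_ne (hq 0) _ _
  | succ r ih =>
    simp only [label]
    split_ifs with h
    · rw [stepLabel, update_of_ne (hq _), ih]
    · exact ih

theorem label_inp (r : ℕ) (x : Q → Bool) (i : Fin D) : L.label r x (L.inp i) = x (L.inp i) :=
  L.label_of_notMem r x _ (L.disjoint i)

theorem label_flag (r : ℕ) (x : Q → Bool) (hx : ∀ s, x (L.flag s) = false) (s : Fin (D + 1)) :
    L.label r x (L.flag s)
      = decide ((s : ℕ) ≤ r ∧ ∀ i : Fin D, (i : ℕ) < s → x (L.inp i) = L.pattern i) := by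
  induction r generalizing s with
  | zero =>
    simp only [label]
    by_cases hs : s = 0
    · subst hs
      simp [hx]
    · rw [update_of_ne (fun h => hs (L.flag.injective h)), hx]
      have : ¬ (s : ℕ) ≤ 0 := fun h => hs (Fin.ext (by simpa using h))
      simp [this]
  | succ r ih =>
    simp only [label]
    split_ifs with h
    · rw [stepLabel]
      by_cases hs : s = Fin.succ ⟨r, h⟩
      · subst hs
        rw [update_self, cond, ih, ih, label_inp]
        rw [Bool.eq_iff_iff]
        simp only [Fin.val_succ, Fin.val_castSucc, Bool.xor_iff_ne]
        simp only [add_le_iff_nonpos_right, nonpos_iff_eq_zero, one_ne_zero, false_and,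
          decide_false, le_refl, true_and, ne_eq, Bool.false_eq, Bool.not_eq_false,
          Bool.and_eq_true, decide_eq_true_eq, beq_iff_eq]
        constructor
        · rintro ⟨h1, h2⟩ i hi
          rcases Nat.lt_succ_iff_lt_or_eq.1 hi with hi | hi
          · exact h1 i hi
          · rwa [show i = ⟨r, h⟩ from Fin.ext hi]
        · intro h1
          exact ⟨fun i hi => h1 i (by omega), h1 _ (by simp)⟩
      · rw [update_of_ne (fun h => hs (L.flag.injective h)), ih]
        have : (s : ℕ) ≤ r ↔ (s : ℕ) ≤ r + 1 := by
          have : (s : ℕ) ≠ r + 1 := fun h => hs (Fin.ext (by simpa using h))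
          omega
        simp only [this]
    · rw [ih]
      have h1 : (s : ℕ) ≤ r := by have := s.2; omega
      have h2 : (s : ℕ) ≤ r + 1 := by omega
      simp [h1, h2]

theorem label_update_inp (r : ℕ) (x : Q → Bool) (i : Fin D) (hi : r ≤ i) (b : Bool) :
    L.label r (update x (L.inp i) b) = update (L.label r x) (L.inp i) b := by
  induction r with
  | zero =>
    simp only [label]
    rw [update_of_ne (L.disjoint i 0).symm, update_comm (L.disjoint i 0)]
  | succ r ih =>
    have h : r < D := by have := i.2; omega
    simp only [label, h, dif_pos]
    rw [ih (by omega), stepLabel, stepLabel, update_of_ne (L.disjoint i _).symm,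
      update_comm (L.disjoint i _), cond, cond, update_of_ne (L.disjoint i _).symm, update_of_ne]
    intro h'
    have := congrArg Fin.val (L.inp.injective h')
    simp at this
    omega

theorem supportedOn_op (I S : Set Q) (h1 : ∀ i, L.inp i ∈ S) (h2 : ∀ s, L.flag s ∈ S) (r : ℕ) :
    SupportedOn I S (L.op r) := by
  induction r with
  | zero => exact supportedOn_target _ _ _ _ (fun _ _ => rfl) (h2 0) fun _ _ _ => rfl
  | succ r ih =>
    refine ih.trans ?_
    split_ifs with h
    · refine supportedOn_target _ _ _ _ (fun x b => by rw [L.cond_update]) (h2 _) fun x y hxy => ?_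
      rw [cond, cond, hxy _ (Or.inl (h2 _)), hxy _ (Or.inl (h1 _))]
    · exact SupportedOn.refl _ _

/-- The conjugation by the computation of the flags of the operator which changes the sign if the
last flag is not set and `c` holds of the label. -/
def reflect (c : (Q → Bool) → Bool) (hc : ∀ x b, c (update x (L.flag (Fin.last D)) b) = c x) :
    QState Q ≃ₗᵢ[ℂ] QState Q :=
  ((L.op D).trans (target (L.flag (Fin.last D)) (fun x => if c x then signGate else 1)
    fun x b => by rw [hc])).trans (L.op D).symm

theorem reflect_apply (c : (Q → Bool) → Bool)
    (hc : ∀ x b, c (update x (L.flag (Fin.last D)) b) = c x) (ψ : QState Q) (x : Q → Bool) :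
    L.reflect c hc ψ x =
      (if c (L.label D x) = true ∧ L.label D x (L.flag (Fin.last D)) = false then -1 else 1)
        * ψ x := by
  rw [reflect, LinearIsometryEquiv.trans_apply, op_symm_apply, LinearIsometryEquiv.trans_apply,
    target_apply, ← L.op_apply_label D ψ x]
  cases h : c (L.label D x) <;> cases h' : L.label D x (L.flag (Fin.last D)) <;>
    · simp only [signGate, unitaryTwo, if_true, if_false, Bool.false_eq_true, Matrix.of_apply,
        Matrix.UnitaryGroup.one_val, Matrix.one_apply, map_neg, map_one, map_zero, reduceCtorEq,
        and_self, and_false, and_true]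
      rw [← h', update_eq_self]
      simp

theorem supportedOn_reflect (I S : Set Q) (h1 : ∀ i, L.inp i ∈ S) (h2 : ∀ s, L.flag s ∈ S)
    (c : (Q → Bool) → Bool) (hc : ∀ x b, c (update x (L.flag (Fin.last D)) b) = c x)
    (hcS : ∀ x y, (∀ q ∈ S ∪ I, x q = y q) → c x = c y) :
    SupportedOn I S (L.reflect c hc) :=
  ((L.supportedOn_op I S h1 h2 D).trans
    (supportedOn_target _ _ _ _ _ (h2 _) fun x y h => by rw [hcS x y h])).trans
    (L.supportedOn_op I S h1 h2 D).symm

end Ladder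

variable {N n d m w : ℕ}

theorem Ladder.impl_op (L : Ladder (Qubit n m w) D) (r : ℕ) :
    Impl (N := N) (d := d) (r + 1) 0 (fun _ => L.op r) := by
  induction r with
  | zero =>
    exact (impl_target _ ∅ (by simp) _ (fun _ _ => rfl) fun _ _ _ => rfl).mono (by simp) le_rfl
  | succ r ih =>
    by_cases h : r < D
    · refine ((ih.trans (impl_target (L.flag (Fin.succ ⟨r, h⟩))
        {L.flag (Fin.castSucc ⟨r, h⟩), L.inp ⟨r, h⟩} Finset.card_le_two
        (fun x => if L.cond ⟨r, h⟩ x then notGate else 1)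
        (fun x b => by rw [L.cond_update]) ?_)).mono (by push_cast; rfl) (by simp)).congr ?_
      · intro x y hxy
        rw [Ladder.cond, Ladder.cond, hxy _ (by simp), hxy _ (by simp)]
      · intro O ψ
        simp only [Ladder.op, h, dif_pos]
        rfl
    · refine (ih.mono (by push_cast; linarith) le_rfl).congr fun O ψ => ?_
      simp only [Ladder.op, h, dif_neg, not_false_eq_true]
      rfl

theorem Ladder.impl_reflect (L : Ladder (Qubit n m w) D) (c : Label n m w → Bool)
    (hc : ∀ x b, c (update x (L.flag (Fin.last D)) b) = c x) (q : Qubit n m w)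
    (hq : ∀ x y, x q = y q → c x = c y) :
    Impl (N := N) (d := d) (2 * D + 3) 0 (fun _ => L.reflect c hc) := by
  refine Impl.mono (((L.impl_op D).trans (impl_target _ {q} (by simp) _ _ ?_)).trans
    (L.impl_op D).symm) (by linarith) (by simp)
  intro x y h
  rw [hq x y (h q (by simp))]

end ladder

section uniform

theorem ofBits_eq_sum {n : ℕ} (f : Fin n → Bool) :
    Nat.ofBits f = ∑ i, (f i).toNat * 2 ^ (i : ℕ) := by
  induction n with
  | zero => simp
  | succ n ih =>
    rw [Nat.ofBits_succ, ih, Fin.sum_univ_succ, Finset.mul_sum]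
    simp only [Fin.val_zero, pow_zero, mul_one, Fin.val_succ, pow_succ, comp_apply]
    rw [add_comm]
    congr 1
    exact Finset.sum_congr rfl fun i _ => by ring

theorem ofBits_update_true {n : ℕ} (f : Fin n → Bool) (k : Fin n) :
    Nat.ofBits (update f k true) = Nat.ofBits (update f k false) + 2 ^ (k : ℕ) := by
  rw [ofBits_eq_sum, ofBits_eq_sum, ← Finset.add_sum_erase _ _ (Finset.mem_univ k),
    ← Finset.add_sum_erase _ _ (Finset.mem_univ k)]
  simp only [update_self, Bool.toNat_true, Bool.toNat_false]
  rw [Finset.sum_congr rfl fun i hi => by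
    rw [update_of_ne (Finset.ne_of_mem_erase hi), ← update_of_ne (Finset.ne_of_mem_erase hi) false f]]
  ring

variable {N n d m w : ℕ}

theorem indexValue_update_true (x : Label n m w) (k : Fin n) :
    indexValue (update x (Sum.inl k) true)
      = indexValue (update x (Sum.inl k) false) + 2 ^ (k : ℕ) := by
  have h : ∀ b, (fun i : Fin n => update x (Sum.inl k) b (Sum.inl i))
      = update (fun i => x (Sum.inl i)) k b := by
    intro b
    funext i
    by_cases hi : i = k
    · subst hi
      simp
    · rw [update_of_ne hi, update_of_ne (by simpa using hi)]
  unfold indexValue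
  rw [h, h, ofBits_update_true]

theorem indexValue_lt (x : Label n m w) : indexValue x < 2 ^ n := Nat.ofBits_lt_two_pow _

theorem testBit_indexValue (x : Label n m w) (k : Fin n) :
    (indexValue x).testBit k = x (Sum.inl k) :=
  Nat.testBit_ofBits_lt _ _ k.2

/-- The number of integers below `N` among the `2 ^ (n - r)` ones from `v` on. -/
def prefixCount (N n r v : ℕ) : ℕ := min N (v + 2 ^ (n - r)) - v

/-- The number `N - 1`, with its last `n - r` bits cleared. -/
def prefixValue (N n r : ℕ) : ℕ := (N - 1) / 2 ^ (n - r) * 2 ^ (n - r)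

theorem two_pow_sub_eq {n r : ℕ} (hr : r < n) : 2 ^ (n - r) = 2 * 2 ^ (n - (r + 1)) := by
  rw [← pow_succ']
  congr 1
  omega

theorem prefixCount_succ {r : ℕ} (hr : r < n) (v : ℕ) :
    prefixCount N n (r + 1) v + prefixCount N n (r + 1) (v + 2 ^ (n - (r + 1)))
      = prefixCount N n r v := by
  unfold prefixCount
  rw [two_pow_sub_eq hr]
  omega

theorem prefixValue_le : prefixValue N n r ≤ N - 1 := Nat.div_mul_le_self _ _

theorem lt_prefixValue_add {r : ℕ} : N - 1 < prefixValue N n r + 2 ^ (n - r) :=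
  Nat.lt_div_mul_add (by positivity)

theorem prefixCount_prefixValue_pos (hN : 0 < N) (r : ℕ) :
    0 < prefixCount N n r (prefixValue N n r) := by
  have h1 : prefixValue N n r ≤ N - 1 := prefixValue_le
  have h2 : 0 < 2 ^ (n - r) := by positivity
  unfold prefixCount
  omega

theorem prefixCount_of_ne {r v : ℕ} (hr : r < n) (hv : 2 ^ (n - r) ∣ v)
    (h : v ≠ prefixValue N n r) :
    prefixCount N n (r + 1) v = prefixCount N n (r + 1) (v + 2 ^ (n - (r + 1))) := by
  have h1 : prefixValue N n r ≤ N - 1 := prefixValue_le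
  have h2 : N - 1 < prefixValue N n r + 2 ^ (n - r) := lt_prefixValue_add
  have h3 : v + 2 ^ (n - r) ≤ prefixValue N n r ∨ prefixValue N n r + 2 ^ (n - r) ≤ v := by
    obtain ⟨a, rfl⟩ := hv
    unfold prefixValue at *
    rcases lt_trichotomy a ((N - 1) / 2 ^ (n - r)) with h4 | h4 | h4
    · left
      calc _ = (a + 1) * 2 ^ (n - r) := by ring
        _ ≤ _ := Nat.mul_le_mul_right _ h4
    · exact absurd (by rw [h4, mul_comm]) h
    · right
      calc _ = ((N - 1) / 2 ^ (n - r) + 1) * 2 ^ (n - r) := by ring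
        _ ≤ a * 2 ^ (n - r) := Nat.mul_le_mul_right _ h4
        _ = _ := mul_comm _ _
  rw [two_pow_sub_eq hr] at h2 h3
  unfold prefixCount
  omega

/-- The rotation which splits the numbers that share their first `r` bits with `N - 1`. -/
def splitGate (N n r : ℕ) (hN : 0 < N) (hr : r < n) : Matrix.unitaryGroup Bool ℂ :=
  unitaryTwo
    (Real.sqrt (prefixCount N n (r + 1) (prefixValue N n r)
      / prefixCount N n r (prefixValue N n r)) : ℝ)
    (Real.sqrt (prefixCount N n (r + 1) (prefixValue N n r + 2 ^ (n - (r + 1)))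
      / prefixCount N n r (prefixValue N n r)) : ℝ) 1
    (by
      have h : (0 : ℝ) < prefixCount N n r (prefixValue N n r) := by
        exact_mod_cast prefixCount_prefixValue_pos hN r
      rw [Complex.norm_real, Complex.norm_real, Real.norm_of_nonneg (Real.sqrt_nonneg _),
        Real.norm_of_nonneg (Real.sqrt_nonneg _), Real.sq_sqrt (by positivity),
        Real.sq_sqrt (by positivity), ← add_div, div_eq_one_iff_eq h.ne',
        ← prefixCount_succ hr]
      push_cast
      rfl)
    (by simp)

/-- The comparison of the index with `N - 1`, from the most significant bit on. -/
def indexLadder (N : ℕ) {n m w : ℕ} (t : Fin (n + 1) ↪ Fin w) : Ladder (Qubit n m w) n where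
  inp := Fin.revPerm.toEmbedding.trans Embedding.inl
  flag := workQubits t
  disjoint i s := by simp [workQubits]
  pattern i := (N - 1).testBit (n - (i + 1))

theorem indexLadder_inp (t : Fin (n + 1) ↪ Fin w) (i : Fin n) :
    (indexLadder (m := m) N t).inp i = Sum.inl i.rev := rfl

/-- The operator which splits the amplitudes according to the bit `i`. -/
def splitOp (hN : 0 < N) (t : Fin (n + 1) ↪ Fin w) (i : Fin n) : State n m w ≃ₗᵢ[ℂ] State n m w :=
  target ((indexLadder N t).inp i)
    (fun x => if x ((indexLadder N t).flag i.castSucc) then splitGate N n i hN i.2 else hadamard)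
    fun x b => by rw [update_of_ne ((indexLadder N t).disjoint i _).symm]

/-- The preparation of the index register up to bit `r`, with the flags computed. -/
def splitOps (hN : 0 < N) (t : Fin (n + 1) ↪ Fin w) : ℕ → (State n m w ≃ₗᵢ[ℂ] State n m w)
  | 0 => (indexLadder N t).start
  | r + 1 => (splitOps hN t r).trans (if h : r < n then
      (splitOp hN t ⟨r, h⟩).trans ((indexLadder N t).step ⟨r, h⟩)
    else LinearIsometryEquiv.refl ℂ _)

/-- All qubits vanish, except for the first `r` index bits. -/
def ZeroFrom (r : ℕ) (x : Label n m w) : Prop :=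
  (∀ i : Fin n, r ≤ i → x (Sum.inl i.rev) = false) ∧ ∀ q, x (Sum.inr q) = false

theorem zeroFrom_update (r : ℕ) (hr : r < n) (x : Label n m w) :
    ZeroFrom r (update x (Sum.inl (Fin.rev ⟨r, hr⟩)) false) ↔ ZeroFrom (r + 1) x := by
  unfold ZeroFrom
  refine and_congr ⟨fun h i hi => ?_, fun h i hi => ?_⟩ (by simp)
  · rw [← h i (by omega), update_of_ne]
    simp only [ne_eq, Sum.inl.injEq, Fin.rev_inj]
    rintro rfl
    simp at hi
  · by_cases hi' : i = ⟨r, hr⟩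
    · rw [hi', update_self]
    · rw [update_of_ne (by simpa using hi')]
      refine h i (lt_of_le_of_ne hi fun h' => hi' (Fin.ext h'.symm))

theorem not_zeroFrom_update (r : ℕ) (hr : r < n) (x : Label n m w) :
    ¬ ZeroFrom r (update x (Sum.inl (Fin.rev ⟨r, hr⟩)) true) := fun h => by
  have := h.1 ⟨r, hr⟩ le_rfl
  simp at this

theorem ZeroFrom.testBit {r : ℕ} {x : Label n m w} (h : ZeroFrom r x) {k : ℕ} (hk : k < n - r) :
    (indexValue x).testBit k = false := by
  have hk' : k < n := by omega
  rw [testBit_indexValue x ⟨k, hk'⟩, ← h.1 (Fin.rev ⟨k, hk'⟩), Fin.rev_rev]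
  rw [Fin.val_rev]
  simp
  omega

theorem ZeroFrom.dvd {r : ℕ} {x : Label n m w} (h : ZeroFrom r x) :
    2 ^ (n - r) ∣ indexValue x := by
  refine Nat.dvd_of_mod_eq_zero (Nat.eq_of_testBit_eq fun k => ?_)
  rw [Nat.testBit_mod_two_pow, Nat.zero_testBit]
  by_cases hk : k < n - r
  · rw [h.testBit hk, Bool.and_false]
  · simp [hk]

theorem ZeroFrom.eq_prefixValue_iff {r : ℕ} {x : Label n m w} (h : ZeroFrom r x)
    (hN : 0 < N) (hNn : N ≤ 2 ^ n) :
    indexValue x = prefixValue N n r ↔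
      ∀ i : Fin n, (i : ℕ) < r → x (Sum.inl i.rev) = (N - 1).testBit (n - (i + 1)) := by
  have h1 : ∀ k, (prefixValue N n r).testBit k = (decide (n - r ≤ k) && (N - 1).testBit k) := by
    intro k
    rw [prefixValue, Nat.testBit_mul_two_pow]
    by_cases hk : n - r ≤ k
    · simp only [hk, Nat.testBit_div_two_pow]
      simp [hk]
    · simp [hk]
  constructor
  · intro h2 i hi
    rw [← testBit_indexValue x i.rev, h2, h1, Fin.val_rev]
    have : n - r ≤ n - (i + 1) := by omega
    simp [this]
  · intro h2
    refine Nat.eq_of_testBit_eq fun k => ?_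
    rw [h1]
    by_cases hk : n - r ≤ k
    · by_cases hk' : k < n
      · have h3 := h2 (Fin.rev ⟨k, hk'⟩) (by rw [Fin.val_rev]; simp; omega)
        rw [Fin.rev_rev] at h3
        rw [testBit_indexValue x ⟨k, hk'⟩, h3, Fin.val_rev]
        simp only [hk, decide_true, Bool.true_and]
        congr 1
        omega
      · have h4 : 2 ^ n ≤ 2 ^ k := Nat.pow_le_pow_right (by norm_num) (by omega)
        rw [Nat.testBit_lt_two_pow ((indexValue_lt x).trans_le h4),
          Nat.testBit_lt_two_pow (by omega), Bool.and_false]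
    · rw [h.testBit (by omega)]
      simp [hk]

theorem sqrt_div_mul_sqrt_div {a b c : ℝ} (ha : 0 ≤ a) (hb : 0 < b) :
    Real.sqrt (a / b) * Real.sqrt (b / c) = Real.sqrt (a / c) := by
  rw [← Real.sqrt_mul (by positivity)]
  congr 1
  field_simp

open Classical in
/-- The amplitudes after `r` bits. -/
def prefixAmp (N : ℕ) {n m w : ℕ} (r : ℕ) (x : Label n m w) : ℂ :=
  if ZeroFrom r x then (Real.sqrt (prefixCount N n r (indexValue x) / N) : ℝ) else 0

theorem splitOps_apply (hN : 0 < N) (hNn : N ≤ 2 ^ n) (t : Fin (n + 1) ↪ Fin w) (r : ℕ)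
    (hr : r ≤ n) (x : Label n m w) :
    splitOps hN t r (EuclideanSpace.single (fun _ => false) 1) ((indexLadder N t).label r x)
      = prefixAmp N r x := by
  induction r generalizing x with
  | zero =>
    rw [splitOps, Ladder.start_apply_label, prefixAmp]
    have h : ZeroFrom 0 x ↔ x = fun _ => false := by
      constructor
      · intro h
        funext q
        rcases q with i | q
        · rw [← Fin.rev_rev i]
          exact h.1 i.rev (Nat.zero_le _)
        · exact h.2 q
      · rintro rfl
        exact ⟨fun _ _ => rfl, fun _ => rfl⟩
    by_cases hx : x = fun _ => false
    · have h0 : indexValue x = 0 := by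
        refine Nat.eq_of_testBit_eq fun k => ?_
        rw [Nat.zero_testBit]
        by_cases hk : k < n
        · rw [testBit_indexValue x ⟨k, hk⟩, hx]
        · exact Nat.testBit_lt_two_pow ((indexValue_lt x).trans_le
            (Nat.pow_le_pow_right (by norm_num) (by omega)))
      have hN' : (N : ℝ) ≠ 0 := by positivity
      rw [if_pos (h.2 hx), h0]
      simp [hx, prefixCount, hNn, hN']
    · rw [if_neg (h.not.2 hx)]
      simp [hx]
  | succ r ih =>
    have hr' : r < n := hr
    have ih := fun x => ih hr'.le x
    simp only [splitOps, Ladder.label, hr', dif_pos, LinearIsometryEquiv.trans_apply]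
    have hup : ∀ b, update ((indexLadder N t).label r x) ((indexLadder N t).inp ⟨r, hr'⟩) b
        = (indexLadder N t).label r (update x ((indexLadder N t).inp ⟨r, hr'⟩) b) :=
      fun b => ((indexLadder N t).label_update_inp r x ⟨r, hr'⟩ le_rfl b).symm
    rw [Ladder.step_apply_stepLabel, splitOp, target_apply, hup, hup, ih, ih, Ladder.label_inp, indexLadder_inp]
    rw [prefixAmp, prefixAmp, if_neg (not_zeroFrom_update r hr' x), mul_zero, add_zero, prefixAmp,
      zeroFrom_update]
    by_cases h : ZeroFrom (r + 1) x
    swap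
    · rw [if_neg h, if_neg h, mul_zero]
    rw [if_pos h, if_pos h]
    have h' := (zeroFrom_update r hr' x).2 h
    set q : Qubit n m w := Sum.inl (Fin.rev ⟨r, hr'⟩) with hq
    set v := indexValue (update x q false) with hv
    have hflag : (indexLadder N t).label r x ((indexLadder N t).flag (Fin.castSucc ⟨r, hr'⟩))
        = decide (v = prefixValue N n r) := by
      rw [Ladder.label_flag _ _ _ (fun s => h.2 _), Bool.eq_iff_iff, decide_eq_true_iff,
        decide_eq_true_iff, hv, h'.eq_prefixValue_iff hN hNn]
      simp only [Fin.val_castSucc, le_refl, true_and]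
      refine forall_congr' fun i => imp_congr_right fun hi => ?_
      rw [indexLadder_inp, update_of_ne]
      · rfl
      · simp only [hq, ne_eq, Sum.inl.injEq, Fin.rev_inj]
        rintro rfl
        simp at hi
    have hx : indexValue x = if x q then v + 2 ^ (n - (r + 1)) else v := by
      conv_lhs => rw [← update_eq_self q x]
      cases h1 : x q
      · simp [hv]
      · rw [hq, indexValue_update_true]
        simp [hv, hq]
    have hN' : (0 : ℝ) < N := by exact_mod_cast hN
    have hcount := prefixCount_succ (N := N) hr' v
    rw [hflag, hx]
    by_cases h1 : v = prefixValue N n r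
    · have hc : (0 : ℝ) < prefixCount N n r v := by
        rw [h1]
        exact_mod_cast prefixCount_prefixValue_pos hN r
      simp only [h1, decide_true, if_true, splitGate, unitaryTwo, Matrix.of_apply,
        Bool.false_eq_true, if_false]
      rw [← h1]
      cases x q
      · simp only [if_false, Bool.false_eq_true]
        rw [← Complex.ofReal_mul, sqrt_div_mul_sqrt_div (by positivity) hc]
      · simp only [if_true]
        rw [← Complex.ofReal_mul, sqrt_div_mul_sqrt_div (by positivity) hc]
    · have h2 := prefixCount_of_ne hr' h'.dvd h1
      rw [← hv] at h2
      have h3 : (prefixCount N n r v : ℝ) / N = 2 * (prefixCount N n (r + 1) v / N) := by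
        rw [← hcount, ← h2]
        push_cast
        ring
      have h4 : ((Real.sqrt 2 : ℝ) : ℂ) ≠ 0 := by
        exact_mod_cast (Real.sqrt_pos.2 zero_lt_two).ne'
      have h5 : ∀ y : Bool, hadamard.1 y false = ((Real.sqrt 2 : ℝ) : ℂ)⁻¹ := by
        intro y
        cases y <;> simp [hadamard, unitaryTwo]
      have h6 : prefixCount N n (r + 1) (if x q then v + 2 ^ (n - (r + 1)) else v)
          = prefixCount N n (r + 1) v := by
        cases x q <;> simp [h2]
      simp only [h1, decide_false, Bool.false_eq_true, if_false]
      rw [h5, h6, h3, Real.sqrt_mul zero_le_two, Complex.ofReal_mul, ← mul_assoc,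
        inv_mul_cancel₀ h4, one_mul]

/-- The preparation of the uniform superposition of the indices below `N`. -/
def uniformOp (hN : 0 < N) (t : Fin (n + 1) ↪ Fin w) : State n m w ≃ₗᵢ[ℂ] State n m w :=
  (splitOps hN t n).trans ((indexLadder N t).op n).symm

theorem uniformOp_apply (hN : 0 < N) (hNn : N ≤ 2 ^ n) (t : Fin (n + 1) ↪ Fin w) :
    uniformOp hN t (EuclideanSpace.single (fun _ => false) 1)
      = uniformState (N := N) (m := m) n w fun _ _ => false := by
  ext x
  rw [uniformOp, LinearIsometryEquiv.trans_apply, Ladder.op_symm_apply,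
    splitOps_apply hN hNn t n le_rfl, prefixAmp]
  have h : ZeroFrom n x ↔ outPart x = (fun _ => false) ∧ workPart x = fun _ => false := by
    unfold ZeroFrom
    constructor
    · intro h
      exact ⟨funext fun i => h.2 _, funext fun i => h.2 _⟩
    · rintro ⟨h1, h2⟩
      refine ⟨fun i hi => absurd i.2 (by omega), fun q => ?_⟩
      rcases q with i | i
      · exact congrFun h1 i
      · exact congrFun h2 i
  simp only [uniformState, h, prefixCount, Nat.sub_self, pow_zero]
  by_cases hx : indexValue x < N
  · have h1 : min N (indexValue x + 1) - indexValue x = 1 := by omega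
    rw [dif_pos hx, h1, Nat.cast_one, Real.sqrt_div zero_le_one, Real.sqrt_one]
  · have h1 : min N (indexValue x + 1) - indexValue x = 0 := by omega
    rw [dif_neg hx, h1]
    simp

theorem impl_splitOps (hN : 0 < N) (t : Fin (n + 1) ↪ Fin w) (r : ℕ) :
    Impl (N := N) (d := d) (2 * r + 1) 0 (fun _ => splitOps (m := m) hN t r) := by
  induction r with
  | zero =>
    exact (impl_target _ ∅ (by simp) _ (fun _ _ => rfl) fun _ _ _ => rfl).mono (by simp) le_rfl
  | succ r ih =>
    by_cases h : r < n
    · let L := indexLadder (m := m) N t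
      have h1 : Impl (N := N) (d := d) 1 0 (fun _ => splitOp (m := m) hN t ⟨r, h⟩) := by
        refine impl_target _ {L.flag (Fin.castSucc ⟨r, h⟩)} (by simp) _ _ fun x y hxy => ?_
        rw [hxy _ (by simp [L])]
      have h2 : Impl (N := N) (d := d) 1 0 (fun _ => L.step ⟨r, h⟩) := by
        refine impl_target _ {L.flag (Fin.castSucc ⟨r, h⟩), L.inp ⟨r, h⟩} Finset.card_le_two _
          (fun x b => by rw [L.cond_update]) fun x y hxy => ?_
        rw [Ladder.cond, Ladder.cond, hxy _ (by simp), hxy _ (by simp)]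
      refine ((ih.trans (h1.trans h2)).mono (by push_cast; linarith) (by simp)).congr fun O ψ => ?_
      simp only [splitOps, h, dif_pos]
      rfl
    · refine (ih.mono (by push_cast; linarith) le_rfl).congr fun O ψ => ?_
      simp only [splitOps, h, dif_neg, not_false_eq_true]
      rfl

theorem impl_uniformOp (hN : 0 < N) (t : Fin (n + 1) ↪ Fin w) :
    Impl (N := N) (d := d) (3 * n + 2) 0 (fun _ => uniformOp (m := m) hN t) :=
  ((impl_splitOps hN t n).trans ((indexLadder N t).impl_op n).symm).mono (by linarith) (by simp)

end uniform

section rotation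

variable {H : Type*} [NormedAddCommGroup H] [InnerProductSpace ℂ H]

/-- On the span of `φ` and `G φ`, the isometry `G` is a rotation by the angle `θ`. -/
structure RotatesBy (G : H →ₗ[ℂ] H) (φ : H) (θ : ℝ) : Prop where
  sq_apply : G (G φ) = (2 * Real.cos θ : ℂ) • G φ - φ
  inner_apply : inner ℂ φ (G φ) = Real.cos θ * ‖φ‖ ^ 2
  norm_apply : ‖G φ‖ = ‖φ‖

/-- The vector `v` arises from `φ` by a polynomial in `G` which takes the values `p`, `q` at
`exp (i θ)`, `exp (-i θ)`. -/
def Represents (G : H →ₗ[ℂ] H) (φ : H) (θ : ℝ) (v : H) (p q : ℂ) : Prop :=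
  ∃ α β : ℂ, v = α • φ + β • G φ ∧ p = α + β * Complex.exp (θ * Complex.I) ∧
    q = α + β * Complex.exp (-θ * Complex.I)

variable {G : H →ₗ[ℂ] H} {φ : H} {θ : ℝ}

theorem represents_self : Represents G φ θ φ 1 1 := ⟨1, 0, by simp, by simp, by simp⟩

theorem Represents.add {v v' : H} {p q p' q' : ℂ} (h : Represents G φ θ v p q)
    (h' : Represents G φ θ v' p' q') : Represents G φ θ (v + v') (p + p') (q + q') := by
  obtain ⟨α, β, rfl, rfl, rfl⟩ := h
  obtain ⟨α', β', rfl, rfl, rfl⟩ := h'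
  exact ⟨α + α', β + β', by module, by ring, by ring⟩

theorem Represents.smul {v : H} {p q : ℂ} (h : Represents G φ θ v p q) (c : ℂ) :
    Represents G φ θ (c • v) (c * p) (c * q) := by
  obtain ⟨α, β, rfl, rfl, rfl⟩ := h
  exact ⟨c * α, c * β, by module, by ring, by ring⟩

theorem exp_sq_eq (θ : ℂ) : Complex.exp (θ * Complex.I) * Complex.exp (θ * Complex.I)
    = 2 * Complex.cos θ * Complex.exp (θ * Complex.I) - 1 := by
  have h : Complex.exp (-θ * Complex.I) * Complex.exp (θ * Complex.I) = 1 := by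
    rw [← Complex.exp_add]
    simp
  rw [Complex.cos]
  linear_combination -h

theorem Represents.apply {v : H} {p q : ℂ} (hG : RotatesBy G φ θ) (h : Represents G φ θ v p q) :
    Represents G φ θ (G v) (Complex.exp (θ * Complex.I) * p)
      (Complex.exp (-θ * Complex.I) * q) := by
  obtain ⟨α, β, rfl, rfl, rfl⟩ := h
  refine ⟨-β, α + 2 * Real.cos θ * β, ?_, ?_, ?_⟩
  · rw [map_add, map_smul, map_smul, hG.sq_apply]
    module
  · have := exp_sq_eq θ
    push_cast
    linear_combination β * this
  · have := exp_sq_eq (-θ)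
    rw [Complex.cos_neg] at this
    push_cast
    linear_combination β * this

theorem Represents.iterate {v : H} {p q : ℂ} (hG : RotatesBy G φ θ) (h : Represents G φ θ v p q)
    (k : ℕ) : Represents G φ θ (G^[k] v) (Complex.exp ((k * θ : ℝ) * Complex.I) * p)
      (Complex.exp ((k * -θ : ℝ) * Complex.I) * q) := by
  induction k with
  | zero => simpa using h
  | succ k ih =>
    rw [iterate_succ_apply']
    convert ih.apply hG using 1
    · rw [← mul_assoc, ← Complex.exp_add]
      congr 2
      push_cast
      ring
    · rw [← mul_assoc, ← Complex.exp_add]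
      congr 2
      push_cast
      ring

theorem Represents.norm_sq {v : H} {p q : ℂ} (hG : RotatesBy G φ θ)
    (h : Represents G φ θ v p q) : ‖v‖ ^ 2 = (‖p‖ ^ 2 + ‖q‖ ^ 2) / 2 * ‖φ‖ ^ 2 := by
  obtain ⟨α, β, rfl, rfl, rfl⟩ := h
  have h1 : ∀ t : ℝ, ‖α + β * Complex.exp (t * Complex.I)‖ ^ 2
      = ‖α‖ ^ 2 + ‖β‖ ^ 2 + 2 * (starRingEnd ℂ α * β * Complex.exp (t * Complex.I)).re := by
    intro t
    rw [@norm_add_sq ℂ ℂ, norm_mul, Complex.norm_exp_ofReal_mul_I, mul_one]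
    simp only [RCLike.inner_apply, RCLike.re_to_complex]
    rw [mul_comm _ (starRingEnd ℂ α), ← mul_assoc]
    ring
  have h2 := h1 (-θ)
  rw [Complex.ofReal_neg] at h2
  rw [h1, h2, @norm_add_sq ℂ, norm_smul, norm_smul, hG.norm_apply, inner_smul_left,
    inner_smul_right, hG.inner_apply]
  have h3 : (starRingEnd ℂ α * (β * ((Real.cos θ : ℂ) * (‖φ‖ : ℂ) ^ 2)))
      = ((Real.cos θ * ‖φ‖ ^ 2 : ℝ) : ℂ) * (starRingEnd ℂ α * β) := by
    push_cast
    ring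
  have h4 : (starRingEnd ℂ α * β * Complex.exp (θ * Complex.I)).re
      + (starRingEnd ℂ α * β * Complex.exp (-θ * Complex.I)).re
      = 2 * Real.cos θ * (starRingEnd ℂ α * β).re := by
    rw [← Complex.add_re, ← mul_add]
    have : Complex.exp (θ * Complex.I) + Complex.exp (-θ * Complex.I)
        = ((2 * Real.cos θ : ℝ) : ℂ) := by
      push_cast
      rw [Complex.cos]
      ring
    rw [this, mul_comm, Complex.re_ofReal_mul]
  rw [RCLike.re_to_complex, Complex.ofReal_cos, ← Complex.ofReal_cos, h3, Complex.re_ofReal_mul]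
  linear_combination -(‖φ‖ ^ 2) * h4

/-- The product of two reflections is a rotation. -/
theorem exists_rotatesBy (A B R : H ≃ₗᵢ[ℂ] H) (Z : H →ₗ[ℂ] H) (φ₀ : H) (a : ℝ)
    (hB : ∀ ψ, B (B ψ) = ψ) (hR : ∀ ψ, R ψ = (2 : ℂ) • Z ψ - ψ) (hφ₀ : Z φ₀ = φ₀)
    (hZ : ∀ ψ, inner ℂ φ₀ ψ = inner ℂ φ₀ (Z ψ))
    (ha : Z (A.symm (B (A φ₀))) = (a : ℂ) • φ₀) (hne : φ₀ ≠ 0) (G : H →ₗ[ℂ] H)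
    (hG : ∀ ψ, G ψ = A (R (A.symm (B ψ)))) :
    ∃ θ, Real.cos θ = a ∧ RotatesBy G (A φ₀) θ := by
  have h1 : inner ℂ (A φ₀) (B (A φ₀)) = (a : ℂ) * (‖φ₀‖ : ℂ) ^ 2 := by
    have h := hZ (A.symm (B (A φ₀)))
    rw [ha, inner_smul_right, inner_self_eq_norm_sq_to_K, ← A.inner_map_map, A.apply_symm_apply] at h
    exact h
  have hpos : 0 < ‖φ₀‖ ^ 2 := by positivity
  have h2 : |a| ≤ 1 := by
    have h3 := norm_inner_le_norm (𝕜 := ℂ) (A φ₀) (B (A φ₀))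
    rw [h1, B.norm_map, A.norm_map, norm_mul, norm_pow, Complex.norm_real, Complex.norm_real,
      norm_norm, Real.norm_eq_abs, ← sq] at h3
    exact le_of_mul_le_mul_right (by linarith) hpos
  have hcos : Real.cos (Real.arccos a) = a := Real.cos_arccos (abs_le.1 h2).1 (abs_le.1 h2).2
  have h4 : G (A φ₀) = (2 * a : ℂ) • A φ₀ - B (A φ₀) := by
    rw [hG, hR, ha, map_sub, A.apply_symm_apply, map_smul, map_smul, smul_smul]
  have h5 : G (B (A φ₀)) = A φ₀ := by
    rw [hG, hB, A.symm_apply_apply, hR, hφ₀]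
    congr 1
    module
  refine ⟨Real.arccos a, hcos, ?_, ?_, ?_⟩
  · conv_lhs => rw [h4, map_sub, map_smul, h5]
    rw [hcos]
  · rw [h4, inner_sub_right, inner_smul_right, inner_self_eq_norm_sq_to_K, h1, hcos, A.norm_map]
    simp only [Complex.coe_algebraMap]
    ring
  · rw [hG]
    simp

end rotation

section estimate

/-- The value of a weight at the sine of half the error of an estimated phase. -/
def phaseWeight (s : ℝ) : ℝ := Real.sqrt s * (1 + 2 * (s * Real.sqrt s))

theorem phaseWeight_split {s c : ℝ} (hs : 0 ≤ s) (hc : 0 ≤ c) (hs1 : s ≤ 1) (hc1 : c ≤ 1) :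
    c ^ 2 * phaseWeight s + s ^ 2 * phaseWeight c
      ≤ (Real.sqrt 2)⁻¹ * phaseWeight (2 * (s * c)) := by
  unfold phaseWeight
  obtain ⟨x, hx, rfl⟩ : ∃ x, 0 ≤ x ∧ s = x ^ 2 :=
    ⟨Real.sqrt s, Real.sqrt_nonneg s, (Real.sq_sqrt hs).symm⟩
  obtain ⟨y, hy, rfl⟩ : ∃ y, 0 ≤ y ∧ c = y ^ 2 :=
    ⟨Real.sqrt c, Real.sqrt_nonneg c, (Real.sq_sqrt hc).symm⟩
  have h2 : (0 : ℝ) < Real.sqrt 2 := Real.sqrt_pos.2 zero_lt_two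
  have h3 : (5 / 4 : ℝ) ≤ Real.sqrt 2 := Real.le_sqrt_of_sq_le (by norm_num)
  rw [Real.sqrt_mul zero_le_two, Real.sqrt_mul (sq_nonneg x), Real.sqrt_sq hx, Real.sqrt_sq hy]
  have hx1 : x ^ 3 ≤ 1 := pow_le_one₀ hx ((sq_le_one_iff₀ hx).1 hs1)
  have hy1 : y ^ 3 ≤ 1 := pow_le_one₀ hy ((sq_le_one_iff₀ hy).1 hc1)
  have h4 : (Real.sqrt 2)⁻¹ * (Real.sqrt 2 * (x * y) *
      (1 + 2 * (2 * (x ^ 2 * y ^ 2) * (Real.sqrt 2 * (x * y)))))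
      = x * y * (1 + 4 * Real.sqrt 2 * (x ^ 3 * y ^ 3)) := by
    field_simp
    ring
  have h5 : 0 ≤ x ^ 3 * y ^ 3 := by positivity
  have h6 : x ^ 3 + y ^ 3 + 4 * (x ^ 3 * y ^ 3) ≤ 1 + 4 * Real.sqrt 2 * (x ^ 3 * y ^ 3) := by
    nlinarith [mul_nonneg (sub_nonneg.2 hx1) (sub_nonneg.2 hy1),
      mul_le_mul_of_nonneg_right h3 h5]
  rw [h4]
  have h7 := mul_le_mul_of_nonneg_left h6 (mul_nonneg hx hy)
  linarith

/-- The bit `i` of a bit string. -/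
def bitAt {K : ℕ} (y : Fin K → Bool) (i : ℕ) : Bool := if h : i < K then y ⟨i, h⟩ else false

/-- The phase which is read off from the first `i` bits. -/
def estimatedPhase {K : ℕ} (y : Fin K → Bool) : ℕ → ℝ
  | 0 => 0
  | i + 1 => estimatedPhase y i / 2 + if bitAt y i then Real.pi else 0

/-- The amplitude of the first `i` bits in the estimation of the phase `θ` with `K` bits. -/
def phaseAmp {K : ℕ} (θ : ℝ) (y : Fin K → Bool) : ℕ → ℂ
  | 0 => 1
  | i + 1 => (2 : ℂ)⁻¹ * (phaseAmp θ y i + (if bitAt y i then -1 else 1) *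
      (Complex.exp (-(estimatedPhase y i / 2 : ℝ) * Complex.I) *
        (Complex.exp (((2 ^ (K - (i + 1)) : ℕ) * θ : ℝ) * Complex.I) * phaseAmp θ y i)))

theorem norm_one_add_exp_sq (t : ℝ) : ‖1 + Complex.exp (t * Complex.I)‖ ^ 2
    = 4 * Real.cos (t / 2) ^ 2 := by
  rw [← Complex.normSq_eq_norm_sq, Complex.normSq_apply]
  simp only [Complex.add_re, Complex.add_im, Complex.one_re, Complex.one_im,
    Complex.exp_ofReal_mul_I_re, Complex.exp_ofReal_mul_I_im]
  have h := Real.cos_sq_add_sin_sq t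
  have h' := Real.cos_sq (t / 2)
  rw [mul_div_cancel₀ t two_ne_zero] at h'
  rw [h']
  linarith

theorem norm_phaseAmp_succ_sq {K : ℕ} (θ : ℝ) (y : Fin K → Bool) (i : ℕ) :
    ‖phaseAmp θ y (i + 1)‖ ^ 2 = Real.cos (((2 ^ (K - (i + 1)) : ℕ) * θ
      - estimatedPhase y (i + 1)) / 2) ^ 2 * ‖phaseAmp θ y i‖ ^ 2 := by
  have h : phaseAmp θ y (i + 1) = (2 : ℂ)⁻¹ * ((1 + Complex.exp
      (((2 ^ (K - (i + 1)) : ℕ) * θ - estimatedPhase y (i + 1) : ℝ) * Complex.I))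
        * phaseAmp θ y i) := by
    have h1 : Complex.exp (((2 ^ (K - (i + 1)) : ℕ) * θ - estimatedPhase y (i + 1) : ℝ) * Complex.I)
        = (if bitAt y i then -1 else 1) * (Complex.exp (-(estimatedPhase y i / 2 : ℝ) * Complex.I) *
        Complex.exp (((2 ^ (K - (i + 1)) : ℕ) * θ : ℝ) * Complex.I)) := by
      rw [estimatedPhase, ← Complex.exp_add]
      split_ifs
      · rw [← Complex.exp_neg_pi_mul_I, ← Complex.exp_add]
        congr 1
        push_cast
        ring
      · rw [one_mul]
        congr 1
        push_cast
        ring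
    rw [h1, phaseAmp]
    ring
  rw [h, norm_mul, norm_mul, mul_pow, mul_pow, norm_one_add_exp_sq]
  rw [norm_inv, Complex.norm_ofNat]
  ring

theorem estimatedPhase_congr {K : ℕ} {y y' : Fin K → Bool} (i : ℕ)
    (h : ∀ l < i, bitAt y l = bitAt y' l) : estimatedPhase y i = estimatedPhase y' i := by
  induction i with
  | zero => rfl
  | succ i ih =>
    rw [estimatedPhase, estimatedPhase, ih fun l hl => h l (hl.trans (Nat.lt_succ_self i)),
      h i (Nat.lt_succ_self i)]

theorem phaseAmp_congr {K : ℕ} (θ : ℝ) {y y' : Fin K → Bool} (i : ℕ)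
    (h : ∀ l < i, bitAt y l = bitAt y' l) : phaseAmp θ y i = phaseAmp θ y' i := by
  induction i with
  | zero => rfl
  | succ i ih =>
    have h' : ∀ l < i, bitAt y l = bitAt y' l := fun l hl => h l (hl.trans (Nat.lt_succ_self i))
    rw [phaseAmp, phaseAmp, ih h', h i (Nat.lt_succ_self i), estimatedPhase_congr i h']

theorem bitAt_update_of_ne {K : ℕ} (y : Fin K → Bool) (i : Fin K) (b : Bool) {l : ℕ} (h : l ≠ i) :
    bitAt (update y i b) l = bitAt y l := by
  unfold bitAt
  split_ifs with hl
  · rw [update_of_ne]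
    rintro rfl
    exact h rfl
  · rfl

theorem bitAt_val {K : ℕ} (y : Fin K → Bool) (i : Fin K) : bitAt y i = y i := by
  simp [bitAt]

/-- The expected weight of the error after `i` bits. -/
def expectedWeight (K : ℕ) (θ : ℝ) (i : ℕ) : ℝ :=
  ∑ y : Fin K → Bool, ‖phaseAmp θ y i‖ ^ 2
    * phaseWeight |Real.sin (((2 ^ (K - i) : ℕ) * θ - estimatedPhase y i) / 2)|

theorem expectedWeight_succ_le (K : ℕ) (θ : ℝ) (i : ℕ) (hi : i < K) :
    expectedWeight K θ (i + 1) ≤ (2 * Real.sqrt 2)⁻¹ * expectedWeight K θ i := by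
  let f : (Fin K → Bool) → ℝ := fun y => ‖phaseAmp θ y (i + 1)‖ ^ 2
    * phaseWeight |Real.sin (((2 ^ (K - (i + 1)) : ℕ) * θ - estimatedPhase y (i + 1)) / 2)|
  let ι : (Fin K → Bool) ≃ (Fin K → Bool) :=
    Involutive.toPerm (fun y => update y ⟨i, hi⟩ (!(y ⟨i, hi⟩))) fun y => by simp
  have h1 : expectedWeight K θ (i + 1) = 2⁻¹ * ∑ y, (f y + f (ι y)) := by
    rw [Finset.sum_add_distrib, Equiv.sum_comp ι f]
    change ∑ y, f y = _
    ring
  rw [h1, mul_inv, mul_assoc, expectedWeight]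
  refine mul_le_mul_of_nonneg_left ?_ (by norm_num)
  rw [Finset.mul_sum]
  refine Finset.sum_le_sum fun y _ => ?_
  have hcongr : ∀ l < i, bitAt (ι y) l = bitAt y l := fun l hl =>
    bitAt_update_of_ne y ⟨i, hi⟩ _ hl.ne
  have hbit : bitAt (ι y) i = !(bitAt y i) := by
    have h2 := bitAt_val (ι y) ⟨i, hi⟩
    have h3 := bitAt_val y ⟨i, hi⟩
    rw [h2, h3]
    simp [ι, Involutive.toPerm]
  set e : ℝ := ((2 ^ (K - (i + 1)) : ℕ) * θ - estimatedPhase y i / 2) / 2 with he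
  have key : ∀ z : Fin K → Bool, (∀ l < i, bitAt z l = bitAt y l) →
      f z = ‖phaseAmp θ y i‖ ^ 2 * (if bitAt z i
        then |Real.sin e| ^ 2 * phaseWeight |Real.cos e|
        else |Real.cos e| ^ 2 * phaseWeight |Real.sin e|) := by
    intro z hz
    simp only [f]
    rw [norm_phaseAmp_succ_sq, phaseAmp_congr θ i hz, estimatedPhase, estimatedPhase_congr i hz]
    cases bitAt z i
    · simp only [Bool.false_eq_true, if_false, add_zero, ← he, sq_abs]
      ring
    · simp only [if_true]
      rw [show ((2 ^ (K - (i + 1)) : ℕ) * θ - (estimatedPhase y i / 2 + Real.pi)) / 2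
        = e - Real.pi / 2 by rw [he]; ring, Real.cos_sub_pi_div_two, Real.sin_sub_pi_div_two,
        abs_neg, sq_abs]
      ring
  have h2 : |Real.sin (((2 ^ (K - i) : ℕ) * θ - estimatedPhase y i) / 2)|
      = 2 * (|Real.sin e| * |Real.cos e|) := by
    rw [show ((2 ^ (K - i) : ℕ) * θ - estimatedPhase y i) / 2 = 2 * e by
      rw [he, two_pow_sub_eq hi]; push_cast; ring, Real.sin_two_mul, abs_mul, abs_mul, abs_two,
      mul_assoc]
  have h3 := phaseWeight_split (abs_nonneg (Real.sin e)) (abs_nonneg (Real.cos e))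
    (Real.abs_sin_le_one e) (Real.abs_cos_le_one e)
  have h4 : f y + f (ι y) = ‖phaseAmp θ y i‖ ^ 2 * (|Real.cos e| ^ 2 * phaseWeight |Real.sin e|
      + |Real.sin e| ^ 2 * phaseWeight |Real.cos e|) := by
    rw [key y fun _ _ => rfl, key (ι y) hcongr, hbit]
    cases bitAt y i <;> simp only [Bool.not_false, Bool.not_true, if_true, if_false,
      Bool.false_eq_true] <;> ring
  rw [h4, h2]
  calc _ ≤ ‖phaseAmp θ y i‖ ^ 2 * ((Real.sqrt 2)⁻¹ * phaseWeight (2 * (|Real.sin e| * |Real.cos e|)))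
        := mul_le_mul_of_nonneg_left h3 (sq_nonneg _)
    _ = _ := by ring

theorem phaseWeight_le {s : ℝ} (hs : 0 ≤ s) (h : s ≤ 1) : phaseWeight s ≤ 3 := by
  have h1 : Real.sqrt s ≤ 1 := Real.sqrt_le_one.2 h
  have h2 := Real.sqrt_nonneg s
  unfold phaseWeight
  nlinarith [mul_le_one₀ h h2 h1, mul_nonneg hs h2]

theorem expectedWeight_le (K : ℕ) (θ : ℝ) (i : ℕ) (hi : i ≤ K) :
    expectedWeight K θ i ≤ (2 * Real.sqrt 2)⁻¹ ^ i * (3 * 2 ^ K) := by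
  induction i with
  | zero =>
    rw [pow_zero, one_mul, expectedWeight]
    calc _ ≤ ∑ _y : Fin K → Bool, (3 : ℝ) := by
          refine Finset.sum_le_sum fun y _ => ?_
          simp only [phaseAmp, norm_one, one_pow, one_mul]
          exact phaseWeight_le (abs_nonneg _) (Real.abs_sin_le_one _)
      _ = _ := by simp [mul_comm]
  | succ i ih =>
    refine (expectedWeight_succ_le K θ i hi).trans ?_
    rw [pow_succ', mul_assoc]
    exact mul_le_mul_of_nonneg_left (ih (by omega)) (by positivity)

theorem abs_cos_sub_cos_le (α θ : ℝ) :
    |Real.cos α - Real.cos θ| ≤ 2 * |Real.sin ((θ - α) / 2)| := by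
  rw [Real.cos_sub_cos, abs_mul, abs_mul, abs_neg, abs_two, ← abs_neg (Real.sin ((θ - α) / 2)),
    ← Real.sin_neg, show -((θ - α) / 2) = (α - θ) / 2 by ring]
  nlinarith [Real.abs_sin_le_one ((α + θ) / 2), abs_nonneg (Real.sin ((α - θ) / 2))]

/-- The probability of an error larger than `η` in the estimation of `cos θ`. -/
theorem sum_phaseAmp_le (K : ℕ) (θ η : ℝ) (hη : 0 < η) :
    ∑ y : Fin K → Bool, (if η < |Real.cos (estimatedPhase y K) - Real.cos θ| then
      ‖phaseAmp θ y K‖ ^ 2 else 0) ≤ 3 * (Real.sqrt 2)⁻¹ ^ K / Real.sqrt (η / 2) := by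
  have hpos : 0 < Real.sqrt (η / 2) := Real.sqrt_pos.2 (by positivity)
  have h2 : (0 : ℝ) < Real.sqrt 2 := Real.sqrt_pos.2 zero_lt_two
  rw [le_div_iff₀ hpos, Finset.sum_mul]
  have h := expectedWeight_le K θ K le_rfl
  have h3 : (2 * Real.sqrt 2)⁻¹ ^ K * (3 * 2 ^ K) = 3 * (Real.sqrt 2)⁻¹ ^ K := by
    rw [mul_inv, mul_pow, inv_pow]
    field_simp
  rw [h3] at h
  refine le_trans (Finset.sum_le_sum fun y _ => ?_) h
  rw [Nat.sub_self, pow_zero, Nat.cast_one, one_mul]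
  set s := |Real.sin ((θ - estimatedPhase y K) / 2)|
  have hs : 0 ≤ s := abs_nonneg _
  have hw : Real.sqrt s ≤ phaseWeight s := by
    unfold phaseWeight
    exact le_mul_of_one_le_right (Real.sqrt_nonneg s)
      (by have := mul_nonneg hs (Real.sqrt_nonneg s); linarith)
  split_ifs with hbad
  · refine mul_le_mul_of_nonneg_left (le_trans (Real.sqrt_le_sqrt ?_) hw) (sq_nonneg _)
    have := abs_cos_sub_cos_le (estimatedPhase y K) θ
    linarith
  · rw [zero_mul]
    exact mul_nonneg (sq_nonneg _) ((Real.sqrt_nonneg s).trans hw)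

end estimate

section estimation

variable {N n d m w K : ℕ}

/-- The qubits used by an estimation: `K` result qubits, a control qubit and `d` data qubits, and
`d + 2` flags. -/
abbrev RegType (K d : ℕ) : Type := Fin K ⊕ Fin (d + 1) ⊕ Fin (d + 2)

/-- The work qubit with a given number. -/
def workQ (i : Fin w) : Qubit n m w := Sum.inr (Sum.inr i)

@[simp]
theorem workQ_inj {i j : Fin w} : (workQ i : Qubit n m w) = workQ j ↔ i = j := by
  simp [workQ]

/-- The index qubits. -/
def indexQubits (n m w : ℕ) : Set (Qubit n m w) := Set.range Sum.inl

variable (ρ : RegType K d ↪ Fin w)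

/-- The qubits of an estimation. -/
def regQubits : Set (Qubit n m w) := Set.range fun r => workQ (ρ r)

/-- The qubits of an estimation, without the result qubits. -/
def innerQubits : Set (Qubit n m w) := Set.range fun r => workQ (ρ (Sum.inr r))

theorem innerQubits_subset : innerQubits (n := n) (m := m) ρ ⊆ regQubits ρ := by
  rintro _ ⟨r, rfl⟩
  exact ⟨_, rfl⟩

theorem workQ_mem_innerQubits (r : Fin (d + 1) ⊕ Fin (d + 2)) :
    (workQ (ρ (Sum.inr r)) : Qubit n m w) ∈ innerQubits ρ := ⟨r, rfl⟩

theorem result_notMem (i : Fin K) :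
    (workQ (ρ (Sum.inl i)) : Qubit n m w) ∉ innerQubits ρ ∪ indexQubits n m w := by
  rintro (⟨r, hr⟩ | ⟨l, hl⟩)
  · simp at hr
  · exact absurd hl (by simp [workQ])

/-- The control qubit. -/
def ctlW : Fin w := ρ (Sum.inr (Sum.inl 0))

/-- The data qubits. -/
def dataW : Fin d ↪ Fin w :=
  ⟨fun i => ρ (Sum.inr (Sum.inl i.succ)), fun i j h => by simpa using h⟩

/-- The result qubits. -/
def resultW : Fin K ↪ Fin w := ⟨fun i => ρ (Sum.inl i), fun i j h => by simpa using h⟩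

theorem ctlW_notMem : ctlW ρ ∉ Set.range (dataW ρ) := by
  rintro ⟨i, hi⟩
  have := ρ.injective hi
  simp at this

/-- The comparison of the control and data qubits with zero. -/
def regLadder : Ladder (Qubit n m w) (d + 1) where
  inp := workQubits ⟨fun i => ρ (Sum.inr (Sum.inl i)), fun i j h => by simpa using h⟩
  flag := workQubits ⟨fun i => ρ (Sum.inr (Sum.inr i)), fun i j h => by simpa using h⟩
  disjoint i s h := by
    have := ρ.injective (Sum.inr.inj (Sum.inr.inj h))
    simp at this
  pattern _ := false

/-- The operator which prepares, from zero, the state `(|0⟩ |u⟩ + |1⟩ |v⟩) / √2`. -/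
def pairOp (O : Access N d m) : State n m w ≃ₗᵢ[ℂ] State n m w :=
  ((target (workQ (ctlW ρ)) (fun _ => hadamard) fun _ _ => rfl).trans
    (prepOp O Side.left false (ctlW ρ) (dataW ρ) (ctlW_notMem ρ))).trans
  ((flipIf (workQ (ctlW ρ)) (fun _ => true) fun _ _ => rfl).trans
    (prepOp O Side.right false (ctlW ρ) (dataW ρ) (ctlW_notMem ρ)))

theorem impl_pairOp : Impl (N := N) (n := n) (m := m) 2 2 (pairOp ρ) :=
  (((impl_target _ ∅ (by simp) _ (fun _ _ => rfl) fun _ _ _ => rfl).trans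
    (impl_prepare _ _ _ _ _)).trans
    ((impl_target _ ∅ (by simp) _ (fun _ _ => rfl) fun _ _ _ => rfl).trans
    (impl_prepare _ _ _ _ _))).mono (by norm_num) (by norm_num)

theorem supportedOn_prepOp (O : Access N d m) (side : Side) (inverse : Bool) :
    SupportedOn (indexQubits n m w) (innerQubits ρ)
      (prepOp O side inverse (ctlW ρ) (dataW ρ) (ctlW_notMem ρ)) :=
  supportedOn_ctrl _ _ _ _ _ (fun _ => workQ_mem_innerQubits ρ _) fun _ _ h =>
    prepUnitary_congr _ _ _ _ (fun i => h _ (Or.inr ⟨i, rfl⟩))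
      (h _ (Or.inl (workQ_mem_innerQubits ρ _)))

theorem supportedOn_pairOp (O : Access N d m) :
    SupportedOn (indexQubits n m w) (innerQubits ρ) (pairOp ρ O) :=
  ((supportedOn_target _ _ _ _ (fun _ _ => rfl) (workQ_mem_innerQubits ρ _)
    fun _ _ _ => rfl).trans (supportedOn_prepOp ρ O _ _)).trans
  ((supportedOn_target _ _ _ _ (fun _ _ => rfl) (workQ_mem_innerQubits ρ _)
    fun _ _ _ => rfl).trans (supportedOn_prepOp ρ O _ _))

theorem prepOp_apply_true (O : Access N d m) (side : Side) (inverse : Bool) (c : Fin w)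
    (data : Fin d ↪ Fin w) (h : c ∉ Set.range data) (ψ : State n m w) (x : Label n m w) (j : Fin N)
    (hx : indexValue x = j) (hc : x (workQ c) = true) :
    prepOp O side inverse c data h ψ x = ∑ a, (if inverse then (O.family side j)⁻¹
      else O.family side j).1 (fun i => x (workQ (data i))) a
        * ψ (extend (workQubits data) a x) := by
  have h1 : indexValue x < N := hx ▸ j.2
  have h2 : (⟨indexValue x, h1⟩ : Fin N) = j := Fin.ext hx
  have h3 : workPart x c = true := hc
  rw [prepOp, ctrl_apply, prepUnitary, dif_pos h1, if_pos h3, h2]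
  rfl

theorem prepOp_apply_false (O : Access N d m) (side : Side) (inverse : Bool) (c : Fin w)
    (data : Fin d ↪ Fin w) (h : c ∉ Set.range data) (ψ : State n m w) (x : Label n m w)
    (hc : x (workQ c) = false) : prepOp O side inverse c data h ψ x = ψ x := by
  rw [← apply_prepare]
  have h1 : ¬ workPart x c = true := by
    rw [show workPart x c = false from hc]
    simp
  simp [Gate.apply, h1]

theorem prepOp_symm (O : Access N d m) (side : Side) (c : Fin w)
    (data : Fin d ↪ Fin w) (h : c ∉ Set.range data) :
    (prepOp (n := n) O side false c data h).symm = prepOp O side true c data h :=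
  (Gate.op_inv O (Gate.prepare side false c data h)).symm

/-- The label `x`, with the control and data qubits set to zero. -/
def zeroPair (x : Label n m w) : Label n m w :=
  update (extend (workQubits (dataW ρ)) (fun _ => false) x) (workQ (ctlW ρ)) false

theorem update_ctlW_workQ_dataW (x : Label n m w) (b : Bool) (i : Fin d) :
    update x (workQ (ctlW ρ)) b (workQ (dataW ρ i)) = x (workQ (dataW ρ i)) := by
  rw [update_of_ne]
  rw [ne_eq, workQ_inj]
  exact fun h => ctlW_notMem ρ ⟨i, h⟩

theorem extend_dataW_ctlW (x : Label n m w) (a : Fin d → Bool) :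
    extend (workQubits (dataW ρ)) a x (workQ (ctlW ρ)) = x (workQ (ctlW ρ)) :=
  extend_workQubits_of_notMem _ _ _ _ (ctlW_notMem ρ)

theorem extend_dataW_dataW (x : Label n m w) (a : Fin d → Bool) (i : Fin d) :
    extend (workQubits (dataW ρ)) a x (workQ (dataW ρ i)) = a i :=
  (workQubits (n := n) (m := m) (dataW ρ)).injective.extend_apply a x i

theorem update_extend (x : Label n m w) (a : Fin d → Bool) (b : Bool) :
    update (extend (workQubits (dataW ρ)) a x) (workQ (ctlW ρ)) b
      = extend (workQubits (dataW ρ)) a (update x (workQ (ctlW ρ)) b) := by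
  funext q
  by_cases hq : ∃ i, workQubits (dataW ρ) i = q
  · obtain ⟨i, rfl⟩ := hq
    exact (update_ctlW_workQ_dataW ρ _ b i).trans
      ((extend_dataW_dataW ρ x a i).trans (extend_dataW_dataW ρ _ a i).symm)
  · rw [extend_apply' _ _ _ hq]
    by_cases hq' : q = workQ (ctlW ρ)
    · subst hq'
      rw [update_self, update_self]
    · rw [update_of_ne hq', update_of_ne hq', extend_apply' _ _ _ hq]

theorem indexValue_update_workQ (x : Label n m w) (i : Fin w) (b : Bool) :
    indexValue (update x (workQ i) b) = indexValue x :=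
  indexValue_congr fun l => update_of_ne (by simp [workQ]) _ _

theorem indexValue_extend_workQubits {k : ℕ} (e : Fin k ↪ Fin w) (x : Label n m w)
    (a : Fin k → Bool) : indexValue (extend (workQubits e) a x) = indexValue x :=
  indexValue_congr fun l => extend_workQubits_inl _ _ _ l

theorem zeroPair_update (x : Label n m w) (b : Bool) :
    zeroPair ρ (update x (workQ (ctlW ρ)) b) = zeroPair ρ x := by
  rw [zeroPair, ← update_extend, update_idem, zeroPair]

theorem zeroPair_extend (x : Label n m w) (a : Fin d → Bool) :
    zeroPair ρ (extend (workQubits (dataW ρ)) a x) = zeroPair ρ x := by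
  rw [zeroPair, extend_extend, zeroPair]

/-- A state vanishes on labels for which one of the qubits in `S` is set. -/
def VanishesOff {Q : Type} [Fintype Q] [DecidableEq Q] (S : Set Q) (χ : QState Q) : Prop :=
  ∀ x, ∀ q ∈ S, x q = true → χ x = 0

theorem sum_extend_of_vanishes (χ : State n m w) (hχ : VanishesOff (innerQubits ρ) χ)
    (x : Label n m w) (M : (Fin d → Bool) → ℂ) :
    ∑ a, M a * χ (update (extend (workQubits (dataW ρ)) a x) (workQ (ctlW ρ)) false)
      = M (fun _ => false) * χ (zeroPair ρ x) := by
  rw [Finset.sum_eq_single fun _ => false]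
  · rfl
  · intro a _ ha
    obtain ⟨i, hi⟩ : ∃ i, a i = true := by
      by_contra h
      exact ha (funext fun i => by simpa using fun h' => h ⟨i, h'⟩)
    rw [hχ _ (workQ (dataW ρ i)) (workQ_mem_innerQubits ρ _), mul_zero]
    rw [update_ctlW_workQ_dataW, extend_dataW_dataW, hi]
  · simp

theorem hadamard_apply_false (b : Bool) : hadamard.1 b false = ((Real.sqrt 2 : ℝ) : ℂ)⁻¹ := by
  cases b <;> simp [hadamard, unitaryTwo]

theorem hadamard_apply_true (b : Bool) :
    hadamard.1 b true = (if b then -1 else 1) * ((Real.sqrt 2 : ℝ) : ℂ)⁻¹ := by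
  cases b <;> simp [hadamard, unitaryTwo]

/-- The side of the states prepared when the control qubit has a given value. -/
def sideOf (b : Bool) : Side := if b then Side.right else Side.left

theorem pairOp_apply (O : Access N d m) (χ : State n m w)
    (hχ : VanishesOff (innerQubits ρ) χ) (x : Label n m w) (j : Fin N) (hx : indexValue x = j) :
    pairOp ρ O χ x = ((Real.sqrt 2 : ℝ) : ℂ)⁻¹ * (O.family (sideOf (x (workQ (ctlW ρ)))) j).1
      (fun i => x (workQ (dataW ρ i))) (fun _ => false) * χ (zeroPair ρ x) := by
  set c : Qubit n m w := workQ (ctlW ρ) with hc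
  set s : ℂ := ((Real.sqrt 2 : ℝ) : ℂ)⁻¹ with hs
  set ψ₁ := target c (fun _ => hadamard) (fun _ _ => rfl) χ with hψ₁
  have h1 : ∀ z, ψ₁ z = s * χ (update z c false) := by
    intro z
    rw [hψ₁, target_apply, hadamard_apply_false,
      hχ (update z c true) c (workQ_mem_innerQubits ρ _) (update_self _ _ _), mul_zero, add_zero]
  set ψ₂ := prepOp O Side.left false (ctlW ρ) (dataW ρ) (ctlW_notMem ρ) ψ₁ with hψ₂
  have h2 : ∀ z, indexValue z = j → z c = true → ψ₂ z = s * (O.family Side.left j).1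
      (fun i => z (workQ (dataW ρ i))) (fun _ => false) * χ (zeroPair ρ z) := by
    intro z hz hzc
    rw [hψ₂, prepOp_apply_true O _ _ _ _ _ _ z j hz hzc]
    simp only [h1, Bool.false_eq_true, if_false]
    rw [mul_assoc, ← sum_extend_of_vanishes ρ χ hχ z, Finset.mul_sum]
    exact Finset.sum_congr rfl fun a _ => by ring
  have h2' : ∀ z, z c = false → ψ₂ z = s * χ (update z c false) := by
    intro z hz
    rw [hψ₂, prepOp_apply_false O _ _ _ _ _ _ z hz, h1]
  set ψ₃ := flipIf c (fun _ => true) (fun _ _ => rfl) ψ₂ with hψ₃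
  have h3 : ∀ z, ψ₃ z = ψ₂ (update z c (!(z c))) := by
    intro z
    rw [hψ₃, flipIf_apply, Bool.xor_true]
  change prepOp O Side.right false (ctlW ρ) (dataW ρ) (ctlW_notMem ρ) ψ₃ x = _
  cases hxc : x c
  · rw [prepOp_apply_false O _ _ _ _ _ _ x hxc, h3, hxc, Bool.not_false,
      h2 _ (by rw [indexValue_update_workQ, hx]) (update_self _ _ _), zeroPair_update]
    simp only [update_ctlW_workQ_dataW]
    rfl
  · rw [prepOp_apply_true O _ _ _ _ _ _ x j hx hxc]
    have h4 : ∀ a, ψ₃ (extend (workQubits (dataW ρ)) a x)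
        = s * χ (update (extend (workQubits (dataW ρ)) a x) c false) := by
      intro a
      rw [h3, hc, extend_dataW_ctlW, ← hc, hxc, Bool.not_true, h2' _ (update_self _ _ _),
        update_idem]
    simp only [h4, Bool.false_eq_true, if_false]
    rw [mul_assoc, sideOf, if_pos rfl, ← sum_extend_of_vanishes ρ χ hχ x, Finset.mul_sum]
    exact Finset.sum_congr rfl fun a _ => by ring

theorem unitaryGroup_inv_apply {ι : Type} [Fintype ι] [DecidableEq ι] (U : Matrix.unitaryGroup ι ℂ)
    (a b : ι) : (U⁻¹).1 a b = starRingEnd ℂ (U.1 b a) := rfl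

theorem pairOp_symm_apply (O : Access N d m) (ξ : State n m w) (x : Label n m w) (j : Fin N)
    (hx : indexValue x = j) (hxc : x (workQ (ctlW ρ)) = false)
    (hxd : ∀ i, x (workQ (dataW ρ i)) = false) :
    (pairOp ρ O).symm ξ x = ((Real.sqrt 2 : ℝ) : ℂ)⁻¹ *
      (∑ a, starRingEnd ℂ ((O.U j).1 a fun _ => false)
          * ξ (extend (workQubits (dataW ρ)) a x)
        + ∑ a, starRingEnd ℂ ((O.V j).1 a fun _ => false)
          * ξ (extend (workQubits (dataW ρ)) a (update x (workQ (ctlW ρ)) true))) := by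
  set c : Qubit n m w := workQ (ctlW ρ) with hc
  set s : ℂ := ((Real.sqrt 2 : ℝ) : ℂ)⁻¹ with hs
  set ξ₁ := prepOp O Side.right true (ctlW ρ) (dataW ρ) (ctlW_notMem ρ) ξ with hξ₁
  set ξ₂ := (flipIf c (fun _ => true) (fun _ _ => rfl)).symm ξ₁ with hξ₂
  have h2 : ∀ z, ξ₂ z = ξ₁ (update z c (!(z c))) := by
    intro z
    have h := flipIf_apply_update c (fun _ => true) (fun _ _ => rfl) ξ₂ z
    rw [Bool.xor_true, hξ₂, LinearIsometryEquiv.apply_symm_apply] at h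
    exact h.symm
  set ξ₃ := prepOp O Side.left true (ctlW ρ) (dataW ρ) (ctlW_notMem ρ) ξ₂ with hξ₃
  have h0 : (pairOp ρ O).symm ξ
      = (target c (fun _ => hadamard) fun _ _ => rfl).symm ξ₃ := by
    simp only [hξ₃, hξ₂, hξ₁, ← prepOp_symm]
    rfl
  have h4 : (target c (fun _ => hadamard) fun _ _ => rfl).symm ξ₃ x
      = s * (ξ₃ x + ξ₃ (update x c true)) := by
    have h : (target c (fun _ => hadamard) fun _ _ => rfl).symm ξ₃
        = target c (fun _ => hadamard) (fun _ _ => rfl) ξ₃ := by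
      rw [LinearIsometryEquiv.symm_apply_eq]
      ext z
      have hsq : s * s = 1 / 2 := by
        rw [hs, ← mul_inv, ← Complex.ofReal_mul, Real.mul_self_sqrt zero_le_two]
        norm_num
      simp only [target_apply, hadamard_apply_false, hadamard_apply_true, update_self, update_idem,
        ← hs, Bool.false_eq_true, if_false, if_true]
      conv_lhs => rw [← update_eq_self c z]
      cases z c
      · simp only [Bool.false_eq_true, if_false]
        linear_combination (-2 * ξ₃ (update z c false)) * hsq
      · simp only [if_true]
        linear_combination (-2 * ξ₃ (update z c true)) * hsq
    rw [h, target_apply, hadamard_apply_false, hadamard_apply_true, hxc, ← hxc, update_eq_self, hxc]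
    simp only [Bool.false_eq_true, if_false]
    ring
  rw [h0, h4]
  congr 1
  rw [add_comm]
  congr 1
  · rw [hξ₃, prepOp_apply_true O _ _ _ _ _ _ _ j (by rw [indexValue_update_workQ, hx])
      (update_self _ _ _)]
    refine Finset.sum_congr rfl fun a _ => ?_
    rw [if_pos rfl, unitaryGroup_inv_apply, h2, hc, extend_dataW_ctlW, update_self, Bool.not_true,
      update_extend, update_idem, ← hc]
    have h5 : update x c false = x := by rw [← hxc, update_eq_self]
    rw [h5]
    simp only [hc, update_ctlW_workQ_dataW, hxd]
    congr 1
    exact prepOp_apply_false O _ _ _ _ _ _ _ (by rw [extend_dataW_ctlW, ← hc, hxc])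
  · rw [hξ₃, prepOp_apply_false O _ _ _ _ _ _ x hxc, h2, hxc, Bool.not_false, hξ₁,
      prepOp_apply_true O _ _ _ _ _ _ _ j (by rw [indexValue_update_workQ, hx])
      (update_self _ _ _)]
    refine Finset.sum_congr rfl fun a _ => ?_
    rw [if_pos rfl, unitaryGroup_inv_apply]
    simp only [hc, update_ctlW_workQ_dataW, hxd]
    rfl

/-- The Pauli matrix of a reflection of the control qubit, applied if `c` holds of the label. -/
def swapOp (β : ℂ) (hβ : ‖β‖ = 1) (c : Label n m w → Bool)
    (hc : ∀ x b, c (update x (workQ (ctlW ρ)) b) = c x) : State n m w ≃ₗᵢ[ℂ] State n m w :=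
  target (workQ (ctlW ρ)) (fun x => if c x then flipGate β hβ else 1) fun x b => by rw [hc]

theorem swapOp_true_apply (β : ℂ) (hβ : ‖β‖ = 1) (ψ : State n m w) (x : Label n m w) :
    swapOp ρ β hβ (fun _ => true) (fun _ _ => rfl) ψ x
      = (if x (workQ (ctlW ρ)) then β else starRingEnd ℂ β)
        * ψ (update x (workQ (ctlW ρ)) (!(x (workQ (ctlW ρ))))) := by
  rw [swapOp, target_apply]
  cases x (workQ (ctlW ρ)) <;> simp [flipGate, unitaryTwo]

theorem swapOp_swapOp (β : ℂ) (hβ : ‖β‖ = 1) (ψ : State n m w) :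
    swapOp ρ β hβ (fun _ => true) (fun _ _ => rfl)
      (swapOp ρ β hβ (fun _ => true) (fun _ _ => rfl) ψ) = ψ := by
  have h : β * starRingEnd ℂ β = 1 := by
    rw [Complex.mul_conj, Complex.normSq_eq_norm_sq, hβ]
    simp
  ext x
  rw [swapOp_true_apply, swapOp_true_apply, update_self, update_idem, Bool.not_not, update_eq_self,
    ← mul_assoc]
  cases x (workQ (ctlW ρ))
  · simp only [Bool.not_false, if_true, Bool.false_eq_true, if_false]
    rw [mul_comm _ β, h, one_mul]
  · simp only [Bool.not_true, if_true, Bool.false_eq_true, if_false]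
    rw [h, one_mul]

/-- The quantity which is estimated: the real part of `β̄ ⟨u | v⟩`. -/
def overlap (O : Access N d m) (β : ℂ) (j : Fin N) : ℝ :=
  (starRingEnd ℂ β * ∑ a, starRingEnd ℂ ((O.U j).1 a fun _ => false) *
    (O.V j).1 a fun _ => false).re

theorem pairOp_symm_swapOp_pairOp (O : Access N d m) (β : ℂ) (hβ : ‖β‖ = 1) (χ : State n m w)
    (hχ : VanishesOff (innerQubits ρ) χ) (x : Label n m w) (j : Fin N) (hx : indexValue x = j)
    (hxc : x (workQ (ctlW ρ)) = false) (hxd : ∀ i, x (workQ (dataW ρ i)) = false) :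
    (pairOp ρ O).symm (swapOp ρ β hβ (fun _ => true) (fun _ _ => rfl) (pairOp ρ O χ)) x
      = overlap O β j * χ x := by
  set c : Qubit n m w := workQ (ctlW ρ) with hc
  set s : ℂ := ((Real.sqrt 2 : ℝ) : ℂ)⁻¹ with hs
  have hzero : zeroPair ρ x = x := by
    have h0 : update x c false = x := by rw [← hxc, update_eq_self]
    rw [zeroPair, update_extend, ← hc, h0]
    conv_rhs => rw [← extend_comp_self (workQubits (dataW ρ)) x]
    congr 1
    funext i
    exact (hxd i).symm
  have h1 : ∀ a, swapOp ρ β hβ (fun _ => true) (fun _ _ => rfl) (pairOp ρ O χ)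
      (extend (workQubits (dataW ρ)) a x)
      = starRingEnd ℂ β * (s * (O.V j).1 a (fun _ => false) * χ x) := by
    intro a
    rw [swapOp_true_apply, extend_dataW_ctlW, ← hc, hxc, Bool.not_false, hc, update_extend,
      pairOp_apply ρ O χ hχ _ j (by rw [indexValue_extend_workQubits, indexValue_update_workQ, hx]),
      zeroPair_extend, zeroPair_update, hzero, extend_dataW_ctlW, update_self]
    simp only [extend_dataW_dataW]
    rfl
  have h2 : ∀ a, swapOp ρ β hβ (fun _ => true) (fun _ _ => rfl) (pairOp ρ O χ)
      (extend (workQubits (dataW ρ)) a (update x c true))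
      = β * (s * (O.U j).1 a (fun _ => false) * χ x) := by
    intro a
    rw [swapOp_true_apply, hc, extend_dataW_ctlW, update_self, Bool.not_true, update_extend,
      update_idem, ← hc, ← hxc, update_eq_self,
      pairOp_apply ρ O χ hχ _ j (by rw [indexValue_extend_workQubits, hx]),
      zeroPair_extend, hzero, extend_dataW_ctlW, ← hc, hxc]
    simp only [extend_dataW_dataW]
    rfl
  rw [pairOp_symm_apply ρ O _ x j hx hxc hxd]
  simp only [h1, ← hc, h2]
  have h3 : ∀ z : ℂ, ((z.re : ℝ) : ℂ) = 1 / 2 * (z + starRingEnd ℂ z) := by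
    intro z
    rw [Complex.add_conj]
    push_cast
    ring
  have hsq : s * s = 1 / 2 := by
    rw [hs, ← mul_inv, ← Complex.ofReal_mul, Real.mul_self_sqrt zero_le_two]
    norm_num
  rw [overlap, h3, map_mul, map_sum, Complex.conj_conj, ← hsq]
  simp only [mul_add, add_mul, Finset.mul_sum, Finset.sum_mul, map_mul, Complex.conj_conj]
  congr 1
  · exact Finset.sum_congr rfl fun a _ => by ring
  · exact Finset.sum_congr rfl fun a _ => by ring

end estimation

section phaseEstimation

theorem sum_sum_extend {Q ι : Type} [Fintype Q] [DecidableEq Q] [Fintype ι] [DecidableEq ι]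
    (e : ι ↪ Q) (F : (ι → Bool) → (Q → Bool) → ℝ) :
    ∑ y, ∑ x, F y (extend e y x) = 2 ^ Fintype.card ι * ∑ x, F (fun i => x (e i)) x := by
  have h : ∑ y : ι → Bool, ∑ x, F y (extend e y x)
      = ∑ _y : ι → Bool, ∑ x, F (fun i => x (e i)) x := by
    rw [← Finset.sum_product', ← Finset.sum_product']
    refine Finset.sum_bij' (fun p _ => (fun i => p.2 (e i), extend e p.1 p.2))
      (fun p _ => (fun i => p.2 (e i), extend e p.1 p.2)) (by simp) (by simp) ?_ ?_ ?_
    · rintro ⟨y, x⟩ _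
      simp [extend_extend, extend_comp_self, extend_restrict]
    · rintro ⟨y, x⟩ _
      simp [extend_extend, extend_comp_self, extend_restrict]
    · rintro ⟨y, x⟩ _
      simp [extend_restrict]
  rw [h]
  simp

theorem SupportedOn.apply_congr {Q : Type} [Fintype Q] [DecidableEq Q] {I S : Set Q}
    {F : QState Q ≃ₗᵢ[ℂ] QState Q} (hF : SupportedOn I S F) (p : (Q → Bool) → Prop)
    (hp : ∀ x y, AgreeOff S x y → (p x ↔ p y)) {ψ ψ' : QState Q} (h : ∀ x, p x → ψ x = ψ' x)
    (x : Q → Bool) (hx : p x) : F ψ x = F ψ' x := by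
  classical
  let g : (Q → Bool) → ℂ := fun x => if p x then 1 else 0
  have hg : ∀ x y, AgreeOff S x y → g x = g y := fun x y hxy => by simp only [g, hp x y hxy]
  have h1 : mulFn g ψ = mulFn g ψ' := by
    ext z
    by_cases hz : p z
    · simp [h z hz]
    · simp [g, hz]
  have h2 := hF.mulFn_comm g hg ψ
  rw [h1, hF.mulFn_comm g hg ψ'] at h2
  have h3 := congrArg (fun φ : QState Q => φ x) h2
  simpa [g, hx] using h3.symm

theorem SupportedOn.apply_eq_zero {Q : Type} [Fintype Q] [DecidableEq Q] {I S : Set Q}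
    {F : QState Q ≃ₗᵢ[ℂ] QState Q} (hF : SupportedOn I S F) (p : (Q → Bool) → Prop)
    (hp : ∀ x y, AgreeOff S x y → (p x ↔ p y)) {ψ : QState Q} (h : ∀ x, p x → ψ x = 0)
    (x : Q → Bool) (hx : p x) : F ψ x = 0 := by
  rw [hF.apply_congr p hp (ψ' := 0) h x hx, map_zero]
  rfl

/-- The iterates of an operator. -/
def iterOp {Q : Type} [Fintype Q] [DecidableEq Q] (F : QState Q ≃ₗᵢ[ℂ] QState Q) :
    ℕ → (QState Q ≃ₗᵢ[ℂ] QState Q)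
  | 0 => LinearIsometryEquiv.refl ℂ _
  | k + 1 => (iterOp F k).trans F

theorem iterOp_apply {Q : Type} [Fintype Q] [DecidableEq Q] (F : QState Q ≃ₗᵢ[ℂ] QState Q) (k : ℕ)
    (ψ : QState Q) : iterOp F k ψ = F.toLinearEquiv.toLinearMap^[k] ψ := by
  induction k with
  | zero => rfl
  | succ k ih =>
    rw [iterOp, LinearIsometryEquiv.trans_apply, ih, iterate_succ_apply']
    rfl

theorem SupportedOn.iterOp {Q : Type} [Fintype Q] [DecidableEq Q] {I S : Set Q}
    {F : QState Q ≃ₗᵢ[ℂ] QState Q} (hF : SupportedOn I S F) (k : ℕ) :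
    SupportedOn I S (iterOp F k) := by
  induction k with
  | zero => exact SupportedOn.refl _ _
  | succ k ih => exact ih.trans hF

variable {N n d m w K : ℕ}

theorem Impl.iterOp {a b : ℝ} {F : Access N d m → (State n m w ≃ₗᵢ[ℂ] State n m w)}
    (hF : Impl a b F) (k : ℕ) : Impl (k * a) (k * b) (fun O => iterOp (F O) k) := by
  induction k with
  | zero => exact Impl.refl.mono (by simp) (by simp)
  | succ k ih => exact (ih.trans hF).mono (by push_cast; linarith) (by push_cast; linarith)

variable (ρ : RegType K d ↪ Fin w)

section rotation

variable (β : ℂ) (hβ : ‖β‖ = 1) (c : Label n m w → Bool)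
  (hc : ∀ x y, AgreeOff (innerQubits ρ) x y → c x = c y)

theorem agreeOff_update {Q : Type} [DecidableEq Q] {S : Set Q} {q : Q} (hq : q ∈ S) (x : Q → Bool)
    (b : Bool) : AgreeOff S (update x q b) x := by
  intro r hr
  rw [update_of_ne]
  rintro rfl
  exact hr hq

include hc in
theorem ctl_update_control (x : Label n m w) (b : Bool) : c (update x (workQ (ctlW ρ)) b) = c x :=
  hc _ _ (agreeOff_update (workQ_mem_innerQubits ρ _) x b)

include hc in
theorem ctl_update_flag (x : Label n m w) (b : Bool) :
    c (update x ((regLadder ρ).flag (Fin.last _)) b) = c x :=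
  hc _ _ (agreeOff_update (workQ_mem_innerQubits ρ _) x b)

/-- The product of the two reflections, controlled by `c`. -/
def rotOp (O : Access N d m) : State n m w ≃ₗᵢ[ℂ] State n m w :=
  ((swapOp ρ β hβ c (ctl_update_control ρ c hc)).trans (pairOp ρ O).symm).trans
    (((regLadder ρ).reflect c (ctl_update_flag ρ c hc)).trans (pairOp ρ O))

theorem impl_rotOp (q : Qubit n m w) (hq : ∀ x y, x q = y q → c x = c y) :
    Impl (N := N) (2 * d + 10) 4 (rotOp ρ β hβ c hc) := by
  refine (((impl_target (workQ (ctlW ρ)) {q} (by simp)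
    (fun x => if c x then flipGate β hβ else 1)
    (fun x b => by rw [ctl_update_control ρ c hc]) ?_).trans
    (impl_pairOp ρ).symm).trans (((regLadder ρ).impl_reflect c (ctl_update_flag ρ c hc) q hq).trans
    (impl_pairOp ρ))).mono ?_ ?_
  · intro x y h
    rw [hq x y (h q (by simp))]
  · push_cast
    linarith
  · norm_num

theorem supportedOn_rotOp_of_subset (O : Access N d m) (S : Set (Qubit n m w))
    (hS : innerQubits ρ ⊆ S) (hcS : ∀ x y, (∀ q ∈ S ∪ indexQubits n m w, x q = y q) → c x = c y) :
    SupportedOn (indexQubits n m w) S (rotOp ρ β hβ c hc O) := by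
  refine ((supportedOn_target _ _ _ _ _ (hS (workQ_mem_innerQubits ρ _))
    fun x y h => by rw [hcS x y h]).trans
    ((supportedOn_pairOp ρ O).mono hS).symm).trans
    (((regLadder ρ).supportedOn_reflect _ _ (fun i => hS (workQ_mem_innerQubits ρ _))
      (fun i => hS (workQ_mem_innerQubits ρ _)) c (ctl_update_flag ρ c hc) hcS).trans
      ((supportedOn_pairOp ρ O).mono hS))

theorem rotOp_apply_of_false (O : Access N d m) (ψ : State n m w) (x : Label n m w)
    (hx : c x = false) : rotOp ρ β hβ c hc O ψ x = ψ x := by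
  have hp : ∀ x y, AgreeOff (innerQubits ρ) x y → (c x = false ↔ c y = false) := fun x y h => by
    rw [hc x y h]
  have hA := supportedOn_pairOp (n := n) ρ O
  have h1 : ∀ z, c z = false → swapOp ρ β hβ c (ctl_update_control ρ c hc) ψ z = ψ z := by
    intro z hz
    rw [swapOp, target_apply]
    conv_rhs => rw [← update_eq_self (workQ (ctlW ρ)) z]
    cases z (workQ (ctlW ρ)) <;> simp [hz]
  have h2 := hA.symm.apply_congr _ hp h1
  have h3 : ∀ z, c z = false → (regLadder ρ).reflect c (ctl_update_flag ρ c hc)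
      ((pairOp ρ O).symm (swapOp ρ β hβ c (ctl_update_control ρ c hc) ψ)) z
      = (pairOp ρ O).symm ψ z := by
    intro z hz
    have : c ((regLadder ρ).label (d + 1) z) = false := by
      rw [← hz]
      refine hc _ _ fun q hq => (regLadder ρ).label_of_notMem _ _ _ fun s hs => ?_
      exact hq (hs ▸ workQ_mem_innerQubits ρ _)
    rw [Ladder.reflect_apply, if_neg (by simp [this]), one_mul, h2 z hz]
  have h4 := hA.apply_congr _ hp h3 x hx
  rw [LinearIsometryEquiv.apply_symm_apply] at h4
  exact h4

/-- The product of the two reflections. -/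
abbrev rotFull (O : Access N d m) : State n m w ≃ₗᵢ[ℂ] State n m w :=
  rotOp ρ β hβ (fun _ => true) (fun _ _ _ => rfl) O

theorem supportedOn_rotFull (O : Access N d m) :
    SupportedOn (indexQubits n m w) (innerQubits ρ) (rotFull ρ β hβ O) :=
  supportedOn_rotOp_of_subset ρ β hβ _ _ O _ subset_rfl fun _ _ _ => rfl

theorem rotOp_apply_of_true (O : Access N d m) (ψ : State n m w) (x : Label n m w)
    (hx : c x = true) : rotOp ρ β hβ c hc O ψ x = rotFull ρ β hβ O ψ x := by
  have hp : ∀ x y, AgreeOff (innerQubits ρ) x y → (c x = true ↔ c y = true) := fun x y h => by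
    rw [hc x y h]
  have hA := supportedOn_pairOp (n := n) ρ O
  have h1 : ∀ z, c z = true → swapOp ρ β hβ c (ctl_update_control ρ c hc) ψ z
      = swapOp ρ β hβ (fun _ => true) (fun _ _ => rfl) ψ z := by
    intro z hz
    rw [swapOp, swapOp, target_apply, target_apply, hz]
  have h2 := hA.symm.apply_congr _ hp h1
  have h3 : ∀ z, c z = true → (regLadder ρ).reflect c (ctl_update_flag ρ c hc)
      ((pairOp ρ O).symm (swapOp ρ β hβ c (ctl_update_control ρ c hc) ψ)) z
      = (regLadder ρ).reflect (fun _ => true) (fun _ _ => rfl)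
      ((pairOp ρ O).symm (swapOp ρ β hβ (fun _ => true) (fun _ _ => rfl) ψ)) z := by
    intro z hz
    have : c ((regLadder ρ).label (d + 1) z) = true := by
      rw [← hz]
      refine hc _ _ fun q hq => (regLadder ρ).label_of_notMem _ _ _ fun s hs => ?_
      exact hq (hs ▸ workQ_mem_innerQubits ρ _)
    rw [Ladder.reflect_apply, Ladder.reflect_apply, this, h2 z hz]
  have h4 := hA.apply_congr _ hp h3 x hx
  exact h4

theorem iterOp_rotOp_apply (O : Access N d m) (k : ℕ) (ψ : State n m w) (x : Label n m w) :
    iterOp (rotOp ρ β hβ c hc O) k ψ x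
      = if c x then iterOp (rotFull ρ β hβ O) k ψ x else ψ x := by
  induction k generalizing x with
  | zero => cases c x <;> rfl
  | succ k ih =>
    rw [iterOp, iterOp, LinearIsometryEquiv.trans_apply, LinearIsometryEquiv.trans_apply]
    generalize iterOp (rotOp ρ β hβ c hc O) k ψ = φ at ih
    generalize iterOp (rotFull ρ β hβ O) k ψ = φ' at ih
    cases hx : c x
    · rw [rotOp_apply_of_false ρ β hβ c hc O φ x hx, ih, hx]
      rfl
    · rw [rotOp_apply_of_true ρ β hβ c hc O φ x hx]
      exact (supportedOn_rotFull ρ β hβ O).apply_congr (fun z => c z = true)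
        (fun x y h => by rw [hc x y h]) (fun z hz => by rw [ih z, if_pos hz]) x hx

end rotation

theorem inner_mulFn {Q : Type} [Fintype Q] [DecidableEq Q] (g : (Q → Bool) → ℂ) (φ ψ : QState Q) :
    inner ℂ (mulFn g φ) ψ = inner ℂ φ (mulFn (fun x => starRingEnd ℂ (g x)) ψ) := by
  simp only [PiLp.inner_apply, mulFn_apply, RCLike.inner_apply, map_mul]
  exact Finset.sum_congr rfl fun x _ => by ring

theorem regLadder_label_last (x : Label n m w)
    (hx : ∀ i, x (workQ (ρ (Sum.inr (Sum.inr i)))) = false) :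
    (regLadder ρ).label (d + 1) x ((regLadder ρ).flag (Fin.last _))
      = decide (∀ i, x (workQ (ρ (Sum.inr (Sum.inl i)))) = false) := by
  rw [Ladder.label_flag _ _ _ hx, Bool.eq_iff_iff, decide_eq_true_iff, decide_eq_true_iff]
  exact ⟨fun h i => h.2 i i.2, fun h => ⟨le_rfl, fun i _ => h i⟩⟩

theorem exists_rotatesBy_rotFull (O : Access N d m) (β : ℂ) (hβ : ‖β‖ = 1) (χ : State n m w)
    (hχ : VanishesOff (innerQubits ρ) χ) (j : Fin N) (hj : ∀ x, indexValue x ≠ j → χ x = 0)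
    (hne : χ ≠ 0) : ∃ θ, Real.cos θ = overlap O β j ∧
      RotatesBy (rotFull ρ β hβ O).toLinearEquiv.toLinearMap (pairOp ρ O χ) θ := by
  let z : Label n m w → Prop := fun x =>
    (regLadder ρ).label (d + 1) x ((regLadder ρ).flag (Fin.last _)) = true
  classical
  let g : Label n m w → ℂ := fun x => if z x then 1 else 0
  have hg : ∀ x, χ x ≠ 0 → g x = 1 := by
    intro x hx
    have h1 : ∀ r, x (workQ (ρ (Sum.inr r))) = false := fun r => by
      by_contra h
      exact hx (hχ x _ (workQ_mem_innerQubits ρ r) (by simpa using h))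
    refine if_pos ?_
    change _ = true
    rw [regLadder_label_last ρ x fun i => h1 _]
    simpa using fun i => h1 (Sum.inl i)
  have hgχ : mulFn g χ = χ := by
    ext x
    by_cases hx : χ x = 0
    · simp [hx]
    · simp [hg x hx]
  have hself : ∀ x, starRingEnd ℂ (g x) = g x := by
    intro x
    simp only [g]
    split_ifs <;> simp
  refine exists_rotatesBy (pairOp ρ O) (swapOp ρ β hβ (fun _ => true) (fun _ _ => rfl))
    ((regLadder ρ).reflect (fun _ => true) (fun _ _ => rfl)) (mulFn g) χ (overlap O β j)
    (swapOp_swapOp ρ β hβ) (fun ψ => ?_) hgχ (fun ψ => ?_) ?_ hne _ fun _ => rfl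
  · ext x
    rw [Ladder.reflect_apply]
    simp only [PiLp.sub_apply, PiLp.smul_apply, mulFn_apply, smul_eq_mul, g, z]
    cases (regLadder ρ).label (d + 1) x ((regLadder ρ).flag (Fin.last _))
    · simp
    · simp only [Bool.true_eq_false, and_false, if_false, if_true]
      ring
  · conv_lhs => rw [← hgχ, inner_mulFn]
    simp only [hself]
  · ext x
    rw [mulFn_apply, PiLp.smul_apply, smul_eq_mul]
    have hA := supportedOn_pairOp (n := n) ρ O
    have hB : SupportedOn (indexQubits n m w) (innerQubits ρ)
        (swapOp ρ β hβ (fun _ => true) (fun _ _ => rfl)) :=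
      supportedOn_target _ _ _ _ (fun _ _ => rfl) (workQ_mem_innerQubits ρ _) fun _ _ _ => rfl
    by_cases h1 : ∃ i, x (workQ (ρ (Sum.inr (Sum.inr i)))) = true
    · obtain ⟨i, hi⟩ := h1
      rw [hχ x _ (workQ_mem_innerQubits ρ _) hi]
      let S : Set (Qubit n m w) := Set.range fun r => workQ (ρ (Sum.inr (Sum.inl r)))
      have hS : ∀ r, (workQ (ρ (Sum.inr (Sum.inl r))) : Qubit n m w) ∈ S := fun r => ⟨r, rfl⟩
      have hP : ∀ side, SupportedOn (indexQubits n m w) S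
          (prepOp O side false (ctlW ρ) (dataW ρ) (ctlW_notMem ρ)) := fun side =>
        supportedOn_ctrl _ _ _ _ _ (fun _ => hS _) fun x y h =>
          prepUnitary_congr _ _ _ _ (fun i => h _ (Or.inr ⟨i, rfl⟩)) (h _ (Or.inl (hS _)))
      have hA' : SupportedOn (indexQubits n m w) S (pairOp ρ O) :=
        ((supportedOn_target _ _ _ _ (fun _ _ => rfl) (hS _) fun _ _ _ => rfl).trans (hP _)).trans
          ((supportedOn_target _ _ _ _ (fun _ _ => rfl) (hS _) fun _ _ _ => rfl).trans (hP _))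
      have hB' : SupportedOn (indexQubits n m w) S
          (swapOp ρ β hβ (fun _ => true) (fun _ _ => rfl)) :=
        supportedOn_target _ _ _ _ (fun _ _ => rfl) (hS _) fun _ _ _ => rfl
      have h2 := ((hA'.trans hB').trans hA'.symm).apply_eq_zero
        (fun x => x (workQ (ρ (Sum.inr (Sum.inr i)))) = true) (fun x y hxy => by
          rw [hxy]
          rintro ⟨r, hr⟩
          simp at hr) (fun x hx => hχ x _ (workQ_mem_innerQubits ρ _) hx) x hi
      simp only [LinearIsometryEquiv.trans_apply] at h2
      rw [h2, mul_zero, mul_zero]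
    · have h1' : ∀ i, x (workQ (ρ (Sum.inr (Sum.inr i)))) = false := fun i => by
        simpa using fun h => h1 ⟨i, h⟩
      by_cases h2 : ∃ i, x (workQ (ρ (Sum.inr (Sum.inl i)))) = true
      · obtain ⟨i, hi⟩ := h2
        have h3 : g x = 0 := by
          refine if_neg ?_
          change ¬ _ = true
          rw [regLadder_label_last ρ x h1', decide_eq_true_iff]
          intro h
          rw [h i] at hi
          exact Bool.false_ne_true hi
        rw [hχ x _ (workQ_mem_innerQubits ρ _) hi, h3, zero_mul, mul_zero]
      · have h2' : ∀ i, x (workQ (ρ (Sum.inr (Sum.inl i)))) = false := fun i => by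
          simpa using fun h => h2 ⟨i, h⟩
        have h3 : g x = 1 := by
          refine if_pos ?_
          change _ = true
          rw [regLadder_label_last ρ x h1']
          simpa using h2'
        rw [h3, one_mul]
        by_cases hx : indexValue x = j
        · exact pairOp_symm_swapOp_pairOp ρ O β hβ χ hχ x j hx (h2' 0) fun i => h2' i.succ
        · rw [hj x hx, mul_zero]
          refine ((hA.trans hB).trans hA.symm).apply_eq_zero (fun x => indexValue x ≠ j)
            (fun x y hxy => ?_) hj x hx
          rw [indexValue_congr fun i => hxy (Sum.inl i) ?_]
          rintro ⟨r, hr⟩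
          simp [workQ] at hr

end phaseEstimation

section estimationCircuit

variable {N n d m w K : ℕ} (ρ : RegType K d ↪ Fin w)

/-- The qubit which holds a bit of the result. -/
def resQ (i : Fin K) : Qubit n m w := workQ (ρ (Sum.inl i))

theorem resQ_ne {i l : Fin K} (h : i ≠ l) : (resQ ρ i : Qubit n m w) ≠ resQ ρ l := by
  simpa [resQ] using h

/-- The label `x` with the result `y`. -/
def writeResult (y : Fin K → Bool) (x : Label n m w) : Label n m w :=
  extend (workQubits (resultW ρ)) y x

/-- The result which a label contains. -/
def readResult (x : Label n m w) : Fin K → Bool := fun i => x (resQ ρ i)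

theorem writeResult_resQ (y : Fin K → Bool) (x : Label n m w) (i : Fin K) :
    writeResult ρ y x (resQ ρ i) = y i :=
  (workQubits (n := n) (m := m) (resultW ρ)).injective.extend_apply y x i

theorem writeResult_of_ne (y : Fin K → Bool) (x : Label n m w) (q : Qubit n m w)
    (hq : ∀ i, q ≠ resQ ρ i) : writeResult ρ y x q = x q := by
  rw [writeResult, extend_apply']
  rintro ⟨i, rfl⟩
  exact hq i rfl

theorem update_writeResult (y : Fin K → Bool) (x : Label n m w) (i : Fin K) (b : Bool) :
    update (writeResult ρ y x) (resQ ρ i) b = writeResult ρ (update y i b) x := by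
  funext q
  by_cases hq : ∃ l, q = resQ ρ l
  · obtain ⟨l, rfl⟩ := hq
    rw [writeResult_resQ]
    by_cases hl : l = i
    · subst hl
      rw [update_self, update_self]
    · rw [update_of_ne (resQ_ne ρ hl), update_of_ne hl, writeResult_resQ]
  · have hq' : ∀ l, q ≠ resQ ρ l := fun l h => hq ⟨l, h⟩
    rw [update_of_ne (hq' i), writeResult_of_ne _ _ _ _ hq', writeResult_of_ne _ _ _ _ hq']

theorem pull_writeResult_comm {F : State n m w ≃ₗᵢ[ℂ] State n m w}
    (hF : SupportedOn (indexQubits n m w) (innerQubits ρ) F) (y : Fin K → Bool) (ψ : State n m w) :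
    F (pull (writeResult ρ y) ψ) = pull (writeResult ρ y) (F ψ) := by
  refine hF.pull_comm _ (fun x q hq => ?_) (fun x x' h q hq => ?_) ψ
  · refine writeResult_of_ne _ _ _ _ fun i hi => ?_
    subst hi
    exact result_notMem ρ i hq
  · by_cases hq' : ∃ l, q = resQ ρ l
    · obtain ⟨l, rfl⟩ := hq'
      rw [writeResult_resQ, writeResult_resQ]
    · have hq'' : ∀ l, q ≠ resQ ρ l := fun l h => hq' ⟨l, h⟩
      rw [writeResult_of_ne _ _ _ _ hq'', writeResult_of_ne _ _ _ _ hq'', h q hq]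

/-- The Hadamard gate on a bit of the result. -/
def hadOp (i : Fin K) : State n m w ≃ₗᵢ[ℂ] State n m w :=
  target (resQ ρ i) (fun _ => hadamard) fun _ _ => rfl

theorem pull_hadOp (i : Fin K) (y : Fin K → Bool) (ψ : State n m w) :
    pull (writeResult ρ y) (hadOp ρ i ψ) = ((Real.sqrt 2 : ℝ) : ℂ)⁻¹ •
      (pull (writeResult ρ (update y i false)) ψ
        + (if y i then (-1 : ℂ) else 1) • pull (writeResult ρ (update y i true)) ψ) := by
  ext x
  simp only [pull_apply, PiLp.smul_apply, PiLp.add_apply, smul_eq_mul]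
  rw [hadOp, target_apply, hadamard_apply_false, hadamard_apply_true, update_writeResult,
    update_writeResult, writeResult_resQ]
  ring

variable (β : ℂ) (hβ : ‖β‖ = 1)

theorem ctl_resQ (i : Fin K) : ∀ x y : Label n m w, AgreeOff (innerQubits ρ) x y →
    x (resQ ρ i) = y (resQ ρ i) :=
  fun _ _ h => h _ fun h' => result_notMem ρ i (Or.inl h')

/-- The iterated rotation, controlled by a bit of the result. -/
def ctlRot (O : Access N d m) (i : Fin K) (k : ℕ) : State n m w ≃ₗᵢ[ℂ] State n m w :=
  iterOp (rotOp ρ β hβ (fun x => x (resQ ρ i)) (ctl_resQ ρ i) O) k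

theorem pull_ctlRot (O : Access N d m) (i : Fin K) (k : ℕ) (y : Fin K → Bool) (ψ : State n m w) :
    pull (writeResult ρ y) (ctlRot ρ β hβ O i k ψ) =
      if y i then iterOp (rotFull ρ β hβ O) k (pull (writeResult ρ y) ψ)
        else pull (writeResult ρ y) ψ := by
  have h := pull_writeResult_comm ρ ((supportedOn_rotFull ρ β hβ O).iterOp k) y ψ
  rw [h]
  ext x
  rw [pull_apply, ctlRot, iterOp_rotOp_apply, writeResult_resQ]
  cases y i <;> rfl

/-- The phase rotations of the bit `i`, controlled by the bits below `l`. -/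
def phaseOps (i : Fin K) : ℕ → (State n m w ≃ₗᵢ[ℂ] State n m w)
  | 0 => LinearIsometryEquiv.refl ℂ _
  | l + 1 => (phaseOps i l).trans (if h : l < i then
      target (resQ ρ i) (fun x => if x (resQ ρ ⟨l, h.trans i.2⟩) then
        phaseGate (Complex.exp ((-(Real.pi / 2 ^ (i - l : ℕ)) : ℝ) * Complex.I))
          (Complex.norm_exp_ofReal_mul_I _) else 1)
        (fun x b => by rw [update_of_ne (resQ_ne ρ (Fin.ne_of_lt h))])
    else LinearIsometryEquiv.refl ℂ _)

theorem estimatedPhase_eq_sum (y : Fin K → Bool) (i : ℕ) : estimatedPhase y i / 2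
    = ∑ l ∈ Finset.range i, if bitAt y l then Real.pi / 2 ^ (i - l) else 0 := by
  induction i with
  | zero => simp [estimatedPhase]
  | succ i ih =>
    rw [estimatedPhase, ih, Finset.sum_range_succ, add_div, Finset.sum_div]
    congr 1
    · refine Finset.sum_congr rfl fun l hl => ?_
      rw [Finset.mem_range] at hl
      rw [Nat.succ_sub hl.le, pow_succ]
      split_ifs
      · rw [div_div]
      · simp
    · simp [ite_div]

theorem phaseOps_apply (i : Fin K) (l : ℕ) (hl : l ≤ i) (ψ : State n m w) (x : Label n m w) :
    phaseOps ρ i l ψ x = (if x (resQ ρ i) then Complex.exp ((-∑ r ∈ Finset.range l,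
      (if bitAt (readResult ρ x) r then Real.pi / 2 ^ (i - r : ℕ) else 0) : ℝ) * Complex.I) else 1)
      * ψ x := by
  induction l generalizing x with
  | zero => simp [phaseOps]
  | succ l ih =>
    have h : l < i := hl
    have hbit : bitAt (readResult ρ x) l = x (resQ ρ ⟨l, h.trans i.2⟩) :=
      bitAt_val (readResult ρ x) ⟨l, h.trans i.2⟩
    simp only [phaseOps, h, dif_pos, LinearIsometryEquiv.trans_apply]
    have h1 : target (resQ ρ i) (fun x => if x (resQ ρ ⟨l, h.trans i.2⟩) then
        phaseGate (Complex.exp ((-(Real.pi / 2 ^ (i - l : ℕ)) : ℝ) * Complex.I))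
          (Complex.norm_exp_ofReal_mul_I _) else 1)
        (fun x b => by rw [update_of_ne (resQ_ne ρ (Fin.ne_of_lt h))]) (phaseOps ρ i l ψ) x
        = (if x (resQ ρ i) then Complex.exp ((-(if bitAt (readResult ρ x) l then
          Real.pi / 2 ^ (i - l : ℕ) else 0) : ℝ) * Complex.I) else 1) * phaseOps ρ i l ψ x := by
      rw [target_apply, hbit]
      have hx := update_eq_self (resQ ρ i) x
      cases hb : x (resQ ρ i) <;> rw [hb] at hx <;> cases x (resQ ρ ⟨l, h.trans i.2⟩) <;>
        simp [phaseGate, unitaryTwo, hx]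
    rw [h1, ih h.le, ← mul_assoc]
    congr 1
    cases x (resQ ρ i)
    · simp
    · simp only [if_true]
      rw [← Complex.exp_add, ← add_mul, Finset.sum_range_succ, ← Complex.ofReal_add]
      congr 3
      ring

theorem readResult_writeResult (y : Fin K → Bool) (x : Label n m w) :
    readResult ρ (writeResult ρ y x) = y := funext fun i => writeResult_resQ ρ y x i

theorem pull_phaseOps (i : Fin K) (y : Fin K → Bool) (ψ : State n m w) :
    pull (writeResult ρ y) (phaseOps ρ i i ψ) = (if y i then
      Complex.exp (-(estimatedPhase y i / 2 : ℝ) * Complex.I) else 1)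
        • pull (writeResult ρ y) ψ := by
  ext x
  rw [pull_apply, phaseOps_apply ρ i i le_rfl, readResult_writeResult, writeResult_resQ,
    ← estimatedPhase_eq_sum, Complex.ofReal_neg]
  rfl

/-- One step of the estimation, which determines one bit of the result. -/
def estStep (O : Access N d m) (i : Fin K) : State n m w ≃ₗᵢ[ℂ] State n m w :=
  ((hadOp ρ i).trans (ctlRot ρ β hβ O i (2 ^ (K - (i + 1))))).trans
    ((phaseOps ρ i i).trans (hadOp ρ i))

/-- The estimation, up to bit `i`. -/
def estOps (O : Access N d m) : ℕ → (State n m w ≃ₗᵢ[ℂ] State n m w)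
  | 0 => pairOp ρ O
  | i + 1 => (estOps O i).trans (if h : i < K then estStep ρ β hβ O ⟨i, h⟩
      else LinearIsometryEquiv.refl ℂ _)

theorem impl_phaseOps (i : Fin K) (l : ℕ) :
    Impl (N := N) (d := d) l 0 (fun _ => phaseOps (n := n) (m := m) ρ i l) := by
  induction l with
  | zero => exact Impl.refl.mono (by simp) le_rfl
  | succ l ih =>
    by_cases h : l < i
    · refine ((ih.trans (impl_target (resQ ρ i) {resQ ρ ⟨l, h.trans i.2⟩} (by simp)
        (fun x => if x (resQ ρ ⟨l, h.trans i.2⟩) then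
        phaseGate (Complex.exp ((-(Real.pi / 2 ^ (i - l : ℕ)) : ℝ) * Complex.I))
          (Complex.norm_exp_ofReal_mul_I _) else 1)
        (fun x b => by rw [update_of_ne (resQ_ne ρ (Fin.ne_of_lt h))]) ?_)).mono
        (by push_cast; rfl) (by simp)).congr fun O ψ => ?_
      · intro x y hxy
        rw [hxy _ (by simp)]
      · simp only [phaseOps, h, dif_pos]
    · refine (ih.mono (by push_cast; linarith) le_rfl).congr fun O ψ => ?_
      simp only [phaseOps, h, dif_neg, not_false_eq_true]
      rfl

theorem impl_hadOp (i : Fin K) :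
    Impl (N := N) (d := d) 1 0 (fun _ => hadOp (n := n) (m := m) ρ i) :=
  impl_target _ ∅ (by simp) _ (fun _ _ => rfl) fun _ _ _ => rfl

theorem impl_estOps (i : ℕ) (hi : i ≤ K) :
    Impl (N := N) (n := n) (m := m) (2 + (2 + K) * i + (2 * d + 10) * (2 ^ K - 2 ^ (K - i)))
      (2 + 4 * (2 ^ K - 2 ^ (K - i))) (fun O => estOps ρ β hβ O i) := by
  induction i with
  | zero => exact (impl_pairOp ρ).mono (by simp) (by simp)
  | succ i ih =>
    have h : i < K := hi
    have hrot : Impl (N := N) (n := n) (m := m) (2 * d + 10) 4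
        (rotOp ρ β hβ (fun x => x (resQ ρ ⟨i, h⟩)) (ctl_resQ ρ ⟨i, h⟩)) :=
      impl_rotOp ρ β hβ _ _ (resQ ρ ⟨i, h⟩) fun _ _ h => h
    have hstep := (ih h.le).trans (((impl_hadOp ρ ⟨i, h⟩).trans
      (hrot.iterOp (2 ^ (K - (i + 1))))).trans ((impl_phaseOps ρ ⟨i, h⟩ i).trans
      (impl_hadOp ρ ⟨i, h⟩)))
    have hpow : (2 : ℝ) ^ (K - i) = 2 * 2 ^ (K - (i + 1)) := by exact_mod_cast two_pow_sub_eq h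
    have hK : (i : ℝ) ≤ K := by exact_mod_cast h.le
    refine (hstep.mono ?_ ?_).congr fun O ψ => ?_
    · rw [hpow]
      push_cast
      linarith
    · rw [hpow]
      push_cast
      linarith
    · simp only [estOps, h, dif_pos]
      rfl

theorem supportedOn_estOps (O : Access N d m) (i : ℕ) :
    SupportedOn (indexQubits n m w) (regQubits ρ) (estOps ρ β hβ O i) := by
  have hmem : ∀ i, (resQ ρ i : Qubit n m w) ∈ regQubits ρ := fun i => ⟨Sum.inl i, rfl⟩
  have hhad : ∀ i, SupportedOn (indexQubits n m w) (regQubits ρ) (hadOp ρ i) := fun i =>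
    supportedOn_target _ _ _ _ (fun _ _ => rfl) (hmem i) fun _ _ _ => rfl
  have hphase : ∀ i l, SupportedOn (indexQubits n m w) (regQubits ρ) (phaseOps ρ i l) := by
    intro i l
    induction l with
    | zero => exact SupportedOn.refl _ _
    | succ l ih =>
      refine ih.trans ?_
      split_ifs with h
      · refine supportedOn_target _ _ _ _
          (fun x b => by rw [update_of_ne (resQ_ne ρ (Fin.ne_of_lt h))]) (hmem i) fun x y hxy => ?_
        rw [hxy _ (Or.inl (hmem _))]
      · exact SupportedOn.refl _ _
  induction i with
  | zero => exact (supportedOn_pairOp ρ O).mono (innerQubits_subset ρ)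
  | succ i ih =>
    refine ih.trans ?_
    split_ifs with h
    · refine ((hhad _).trans (SupportedOn.iterOp ?_ _)).trans ((hphase _ _).trans (hhad _))
      exact supportedOn_rotOp_of_subset ρ β hβ _ _ O _ (innerQubits_subset ρ)
        fun x y hxy => hxy _ (Or.inl (hmem _))
    · exact SupportedOn.refl _ _

theorem pull_estStep (O : Access N d m) (i : Fin K) (y : Fin K → Bool) (ψ : State n m w)
    (h : pull (writeResult ρ (update y i true)) ψ = 0) :
    pull (writeResult ρ y) (estStep ρ β hβ O i ψ) = (2 : ℂ)⁻¹ •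
      (pull (writeResult ρ (update y i false)) ψ + (if bitAt y i then (-1 : ℂ) else 1) •
        Complex.exp (-(estimatedPhase y i / 2 : ℝ) * Complex.I) •
        iterOp (rotFull ρ β hβ O) (2 ^ (K - (i + 1)))
          (pull (writeResult ρ (update y i false)) ψ)) := by
  have hphase : estimatedPhase (update y i true) i = estimatedPhase y i :=
    estimatedPhase_congr _ fun l hl => bitAt_update_of_ne y i _ hl.ne
  have hsq : ((Real.sqrt 2 : ℝ) : ℂ)⁻¹ * ((Real.sqrt 2 : ℝ) : ℂ)⁻¹ = 2⁻¹ := by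
    rw [← mul_inv, ← Complex.ofReal_mul, Real.mul_self_sqrt zero_le_two]
    norm_num
  simp only [estStep, LinearIsometryEquiv.trans_apply]
  rw [pull_hadOp, pull_phaseOps, pull_phaseOps, pull_ctlRot, pull_ctlRot, pull_hadOp, pull_hadOp]
  simp only [update_self, update_idem, h, smul_zero, add_zero, Bool.false_eq_true, if_false, if_true,
    hphase, bitAt_val, map_smul, one_smul]
  rw [← hsq]
  module

theorem estOps_pull (O : Access N d m) (φ : State n m w) (hφ : VanishesOff (regQubits ρ) φ) (θ : ℝ)
    (hθ : RotatesBy (rotFull ρ β hβ O).toLinearEquiv.toLinearMap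
      (pairOp ρ O (pull (writeResult ρ fun _ => false) φ)) θ) (i : ℕ) (hi : i ≤ K)
    (y : Fin K → Bool) :
    ((∃ l : Fin K, i ≤ l ∧ y l = true) → pull (writeResult ρ y) (estOps ρ β hβ O i φ) = 0) ∧
    ((∀ l : Fin K, i ≤ l → y l = false) →
      Represents (rotFull ρ β hβ O).toLinearEquiv.toLinearMap
        (pairOp ρ O (pull (writeResult ρ fun _ => false) φ)) θ
        (pull (writeResult ρ y) (estOps ρ β hβ O i φ)) (phaseAmp θ y i) (phaseAmp (-θ) y i)) := by
  induction i generalizing y with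
  | zero =>
    rw [estOps, ← pull_writeResult_comm ρ (supportedOn_pairOp ρ O)]
    constructor
    · rintro ⟨l, -, hl⟩
      have h : pull (writeResult ρ y) φ = 0 := by
        ext x
        exact hφ _ (resQ ρ l) ⟨Sum.inl l, rfl⟩ ((writeResult_resQ ρ y x l).trans hl)
      rw [h, map_zero]
    · intro h
      have hy : y = fun _ => false := funext fun l => h l (Nat.zero_le _)
      rw [hy]
      exact represents_self
  | succ i ih =>
    have h : i < K := hi
    have ih := ih h.le
    have hzero : pull (writeResult ρ (update y ⟨i, h⟩ true)) (estOps ρ β hβ O i φ) = 0 :=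
      (ih _).1 ⟨⟨i, h⟩, le_rfl, update_self _ _ _⟩
    have hstep := pull_estStep ρ β hβ O ⟨i, h⟩ y _ hzero
    simp only [estOps, h, dif_pos, LinearIsometryEquiv.trans_apply]
    constructor
    · rintro ⟨l, hl, hyl⟩
      have hli : l ≠ ⟨i, h⟩ := by
        rintro rfl
        exact absurd hl (by simp)
      have h1 : pull (writeResult ρ (update y ⟨i, h⟩ false)) (estOps ρ β hβ O i φ) = 0 :=
        (ih _).1 ⟨l, by omega, by rw [update_of_ne hli, hyl]⟩
      rw [hstep, h1, map_zero]
      simp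
    · intro hy
      have h1 := (ih (update y ⟨i, h⟩ false)).2 fun l hl => by
        by_cases hli : l = ⟨i, h⟩
        · rw [hli, update_self]
        · rw [update_of_ne hli]
          refine hy l (lt_of_le_of_ne hl fun h' => hli (Fin.ext h'.symm))
      have hcongr : ∀ t, phaseAmp t (update y ⟨i, h⟩ false) i = phaseAmp t y i := fun t =>
        phaseAmp_congr t _ fun l hl => bitAt_update_of_ne y ⟨i, h⟩ _ hl.ne
      rw [hcongr, hcongr] at h1
      have h2 := h1.iterate hθ (2 ^ (K - (i + 1)))
      rw [← iterOp_apply] at h2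
      have h3 := (h1.add ((h2.smul (Complex.exp (-(estimatedPhase y i / 2 : ℝ) * Complex.I))).smul
        (if bitAt y i then (-1 : ℂ) else 1))).smul (2 : ℂ)⁻¹
      rw [hstep]
      exact h3

theorem sum_norm_sq_pull (f : (Fin K → Bool) → ℝ) (ψ : State n m w) :
    ∑ y, f y * ‖pull (writeResult ρ y) ψ‖ ^ 2
      = 2 ^ K * ∑ x, f (readResult ρ x) * ‖ψ x‖ ^ 2 := by
  have h := sum_sum_extend (workQubits (n := n) (m := m) (resultW ρ)) fun y x => f y * ‖ψ x‖ ^ 2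
  rw [Fintype.card_fin] at h
  simp only [EuclideanSpace.norm_sq_eq, Finset.mul_sum] at h ⊢
  exact h

/-- The probability of an error larger than `η` in the result of the estimation. -/
theorem sum_estOps_le (O : Access N d m) (φ : State n m w) (hφ : VanishesOff (regQubits ρ) φ)
    (j : Fin N) (hj : ∀ x, indexValue x ≠ j → φ x = 0) (η : ℝ) (hη : 0 < η) :
    ∑ x, (if η < |Real.cos (estimatedPhase (readResult ρ x) K) - overlap O β j| then (1 : ℝ) else 0)
      * ‖estOps ρ β hβ O K φ x‖ ^ 2
      ≤ 3 * (Real.sqrt 2)⁻¹ ^ K / Real.sqrt (η / 2) * ‖φ‖ ^ 2 := by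
  by_cases hne : φ = 0
  · subst hne
    simp
  set χ := pull (writeResult ρ fun _ => false) φ with hχ
  have hK : (0 : ℝ) < 2 ^ K := by positivity
  have hnorm : ‖χ‖ ^ 2 = 2 ^ K * ‖φ‖ ^ 2 := by
    have h := sum_norm_sq_pull ρ (fun _ => 1) φ
    simp only [one_mul] at h
    rw [EuclideanSpace.norm_sq_eq φ, ← h]
    rw [Fintype.sum_eq_single (fun _ : Fin K => false)]
    intro y hy
    obtain ⟨l, hl⟩ : ∃ l, y l = true := by
      by_contra h'
      refine hy (funext fun l => ?_)
      cases hl : y l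
      · rfl
      · exact absurd ⟨l, hl⟩ h'
    have h0 : pull (writeResult ρ y) φ = 0 := by
      ext x
      exact hφ _ (resQ ρ l) ⟨Sum.inl l, rfl⟩ ((writeResult_resQ ρ y x l).trans hl)
    rw [h0, norm_zero, sq, mul_zero]
  have hχ0 : χ ≠ 0 := by
    intro h
    rw [h, norm_zero] at hnorm
    have h1 : 0 < ‖φ‖ := norm_pos_iff.2 hne
    have : 0 < 2 ^ K * ‖φ‖ ^ 2 := by positivity
    rw [← hnorm] at this
    simp at this
  have hχv : VanishesOff (innerQubits ρ) χ := by
    intro x q hq hxq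
    refine hφ _ q (innerQubits_subset ρ hq) ?_
    rw [writeResult_of_ne, hxq]
    rintro i rfl
    exact result_notMem ρ i (Or.inl hq)
  have hχj : ∀ x, indexValue x ≠ j → χ x = 0 := by
    intro x hx
    refine hj _ ?_
    rwa [writeResult, indexValue_extend_workQubits]
  obtain ⟨θ, hcos, hθ⟩ := exists_rotatesBy_rotFull ρ O β hβ χ hχv j hχj hχ0
  have hrep := fun y => ((estOps_pull ρ β hβ O φ hφ θ hθ K le_rfl y).2 fun l hl =>
    absurd l.2 (by omega)).norm_sq hθ
  have h1 := sum_norm_sq_pull ρ (fun y => if η < |Real.cos (estimatedPhase y K) - overlap O β j|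
    then (1 : ℝ) else 0) (estOps ρ β hβ O K φ)
  simp only [hrep, LinearIsometryEquiv.norm_map, ← hcos] at h1
  rw [← hcos]
  have h2 := sum_phaseAmp_le K θ η hη
  have h3 := sum_phaseAmp_le K (-θ) η hη
  rw [Real.cos_neg] at h3
  rw [hnorm] at h1
  set τ := 3 * (Real.sqrt 2)⁻¹ ^ K / Real.sqrt (η / 2)
  have h4 : ∑ y : Fin K → Bool, (if η < |Real.cos (estimatedPhase y K) - Real.cos θ|
      then (1 : ℝ) else 0) * ((‖phaseAmp θ y K‖ ^ 2 + ‖phaseAmp (-θ) y K‖ ^ 2) / 2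
        * (2 ^ K * ‖φ‖ ^ 2)) = (2 ^ K * ‖φ‖ ^ 2 / 2) *
      (∑ y : Fin K → Bool, (if η < |Real.cos (estimatedPhase y K) - Real.cos θ|
        then ‖phaseAmp θ y K‖ ^ 2 else 0)
      + ∑ y : Fin K → Bool, (if η < |Real.cos (estimatedPhase y K) - Real.cos θ|
        then ‖phaseAmp (-θ) y K‖ ^ 2 else 0)) := by
    rw [← Finset.sum_add_distrib, Finset.mul_sum]
    refine Finset.sum_congr rfl fun y _ => ?_
    split_ifs <;> ring
  rw [h4] at h1
  have h5 : 2 ^ K * ‖φ‖ ^ 2 / 2 * (τ + τ) = 2 ^ K * (τ * ‖φ‖ ^ 2) := by ring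
  refine le_of_mul_le_mul_left ?_ hK
  rw [← h1, ← h5]
  exact mul_le_mul_of_nonneg_left (add_le_add h2 h3) (by positivity)

end estimationCircuit

section rounding

/-- The rounding of `t` to the grid of width `g` with offset `-g o`. -/
def roundTo (g o t : ℝ) : ℝ := g * (⌊t / g + o⌋ - o)

theorem abs_roundTo_sub_le {g : ℝ} (hg : 0 < g) (o t : ℝ) : |roundTo g o t - t| ≤ g := by
  have h : roundTo g o t - t = g * (⌊t / g + o⌋ - (t / g + o)) := by
    rw [roundTo]
    field_simp
    ring
  rw [h, abs_mul, abs_of_pos hg]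
  refine mul_le_of_le_one_right hg.le (abs_le.2 ⟨?_, ?_⟩)
  · linarith [Int.lt_floor_add_one (t / g + o)]
  · linarith [Int.floor_le (t / g + o)]

/-- The rounding with offset `r / R` is not constant close to `a`. -/
def BadSeed (g a : ℝ) {R : ℕ} (r : Fin R) : Prop :=
  ∃ t, |t - a| ≤ g / (4 * R) ∧ roundTo g (r / R) t ≠ roundTo g (r / R) a

theorem exists_int_abs_sub_le {x y : ℝ} (h : ⌊x⌋ ≠ ⌊y⌋) : ∃ z : ℤ, |y - z| ≤ |x - y| := by
  rcases lt_or_gt_of_ne h with h | h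
  · refine ⟨⌊y⌋, ?_⟩
    have h1 : x < ⌊y⌋ := Int.floor_lt.1 h |>.trans_le le_rfl |> fun h => by exact_mod_cast h
    have h2 := Int.floor_le y
    rw [abs_of_nonneg (by linarith), abs_of_neg (by linarith)]
    linarith
  · refine ⟨⌊x⌋, ?_⟩
    have h1 : y < ⌊x⌋ := Int.floor_lt.1 h |>.trans_le le_rfl |> fun h => by exact_mod_cast h
    have h2 := Int.floor_le x
    rw [abs_of_neg (by linarith), abs_of_pos (by linarith)]
    linarith

theorem BadSeed.eq {g a : ℝ} (hg : 0 < g) {R : ℕ} {r r' : Fin R} (h : BadSeed g a r)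
    (h' : BadSeed g a r') : r = r' := by
  have hR : (0 : ℝ) < R := by exact_mod_cast r.pos
  have key : ∀ r : Fin R, BadSeed g a r → ∃ z : ℤ, |a / g + r / R - z| ≤ 1 / (4 * R) := by
    rintro r ⟨t, ht, hne⟩
    have h1 : ⌊t / g + r / R⌋ ≠ ⌊a / g + r / R⌋ := fun h => hne (by rw [roundTo, roundTo, h])
    obtain ⟨z, hz⟩ := exists_int_abs_sub_le h1
    refine ⟨z, hz.trans ?_⟩
    rw [show t / g + r / R - (a / g + r / R) = (t - a) / g by ring, abs_div, abs_of_pos hg,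
      div_le_iff₀ hg]
    refine ht.trans_eq ?_
    ring
  obtain ⟨z, hz⟩ := key r h
  obtain ⟨z', hz'⟩ := key r' h'
  have h1 : |(r : ℝ) / R - r' / R - (z - z')| ≤ 1 / (2 * R) := by
    have := abs_sub (a / g + r / R - z) (a / g + r' / R - z')
    rw [show a / g + r / R - z - (a / g + r' / R - z') = (r : ℝ) / R - r' / R - (z - z') by ring]
      at this
    refine this.trans ((add_le_add hz hz').trans_eq ?_)
    field_simp
    norm_num
  have h2 : |((r : ℤ) - r' - R * (z - z') : ℤ)| < 1 := by
    have h3 : |(((r : ℤ) - r' - R * (z - z') : ℤ) : ℝ)| ≤ 1 / 2 := by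
      push_cast
      rw [show (r : ℝ) - r' - R * (z - z') = R * ((r : ℝ) / R - r' / R - (z - z')) by
        field_simp, abs_mul, abs_of_pos hR]
      refine (mul_le_mul_of_nonneg_left h1 hR.le).trans_eq ?_
      field_simp
    have h4 : ((|((r : ℤ) - r' - R * (z - z') : ℤ)| : ℤ) : ℝ) < 1 := by
      rw [Int.cast_abs]
      linarith
    exact_mod_cast h4
  have h3 : (r : ℤ) - r' = R * (z - z') := by
    have := Int.abs_lt_one_iff.1 h2
    linarith
  have h4 : z - z' = 0 := by
    rw [← Int.abs_lt_one_iff]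
    by_contra h5
    push Not at h5
    have h6 : (R : ℤ) ≤ |(r : ℤ) - r'| := by
      rw [h3, abs_mul, Nat.abs_cast]
      exact le_mul_of_one_le_right (by positivity) h5
    have h7 : |(r : ℤ) - r'| < R := by
      rw [abs_lt]
      have := r.2
      have := r'.2
      constructor <;> omega
    omega
  rw [h4, mul_zero] at h3
  exact Fin.ext (by omega)

open Classical in
theorem card_badSeed_le {g : ℝ} (hg : 0 < g) (a : ℝ) (R : ℕ) :
    (Finset.univ.filter fun r : Fin R => BadSeed g a r).card ≤ 1 :=
  Finset.card_le_one.2 fun _ hr _ hr' =>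
    BadSeed.eq hg (Finset.mem_filter.1 hr).2 (Finset.mem_filter.1 hr').2

theorem card_good_seeds {N R : ℕ} (hN : 0 < N) (bad : Fin N → Finset (Fin R))
    (hbad : ∀ j, (bad j).card ≤ 2) {β δ : ℝ} (hβ : 0 < β) (hR : 2 ≤ β * (δ * R)) :
    (1 - δ) * R ≤ ((Finset.univ.filter fun r =>
      ((Finset.univ.filter fun j => r ∈ bad j).card : ℝ) ≤ β * N).card : ℝ) := by
  set good := Finset.univ.filter fun r =>
      ((Finset.univ.filter fun j => r ∈ bad j).card : ℝ) ≤ β * N with hgood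
  have hN' : (0 : ℝ) < N := by exact_mod_cast hN
  have h1 : ∑ r, ((Finset.univ.filter fun j => r ∈ bad j).card : ℝ) ≤ 2 * N := by
    have h2 : ∑ r, (Finset.univ.filter fun j => r ∈ bad j).card = ∑ j, (bad j).card := by
      simp only [Finset.card_filter]
      rw [Finset.sum_comm]
      refine Finset.sum_congr rfl fun j _ => ?_
      rw [← Finset.card_filter]
      congr 1
      ext r
      simp
    have h3 : ∑ j, (bad j).card ≤ ∑ _j : Fin N, 2 := Finset.sum_le_sum fun j _ => hbad j
    rw [← h2] at h3
    have h4 : ∑ r, (Finset.univ.filter fun j => r ∈ bad j).card ≤ 2 * N := by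
      simpa [mul_comm] using h3
    exact_mod_cast h4
  have h2 : (goodᶜ.card : ℝ) * (β * N) ≤ 2 * N := by
    refine le_trans ?_ h1
    rw [← nsmul_eq_mul, ← Finset.sum_const]
    refine (Finset.sum_le_sum fun r hr => ?_).trans
      (Finset.sum_le_sum_of_subset_of_nonneg (Finset.subset_univ goodᶜ) fun _ _ _ => by positivity)
    rw [hgood, Finset.mem_compl, Finset.mem_filter] at hr
    push Not at hr
    exact (hr (Finset.mem_univ _)).le
  have h3 : (goodᶜ.card : ℝ) * β ≤ 2 := by
    refine le_of_mul_le_mul_right ?_ hN'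
    linarith
  have h4 : (goodᶜ.card : ℝ) ≤ δ * R := by
    refine le_of_mul_le_mul_right (h3.trans hR |>.trans_eq (mul_comm _ _)) hβ
  have h5 : (good.card : ℝ) + goodᶜ.card = R := by
    have := Finset.card_add_card_compl good
    rw [Fintype.card_fin] at this
    exact_mod_cast this
  linarith

end rounding

section assembly

variable {N n d m w K : ℕ}

/-- The estimations of the real and of the imaginary part of the overlaps. -/
def estBoth (ρ ρ' : RegType K d ↪ Fin w) (O : Access N d m) : State n m w ≃ₗᵢ[ℂ] State n m w :=
  (estOps ρ 1 (by simp) O K).trans (estOps ρ' Complex.I (by simp) O K)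

theorem mul_add_two_le (K : ℕ) : K * (K + 2) ≤ 4 * 2 ^ K := by
  have h : ∀ K : ℕ, 2 * K + 3 ≤ 4 * 2 ^ K := by
    intro K
    induction K with
    | zero => norm_num
    | succ K ih =>
      rw [pow_succ]
      omega
  induction K with
  | zero => norm_num
  | succ K ih =>
    have := h K
    rw [pow_succ]
    nlinarith

theorem impl_estBoth (ρ ρ' : RegType K d ↪ Fin w) :
    Impl (N := N) (n := n) (m := m) ((4 * d + 32) * 2 ^ K) (12 * 2 ^ K) (estBoth ρ ρ') := by
  have hK : ((K * (K + 2) : ℕ) : ℝ) ≤ ((4 * 2 ^ K : ℕ) : ℝ) := by exact_mod_cast mul_add_two_le K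
  have h1 : (1 : ℝ) ≤ 2 ^ K := one_le_pow₀ one_le_two
  push_cast at hK
  refine ((impl_estOps ρ 1 (by simp) K le_rfl).trans
    (impl_estOps ρ' Complex.I (by simp) K le_rfl)).mono ?_ ?_
  · rw [Nat.sub_self, pow_zero]
    nlinarith
  · rw [Nat.sub_self, pow_zero]
    linarith

theorem norm_mulFn_indicator_sq {Q : Type} [Fintype Q] [DecidableEq Q] (p : (Q → Bool) → Prop)
    [DecidablePred p] (ψ : QState Q) :
    ‖mulFn (fun x => if p x then 1 else 0) ψ‖ ^ 2 = ∑ x, (if p x then (1 : ℝ) else 0) * ‖ψ x‖ ^ 2 := by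
  rw [EuclideanSpace.norm_sq_eq]
  refine Finset.sum_congr rfl fun x _ => ?_
  rw [mulFn_apply]
  split_ifs <;> simp

theorem sum_estBoth_le (ρ ρ' : RegType K d ↪ Fin w) (hρ : ∀ r r', ρ r ≠ ρ' r') (O : Access N d m)
    (φ : State n m w) (h1 : VanishesOff (regQubits ρ) φ) (h2 : VanishesOff (regQubits ρ') φ)
    (j : Fin N) (hj : ∀ x, indexValue x ≠ j → φ x = 0) (η : ℝ) (hη : 0 < η) :
    ∑ x, ((if η < |Real.cos (estimatedPhase (readResult ρ x) K) - overlap O 1 j| then (1 : ℝ) else 0)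
      + (if η < |Real.cos (estimatedPhase (readResult ρ' x) K) - overlap O Complex.I j|
          then (1 : ℝ) else 0))
      * ‖estBoth ρ ρ' O φ x‖ ^ 2
      ≤ 2 * (3 * (Real.sqrt 2)⁻¹ ^ K / Real.sqrt (η / 2)) * ‖φ‖ ^ 2 := by
  have hF := supportedOn_estOps (n := n) ρ 1 (by simp) O K
  have hF' := supportedOn_estOps (n := n) ρ' Complex.I (by simp) O K
  have hdis : ∀ r, (workQ (ρ r) : Qubit n m w) ∉ regQubits ρ' := by
    rintro r ⟨r', hr'⟩
    exact hρ r r' (workQ_inj.1 hr').symm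
  have hdis' : ∀ r, (workQ (ρ' r) : Qubit n m w) ∉ regQubits ρ := by
    rintro r ⟨r', hr'⟩
    exact hρ r' r (workQ_inj.1 hr')
  simp only [add_mul, Finset.sum_add_distrib]
  rw [two_mul, add_mul]
  refine add_le_add ?_ ?_
  · rw [← norm_mulFn_indicator_sq
      (fun x => η < |Real.cos (estimatedPhase (readResult ρ x) K) - overlap O 1 j|), estBoth,
      LinearIsometryEquiv.trans_apply, ← hF'.mulFn_comm, LinearIsometryEquiv.norm_map,
      norm_mulFn_indicator_sq]
    · exact sum_estOps_le ρ 1 (by simp) O φ h1 j hj η hη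
    · intro x y hxy
      have : readResult ρ x = readResult ρ y := funext fun i => hxy _ (hdis _)
      rw [this]
  · have h3 := sum_estOps_le ρ' Complex.I (by simp) O (estOps ρ 1 (by simp) O K φ) ?_ j ?_ η hη
    · rwa [LinearIsometryEquiv.norm_map] at h3
    · rintro x _ ⟨r, rfl⟩ hx
      exact hF.apply_eq_zero (fun x => x (workQ (ρ' r)) = true)
        (fun x y hxy => by rw [hxy _ (hdis' r)]) (fun x hx => h2 x _ ⟨r, rfl⟩ hx) x hx
    · intro x hx
      refine hF.apply_eq_zero (fun x => indexValue x ≠ j) (fun x y hxy => ?_) hj x hx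
      rw [indexValue_congr fun i => hxy (Sum.inl i) ?_]
      rintro ⟨r, hr⟩
      simp [workQ] at hr

theorem norm_xorOp_sub_le (b b' : ℕ → (Fin w → Bool) → Fin m → Bool) (p : Label n m w → Prop)
    [DecidablePred p] (hp : ∀ x a, p (xorOut x a) ↔ p x)
    (h : ∀ x, ¬ p x → b (indexValue x) (workPart x) = b' (indexValue x) (workPart x))
    (ψ : State n m w) :
    ‖xorOp b ψ - xorOp b' ψ‖ ≤ 2 * ‖mulFn (fun x => if p x then 1 else 0) ψ‖ := by
  have h1 : xorOp b ψ - xorOp b' ψ = xorOp b (mulFn (fun x => if p x then 1 else 0) ψ)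
      - xorOp b' (mulFn (fun x => if p x then 1 else 0) ψ) := by
    ext x
    simp only [PiLp.sub_apply, xorOp_apply, mulFn_apply, hp]
    by_cases hx : p x
    · simp [hx]
    · simp [hx, h x hx]
  rw [h1]
  refine (norm_sub_le _ _).trans_eq ?_
  rw [LinearIsometryEquiv.norm_map, LinearIsometryEquiv.norm_map, two_mul]

theorem estBoth_xorOp (ρ ρ' : RegType K d ↪ Fin w) (O : Access N d m)
    (b : ℕ → Fin m → Bool) (ψ : State n m w) :
    estBoth ρ ρ' O (xorOp (fun j _ => b j) ψ) = xorOp (fun j _ => b j) (estBoth ρ ρ' O ψ) := by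
  have key : ∀ (ρ : RegType K d ↪ Fin w) (F : State n m w ≃ₗᵢ[ℂ] State n m w),
      SupportedOn (indexQubits n m w) (regQubits ρ) F → ∀ ψ,
      F (xorOp (fun j _ => b j) ψ) = xorOp (fun j _ => b j) (F ψ) := by
    intro ρ F hF ψ
    refine hF.pull_comm (fun x => xorOut x (b (indexValue x))) (fun x q hq => ?_)
      (fun x y hxy q hq => ?_) ψ
    · rcases hq with ⟨r, rfl⟩ | ⟨i, rfl⟩ <;> rfl
    · have hidx : indexValue x = indexValue y := indexValue_congr fun i => hxy _ (by
        rintro ⟨r, hr⟩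
        simp [workQ] at hr)
      rw [hidx]
      rcases q with i | i | i
      · exact hxy _ hq
      · simp only [xorOut, hxy _ hq]
      · exact hxy _ hq
  rw [estBoth, LinearIsometryEquiv.trans_apply, key ρ _ (supportedOn_estOps _ _ _ _ _),
    key ρ' _ (supportedOn_estOps _ _ _ _ _)]
  rfl

theorem label_eq_of_uniformState_ne_zero {x y : Label n m w}
    (hx : uniformState (N := N) n w (fun _ _ => false) x ≠ 0)
    (hy : uniformState (N := N) n w (fun _ _ => false) y ≠ 0) (h : indexValue x = indexValue y) :
    x = y := by
  have key : ∀ z : Label n m w, uniformState (N := N) n w (fun _ _ => false) z ≠ 0 →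
      outPart z = (fun _ => false) ∧ workPart z = fun _ => false := by
    intro z hz
    by_contra h'
    refine hz ?_
    simp only [uniformState, h', if_false]
    split_ifs <;> rfl
  have hx := key x hx
  have hy := key y hy
  funext q
  rcases q with i | i | i
  · rw [← testBit_indexValue x, h, testBit_indexValue y]
  · exact (congrFun hx.1 i).trans (congrFun hy.1 i).symm
  · exact (congrFun hx.2 i).trans (congrFun hy.2 i).symm

theorem norm_uniformState_index_sq_le (j : ℕ) :
    ‖mulFn (fun x => if indexValue x = j then 1 else 0)
      (uniformState (N := N) (m := m) n w fun _ _ => false)‖ ^ 2 ≤ 1 / N := by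
  rw [norm_mulFn_indicator_sq]
  have hle : ∀ x, ‖uniformState (N := N) (m := m) n w (fun _ _ => false) x‖ ^ 2 ≤ 1 / (N : ℝ) := by
    intro x
    simp only [uniformState]
    split_ifs
    · rw [Complex.norm_real, Real.norm_of_nonneg (by positivity), div_pow, one_pow,
        Real.sq_sqrt (Nat.cast_nonneg N)]
    · simp
    · simp
  by_cases h : ∃ x, indexValue x = j ∧
      uniformState (N := N) (m := m) n w (fun _ _ => false) x ≠ 0
  · obtain ⟨x, hx, hx'⟩ := h
    rw [Fintype.sum_eq_single x, if_pos hx, one_mul]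
    · exact hle x
    · intro y hy
      by_cases h1 : indexValue y = j
      · have : uniformState (N := N) (m := m) n w (fun _ _ => false) y = 0 := by
          by_contra h2
          exact hy (label_eq_of_uniformState_ne_zero h2 hx' (h1.trans hx.symm))
        simp [this]
      · simp [h1]
  · push Not at h
    rw [Finset.sum_eq_zero]
    · positivity
    · intro x _
      by_cases h1 : indexValue x = j
      · simp [h x h1]
      · simp [h1]

theorem xorOp_uniformState (b : Fin N → Fin m → Bool) :
    xorOp (fun j _ => if h : j < N then b ⟨j, h⟩ else fun _ => false)
      (uniformState (N := N) n w fun _ _ => false) = uniformState n w b := by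
  ext x
  simp only [xorOp_apply, uniformState, indexValue_xorOut, workPart_xorOut]
  by_cases h : indexValue x < N
  · have h1 : outPart (xorOut x (b ⟨indexValue x, h⟩)) = (fun _ => false)
        ↔ outPart x = b ⟨indexValue x, h⟩ := by
      rw [funext_iff, funext_iff]
      refine forall_congr' fun i => ?_
      simp only [outPart, xorOut]
      cases x (Sum.inr (Sum.inl i)) <;> cases b ⟨indexValue x, h⟩ i <;> simp
    simp only [h, dif_pos, h1]
  · simp only [h, dif_neg, not_false_eq_true]

end assembly

section error

variable {N n d m w K : ℕ}

open Classical in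
theorem norm_estBoth_bad_sq_le (ρ ρ' : RegType K d ↪ Fin w) (hρ : ∀ r r', ρ r ≠ ρ' r')
    (O : Access N d m) (hN : 0 < N) (S : (Fin w → Bool) → ℂ) (s : Fin N → ℂ) (bad : Finset (Fin N))
    (η β p : ℝ) (hη : 0 < η) (hbad : (bad.card : ℝ) ≤ β * N)
    (hp : 3 * (Real.sqrt 2)⁻¹ ^ K / Real.sqrt (η / 2) ≤ p)
    (hs : ∀ j ∉ bad, ∀ x : Label n m w,
      |Real.cos (estimatedPhase (readResult ρ x) K) - overlap O 1 j| ≤ η →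
      |Real.cos (estimatedPhase (readResult ρ' x) K) - overlap O Complex.I j| ≤ η →
      S (workPart x) = s j) :
    ‖mulFn (fun x => if ∃ j : Fin N, indexValue x = j ∧ S (workPart x) ≠ s j then 1 else 0)
      (estBoth ρ ρ' O (uniformState (N := N) (m := m) n w fun _ _ => false))‖ ^ 2
      ≤ β + 2 * p := by
  have hN' : (0 : ℝ) < N := by exact_mod_cast hN
  set u : State n m w := uniformState (N := N) n w fun _ _ => false with hu
  let φ : Fin N → State n m w := fun j => mulFn (fun x => if indexValue x = j then 1 else 0) u
  have hφ : ∀ j, ‖φ j‖ ^ 2 ≤ 1 / N := fun j => norm_uniformState_index_sq_le (N := N) (m := m) j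
  have hD : ∀ j x, estBoth ρ ρ' O (φ j) x
      = (if indexValue x = j then 1 else 0) * estBoth ρ ρ' O u x := by
    intro j x
    have key : ∀ (ρ : RegType K d ↪ Fin w) (x y : Label n m w), AgreeOff (regQubits ρ) x y →
        (if indexValue x = j then (1 : ℂ) else 0) = if indexValue y = j then 1 else 0 := by
      intro ρ x y hxy
      rw [indexValue_congr fun i => hxy (Sum.inl i) ?_]
      rintro ⟨r, hr⟩
      simp [workQ] at hr
    simp only [φ, estBoth, LinearIsometryEquiv.trans_apply]
    rw [(supportedOn_estOps ρ 1 (by simp) O K).mulFn_comm _ (key ρ),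
      (supportedOn_estOps ρ' Complex.I (by simp) O K).mulFn_comm _ (key ρ')]
    rfl
  have hvan : ∀ ρ : RegType K d ↪ Fin w, ∀ j, VanishesOff (regQubits ρ) (φ j) := by
    rintro ρ j x _ ⟨r, rfl⟩ hx
    have h1 : ¬ workPart x = fun _ => false := fun h => by
      have h2 : x (workQ (ρ r)) = false := congrFun h (ρ r)
      rw [hx] at h2
      exact absurd h2 (by simp)
    have h2 : u x = 0 := by
      simp only [hu, uniformState, h1, and_false, if_false, dite_eq_ite, ite_self]
    simp only [φ, mulFn_apply, h2, mul_zero]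
  have hidx : ∀ (j : Fin N) (x : Label n m w), indexValue x ≠ j → φ j x = 0 := by
    intro j x hx
    simp [φ, hx]
  let q : Label n m w → Prop := fun x => ∃ j : Fin N, indexValue x = j ∧ S (workPart x) ≠ s j
  have hsplit : ∑ x, (if q x then (1 : ℝ) else 0) * ‖estBoth ρ ρ' O u x‖ ^ 2
      = ∑ j, ∑ x, (if q x then (1 : ℝ) else 0) * ‖estBoth ρ ρ' O (φ j) x‖ ^ 2 := by
    rw [Finset.sum_comm]
    refine Finset.sum_congr rfl fun x _ => ?_
    by_cases hq : q x
    · obtain ⟨j, hj, -⟩ := hq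
      rw [Finset.sum_eq_single j]
      · rw [hD, if_pos hj, one_mul]
      · intro j' _ hj'
        have : indexValue x ≠ j' := fun h => hj' (Fin.ext (h.symm.trans hj))
        rw [hD, if_neg this, zero_mul, norm_zero]
        simp
      · simp
    · simp [hq]
  rw [norm_mulFn_indicator_sq]
  change ∑ x, (if q x then (1 : ℝ) else 0) * ‖estBoth ρ ρ' O u x‖ ^ 2 ≤ _
  rw [hsplit]
  have hp0 : 0 ≤ p := le_trans (by positivity) hp
  have hterm : ∀ j, ∑ x, (if q x then (1 : ℝ) else 0) * ‖estBoth ρ ρ' O (φ j) x‖ ^ 2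
      ≤ (if j ∈ bad then 1 / (N : ℝ) else 0) + 2 * p * (1 / N) := by
    intro j
    by_cases hj : j ∈ bad
    · rw [if_pos hj]
      have h1 : ∑ x, (if q x then (1 : ℝ) else 0) * ‖estBoth ρ ρ' O (φ j) x‖ ^ 2
          ≤ ‖estBoth ρ ρ' O (φ j)‖ ^ 2 := by
        rw [EuclideanSpace.norm_sq_eq]
        refine Finset.sum_le_sum fun x _ => ?_
        split_ifs
        · rw [one_mul]
        · rw [zero_mul]
          positivity
      rw [LinearIsometryEquiv.norm_map] at h1
      have h2 : 0 ≤ 2 * p * (1 / (N : ℝ)) := by positivity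
      linarith [hφ j]
    · rw [if_neg hj, zero_add]
      have h1 := sum_estBoth_le ρ ρ' hρ O (φ j) (hvan ρ j) (hvan ρ' j) j (hidx j) η hη
      refine le_trans (le_trans (Finset.sum_le_sum fun x _ => ?_) h1)
        (mul_le_mul (by linarith) (hφ j) (sq_nonneg _) (by positivity))
      by_cases hx : indexValue x = j
      · refine mul_le_mul_of_nonneg_right ?_ (sq_nonneg _)
        by_cases hq : q x
        · rw [if_pos hq]
          obtain ⟨j', hj', hne⟩ := hq
          obtain rfl : j' = j := Fin.ext (hj'.symm.trans hx)
          by_cases h2 : η < |Real.cos (estimatedPhase (readResult ρ x) K) - overlap O 1 j'|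
          · rw [if_pos h2]
            split_ifs <;> norm_num
          · rw [if_pos (lt_of_not_ge fun h3 => hne (hs j' hj x (not_lt.1 h2) h3))]
            split_ifs; norm_num
        · rw [if_neg hq]
          split_ifs <;> norm_num
      · rw [hD, if_neg hx, zero_mul, norm_zero]
        simp
  refine (Finset.sum_le_sum fun j _ => hterm j).trans ?_
  rw [Finset.sum_add_distrib, Finset.sum_const, Finset.card_univ, Fintype.card_fin, nsmul_eq_mul,
    ← Finset.sum_filter, Finset.sum_const, nsmul_eq_mul]
  have h1 : (Finset.univ.filter fun j => j ∈ bad) = bad := by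
    ext j
    simp
  have h2 : (N : ℝ) * (2 * p * (1 / N)) = 2 * p := by field_simp
  have h3 : (bad.card : ℝ) * (1 / N) ≤ β := by
    rw [mul_one_div, div_le_iff₀ hN']
    exact hbad
  rw [h1, h2]
  linarith

theorem norm_final_sub_le (ρ ρ' : RegType K d ↪ Fin w) (hρ : ∀ r r', ρ r ≠ ρ' r')
    (O : Access N d m) (hN : 0 < N) (S : (Fin w → Bool) → ℂ) (s : Fin N → ℂ) (bad : Finset (Fin N))
    (η β p δ : ℝ) (hη : 0 < η) (hbad : (bad.card : ℝ) ≤ β * N)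
    (hp : 3 * (Real.sqrt 2)⁻¹ ^ K / Real.sqrt (η / 2) ≤ p)
    (hs : ∀ j ∉ bad, ∀ x : Label n m w,
      |Real.cos (estimatedPhase (readResult ρ x) K) - overlap O 1 j| ≤ η →
      |Real.cos (estimatedPhase (readResult ρ' x) K) - overlap O Complex.I j| ≤ η →
      S (workPart x) = s j) (hδ : 0 ≤ δ) (hβp : 4 * (β + 2 * p) ≤ δ ^ 2) :
    ‖(estBoth ρ ρ' O).symm (xorOp (evalBits O S)
        (estBoth ρ ρ' O (uniformState (N := N) n w fun _ _ => false)))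
      - uniformState n w fun j => O.f j (s j)‖ ≤ δ := by
  classical
  have h1 := norm_estBoth_bad_sq_le (n := n) ρ ρ' hρ O hN S s bad η β p hη hbad hp hs
  set ψ := estBoth ρ ρ' O (uniformState (N := N) n w fun _ _ => false) with hψ
  rw [← xorOp_uniformState fun j => O.f j (s j), ← (estBoth ρ ρ' O).norm_map, map_sub,
    LinearIsometryEquiv.apply_symm_apply, estBoth_xorOp ρ ρ' O
      (fun j => if h : j < N then O.f ⟨j, h⟩ (s ⟨j, h⟩) else fun _ => false), ← hψ]
  have h2 := norm_xorOp_sub_le (evalBits O S)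
    (fun j _ => if h : j < N then O.f ⟨j, h⟩ (s ⟨j, h⟩) else fun _ => false)
    (fun x : Label n m w => ∃ j : Fin N, indexValue x = j ∧ S (workPart x) ≠ s j)
    (fun _ _ => Iff.rfl) (fun x hx => by
      push Not at hx
      unfold evalBits
      split_ifs with h
      · rw [hx ⟨indexValue x, h⟩ rfl]
      · rfl) ψ
  refine h2.trans (abs_le_of_sq_le_sq' ?_ hδ).2
  rw [mul_pow]
  linarith

theorem overlap_one (O : Access N d m) (u v : EuclideanSpace ℂ (Fin d → Bool)) (j : Fin N)
    (hu : Prepares (O.U j) u) (hv : Prepares (O.V j) v) : overlap O 1 j = (inner ℂ u v).re := by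
  rw [overlap, map_one, one_mul, PiLp.inner_apply]
  congr 1
  refine Finset.sum_congr rfl fun a _ => ?_
  rw [hu a, hv a, RCLike.inner_apply, mul_comm]

theorem overlap_I (O : Access N d m) (u v : EuclideanSpace ℂ (Fin d → Bool)) (j : Fin N)
    (hu : Prepares (O.U j) u) (hv : Prepares (O.V j) v) :
    overlap O Complex.I j = (inner ℂ u v).im := by
  have h : ∑ a, starRingEnd ℂ ((O.U j).1 a fun _ => false) * (O.V j).1 a (fun _ => false)
      = inner ℂ u v := by
    rw [PiLp.inner_apply]
    refine Finset.sum_congr rfl fun a _ => ?_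
    rw [hu a, hv a, RCLike.inner_apply, mul_comm]
  rw [overlap, h, Complex.conj_I, neg_mul, Complex.neg_re, Complex.I_mul_re, neg_neg]

theorem exists_two_pow {x : ℝ} (hx : 1 ≤ x) : ∃ K : ℕ, x ≤ 2 ^ K ∧ (2 : ℝ) ^ K ≤ 2 * x := by
  obtain ⟨k, h1, h2⟩ := exists_nat_pow_near hx one_lt_two
  exact ⟨k + 1, h2.le, by rw [pow_succ]; linarith⟩

theorem error_bound {η p : ℝ} {K : ℕ} (hη : 0 < η) (hp : 0 < p) (h : 18 / (η * p ^ 2) ≤ 2 ^ K) :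
    3 * (Real.sqrt 2)⁻¹ ^ K / Real.sqrt (η / 2) ≤ p := by
  have h2 : (0 : ℝ) < 2 ^ K := by positivity
  refine (abs_le_of_sq_le_sq' ?_ hp.le).2
  rw [div_pow, mul_pow, Real.sq_sqrt (by positivity), ← pow_mul, mul_comm K 2, pow_mul, inv_pow,
    Real.sq_sqrt zero_le_two, inv_pow, div_le_iff₀ (by positivity), ← div_eq_mul_inv,
    div_le_iff₀ h2]
  rw [div_le_iff₀ (by positivity)] at h
  nlinarith

end error

end ParallelSwapTest

end

theorem mainTheorem1 (δ : ℝ) (hδ : 0 < δ) :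
    ∃ (C : ℝ) (R : ℕ), 0 < C ∧ 0 < R ∧
      ∀ (N n d m : ℕ) (ε : ℝ), 0 < N → N ≤ 2 ^ n → 0 < ε → ε ≤ 1 →
        ∃ (w : ℕ) (P : Fin R → ParallelSwapTest.Circuit n d m w),
          (∀ T : ℝ, 1 ≤ T → (n : ℝ) + (d : ℝ) ≤ T →
            ∀ r, ParallelSwapTest.Circuit.time T (P r) ≤ C * (T / ε)) ∧
          ∀ (u v : Fin N → EuclideanSpace ℂ (Fin d → Bool)) (O : ParallelSwapTest.Access N d m),
            (∀ j, ParallelSwapTest.Prepares (O.U j) (u j)) →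
            (∀ j, ParallelSwapTest.Prepares (O.V j) (v j)) →
            ∃ good : Finset (Fin R), (1 - δ) * (R : ℝ) ≤ (good.card : ℝ) ∧
              ∀ r ∈ good, ∃ s : Fin N → ℂ,
                (∀ j, ‖s j - inner ℂ (u j) (v j)‖ ≤ ε) ∧
                ‖ParallelSwapTest.Circuit.run O (P r) -
                  ParallelSwapTest.uniformState n w (fun j => O.f j (s j))‖ ≤ δ := by
  open ParallelSwapTest in
  classical
  set δ' := min δ 1 with hδ'
  have hδ'0 : 0 < δ' := lt_min hδ one_pos
  have hδ'1 : δ' ≤ 1 := min_le_right _ _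
  have hδ'δ : δ' ≤ δ := min_le_left _ _
  set β := δ' ^ 2 / 8 with hβ
  set p := δ' ^ 2 / 16 with hp
  have hβ0 : 0 < β := by positivity
  have hp0 : 0 < p := by positivity
  have hp1 : p ≤ 1 := by rw [hp]; nlinarith
  obtain ⟨R, hR⟩ := exists_nat_ge (2 / (β * δ'))
  have hR0' : (0 : ℝ) < R := lt_of_lt_of_le (by positivity) hR
  have hR0 : 0 < R := by exact_mod_cast hR0'
  have hR1 : (1 : ℝ) ≤ R := by exact_mod_cast hR0
  have hRβ : 2 ≤ β * (δ' * R) := by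
    rw [div_le_iff₀ (by positivity)] at hR
    linarith
  set X : ℝ := 144 * R / p ^ 2 with hX
  have hX1 : 1 ≤ X := by
    rw [hX, le_div_iff₀ (by positivity)]
    nlinarith
  refine ⟨200 * X, R, by positivity, hR0, fun N n d m ε hN hNn hε hε1 => ?_⟩
  obtain ⟨K, hK1, hK2⟩ := exists_two_pow (x := X / ε)
    (by rw [le_div_iff₀ hε]; linarith)
  let W := Fin (n + 1) ⊕ RegType K d ⊕ RegType K d
  let e : W ↪ Fin (Fintype.card W) := (Fintype.equivFin W).toEmbedding
  let t : Fin (n + 1) ↪ Fin (Fintype.card W) := Function.Embedding.inl.trans e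
  let ρ : RegType K d ↪ Fin (Fintype.card W) :=
    (Function.Embedding.inl.trans Function.Embedding.inr).trans e
  let ρ' : RegType K d ↪ Fin (Fintype.card W) :=
    (Function.Embedding.inr.trans Function.Embedding.inr).trans e
  have hρ : ∀ r r', ρ r ≠ ρ' r' := fun r r' h => by
    exact Sum.inl_ne_inr (Sum.inr.inj (e.injective h))
  set g := ε / 2 with hg
  have hg0 : 0 < g := by positivity
  set η := g / (4 * R) with hη
  have hη0 : 0 < η := by positivity
  let σ : Fin R → (Fin K → Bool) → ℝ := fun r y =>
    roundTo g (r / R) (Real.cos (estimatedPhase y K))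
  let S : Fin R → (Fin (Fintype.card W) → Bool) → ℂ := fun r z =>
    (σ r fun i => z (resultW ρ i)) + (σ r fun i => z (resultW ρ' i)) * Complex.I
  have himpl : ∀ r : Fin R, Impl (N := N) (n := n) (m := m)
      (3 * n + 2 + 2 * ((4 * d + 32) * 2 ^ K) + 2 * 2 ^ K) (24 * 2 ^ K)
      (fun O : Access N d m => ((uniformOp hN t).trans (estBoth ρ ρ' O)).trans
        ((xorOp (evalBits O (S r))).trans (estBoth ρ ρ' O).symm)) := fun r =>
    (((impl_uniformOp hN t).trans (impl_estBoth ρ ρ')).trans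
      ((impl_evaluate K K (resultW ρ) (resultW ρ') (σ r) (σ r)).trans
        (impl_estBoth ρ ρ').symm)).mono (by linarith) (by linarith)
  choose P hPtime hPrun using himpl
  refine ⟨Fintype.card W, P, fun T hT hTnd r => ?_, fun u v O hu hv => ?_⟩
  · have h1 : (1 : ℝ) ≤ 2 ^ K := one_le_pow₀ one_le_two
    have hn : (0 : ℝ) ≤ n := Nat.cast_nonneg n
    have hd : (0 : ℝ) ≤ d := Nat.cast_nonneg d
    have hT0 : 0 ≤ T := by linarith
    have h2 : (3 * n + 2 + 2 * ((4 * d + 32) * 2 ^ K) + 2 * 2 ^ K : ℝ)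
        ≤ 2 ^ K * (3 * n + 8 * d + 68) := by nlinarith
    have h3 : (2 : ℝ) ^ K * (3 * n + 8 * d + 68) ≤ 2 ^ K * (76 * T) :=
      mul_le_mul_of_nonneg_left (by linarith) (by positivity)
    have h4 : (2 : ℝ) ^ K * (100 * T) ≤ 2 * (X / ε) * (100 * T) :=
      mul_le_mul_of_nonneg_right hK2 (by linarith)
    calc _ ≤ _ := hPtime r T hT0
      _ ≤ (2 : ℝ) ^ K * (100 * T) := by linarith
      _ ≤ _ := h4
      _ = _ := by ring
  · let a : Fin N → ℝ := fun j => overlap O 1 j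
    let b : Fin N → ℝ := fun j => overlap O Complex.I j
    let bad : Fin N → Finset (Fin R) := fun j =>
      (Finset.univ.filter fun r => BadSeed g (a j) r) ∪
        (Finset.univ.filter fun r => BadSeed g (b j) r)
    have hbad : ∀ j, (bad j).card ≤ 2 := fun j =>
      (Finset.card_union_le _ _).trans
        (Nat.add_le_add (card_badSeed_le hg0 (a j) R) (card_badSeed_le hg0 (b j) R))
    refine ⟨_, (?_ : (1 - δ) * (R : ℝ) ≤ (1 - δ') * R).trans
      (card_good_seeds hN bad hbad hβ0 hRβ), fun r hr => ?_⟩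
    · exact mul_le_mul_of_nonneg_right (by linarith) hR0'.le
    let s : Fin N → ℂ := fun j => if r ∈ bad j then inner ℂ (u j) (v j) else
      (roundTo g (r / R) (a j) : ℂ) + (roundTo g (r / R) (b j) : ℂ) * Complex.I
    refine ⟨s, fun j => ?_, ?_⟩
    · by_cases hj : r ∈ bad j
      · simp only [s, if_pos hj, sub_self, norm_zero]
        exact hε.le
      · have h1 : s j - inner ℂ (u j) (v j) = ((roundTo g (r / R) (a j) - a j : ℝ) : ℂ)
            + ((roundTo g (r / R) (b j) - b j : ℝ) : ℂ) * Complex.I := by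
          simp only [s, if_neg hj, a, b]
          rw [overlap_one O _ _ j (hu j) (hv j), overlap_I O _ _ j (hu j) (hv j)]
          push_cast
          linear_combination Complex.re_add_im (inner ℂ (u j) (v j))
        rw [h1]
        refine (norm_add_le _ _).trans ?_
        rw [norm_mul, Complex.norm_I, mul_one, Complex.norm_real, Complex.norm_real]
        have h2 := abs_roundTo_sub_le hg0 (r / R) (a j)
        have h3 := abs_roundTo_sub_le hg0 (r / R) (b j)
        rw [Real.norm_eq_abs, Real.norm_eq_abs]
        linarith
    · have hrun : Circuit.run O (P r) = (estBoth ρ ρ' O).symm (xorOp (evalBits O (S r))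
          (estBoth ρ ρ' O (uniformState (N := N) n _ fun _ _ => false))) := by
        rw [Circuit.run, hPrun, ← uniformOp_apply hN hNn t]
        rfl
      rw [hrun]
      refine (norm_final_sub_le ρ ρ' hρ O hN (S r) s (Finset.univ.filter fun j => r ∈ bad j)
        η β p δ' hη0 (Finset.mem_filter.1 hr).2 (error_bound hη0 hp0 (le_trans ?_ hK1)) ?_ hδ'0.le
        ?_).trans hδ'δ
      · refine le_of_eq ?_
        rw [hη, hg, hX]
        field_simp
        norm_num
      · intro j hj x h1 h2
        have hj' : r ∉ bad j := fun h => hj (Finset.mem_filter.2 ⟨Finset.mem_univ _, h⟩)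
        have h3 : ¬ BadSeed g (a j) r := fun h => hj' (Finset.mem_union_left _
          (Finset.mem_filter.2 ⟨Finset.mem_univ _, h⟩))
        have h4 : ¬ BadSeed g (b j) r := fun h => hj' (Finset.mem_union_right _
          (Finset.mem_filter.2 ⟨Finset.mem_univ _, h⟩))
        have h5 : roundTo g (r / R) (Real.cos (estimatedPhase (readResult ρ x) K))
            = roundTo g (r / R) (a j) := by
          by_contra h
          exact h3 ⟨_, h1, h⟩
        have h6 : roundTo g (r / R) (Real.cos (estimatedPhase (readResult ρ' x) K))
            = roundTo g (r / R) (b j) := by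
          by_contra h
          exact h4 ⟨_, h2, h⟩
        simp only [s, if_neg hj']
        rw [← h5, ← h6]
        rfl
      · rw [hβ, hp]
        linarith
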